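/- **Setting.** Let $q\ge 1$ be an integer and consider, for $t>0$, the planar system $$\dot x=\partial_yH(x,y,t),\qquad \dot y=-\partial_xH(x,y,t)+F(x,y,t),\tag{1}$$ where $H,F$ are infinitely differentiable on $\mathbb R^2\times(0,\infty)$, $\partial_xH(0,0,t)=\partial_yH(0,0,t)=F(0,0,t)=0$ for all $t>0$, and, as $t\to\infty$, $$H(x,y,t)\sim H_0(x,y)+\sum_{k\ge1}t^{-k/q}H_k(x,y),\qquad F(x,y,t)\sim\sum_{k\ge1}t^{-k/q}F_k(x,y)$$ with smooth $H_k,F_k$ and $H_0=\frac{x^2+y^2}2+O(r^3)$ as $r=\sqrt{x^2+y^2}\to0$. These are asymptotic series, uniform on compact subsets of the plane, that may be differentiated term by term in $(x,y)$ (twice for $H$, once for $F$). For $0<E\le E_0$ let $\varphi\mapsto(X(\varphi,E),Y(\varphi,E))$ be the closed orbit around the origin of the limiting system $\dot x=\partial_yH_0$, $\dot y=-\partial_xH_0$ on the level $H_0=E$, with least period $2\pi/\omega(E)$, parametrized by $\varphi=\omega(E)t$, so that it is $2\pi$-periodic in $\varphi$; the initial phases are chosen so that $X,Y$ are smooth functions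 of $(\varphi,\sqrt E)$ on $\mathbb R\times[0,\sqrt{E_0}]$, vanishing at $E=0$. With $H_k,F_k$ evaluated at $(X,Y)$ put $$f_k=-\omega\big(\partial_\varphi H_k-F_k\,\partial_\varphi X\big),\qquad g_k=\omega\big(\partial_E H_k-F_k\,\partial_EX\big),$$ and, with $\langle\cdot\rangle$ the mean over $\varphi\in[0,2\pi]$, define recursively for $k\ge1$ $$Z_k=\sum_{j=1}^{k-1}\sum_{p=1}^{k-j}\frac1{p!}\Lambda_j^{(p)}\!\!\sum_{\substack{i_1+\dots+i_p=k-j\\ i_1,\dots,i_p\ge1}}\!\!v_{i_1}\cdots v_{i_p}-\sum_{j=1}^{k-1}\big(f_j\,\partial_Ev_{k-j}+g_j\,\partial_\varphi v_{k-j}\big)+\frac{k-q}{q}\,v_{k-q},$$ $$\Lambda_k=\langle f_k\rangle-\langle Z_k\rangle,\qquad v_k=H_k(X,Y)-H_k(0,0)+\frac1\omega\int_0^\varphi\big(\Lambda_k-\omega F_k\,\partial_\phi X+Z_k\big)\,d\phi ,$$ where $v_{i}=0$ for $i\le0$. (Thus $v=E+\sum_{k=1}^{N}t^{-k/q}v_k(E,\varphi)$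 formally satisfies $\dot v=\sum_{k=1}^Nt^{-k/q}\Lambda_k(v)+O(t^{-(N+1)/q})$ along (1).) The equilibrium $(0,0)$ of (1) is called * *stable* if for all $t_0>0$ and $\varepsilon>0$ there is $\delta>0$ such that from every initial point with $r(t_0)<\delta$ a solution on $[t_0,\infty)$ exists and every such solution satisfies $r(t)<\varepsilon$ for all $t\ge t_0$; * *polynomially stable* if it is stable and there is $\kappa>0$ such that for every $t_0>0$ there are $\delta>0$ and $C$ with $r(t)\le C\,t^{-\kappa}$ for all $t\ge t_0$ and all solutions with $r(t_0)<\delta$; * *exponentially stable* (with exponent $a>0$) if it is stable and there is $c>0$ such that for every $t_0>0$ there are $\delta>0$ and $C$ with $r(t)\le C\,r(t_0)\exp\!\big(-c\,(t^{a}-t_0^{a})\big)$ for all $t\ge t_0$ and all solutions with $r(t_0)<\delta$. **Statement.** Let $1\le m<n$ and $s\ge2$ be integers and let $\gamma_{m,s},\lambda_n$ be nonzero real constants such that $\Lambda_k\equiv0$ on $(0,E_0)$ for $1\le k<m$ and, as $v\to0^+$, $$\Lambda_m(v)=\gamma_{m,s}v^s+O(v^{s+1}),\qquad \Lambda_j(v)=O(v^s)\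 \ (m\le j<n),\qquad \Lambda_n(v)=\lambda_nv+O(v^2).$$ Then: * if $m<n<q$, the equilibrium $(0,0)$ of (1) is exponentially stable, with exponent $a=1-\frac nq$, when $\lambda_n<0$, and polynomially stable when $\lambda_n>0$ and $\gamma_{m,s}<0$; * if $m<n=q$, it is polynomially stable when $\lambda_n+\frac{n-m}{q(s-1)}<0$, and also when $\lambda_n+\frac{n-m}{q(s-1)}>0$ and $\gamma_{m,s}<0$; * if $m<q<n$, it is polynomially stable when $\gamma_{m,s}<0$; * if $q\le m<n$, it is stable when $\gamma_{m,s}<0$. -/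

import Mathlib

open Set Filter Topology Asymptotics

noncomputable section

/-- Euclidean norm `r = √(x² + y²)` of a point of the plane. -/
def planeNorm (z : ℝ × ℝ) : ℝ := √(z.1 ^ 2 + z.2 ^ 2)

/-- Partial derivative of `h` in the first coordinate. -/
def partialX (h : ℝ × ℝ → ℝ) (z : ℝ × ℝ) : ℝ := deriv (fun x => h (x, z.2)) z.1

/-- Partial derivative of `h` in the second coordinate. -/
def partialY (h : ℝ × ℝ → ℝ) (z : ℝ × ℝ) : ℝ := deriv (fun y => h (z.1, y)) z.2

/-- `G(z,t) ~ ∑_{k ≥ 1} t^{-k/q} c_k(z)` as `t → ∞`: an asymptotic series, uniform on compact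
sets, which may be differentiated term by term up to `r` times in `z`. -/
def HasPowerAsymptotics (q r : ℕ) (G : ℝ × ℝ → ℝ → ℝ) (c : ℕ → ℝ × ℝ → ℝ) : Prop :=
  ∀ (N : ℕ) (K : Set (ℝ × ℝ)), IsCompact K → ∀ j ≤ r, ∃ C T : ℝ, 0 < T ∧
    ∀ t ≥ T, ∀ z ∈ K,
      ‖iteratedFDeriv ℝ j
          (fun w => G w t - ∑ k ∈ Finset.Icc 1 N, t ^ (-(k : ℝ) / (q : ℝ)) * c k w) z‖
        ≤ C * t ^ (-((N : ℝ) + 1) / (q : ℝ))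

/-- The system `x' = ∂_y H(x,y,t)`, `y' = -∂_x H(x,y,t) + F(x,y,t)`, `t > 0`, with the standing
assumptions on `H`, `F` and on the coefficients of their expansions. The limiting Hamiltonian
`H_0` is `Hc 0`; `Fc 0` is not used. -/
structure AsympHamSystem where
  q : ℕ
  H : ℝ × ℝ → ℝ → ℝ
  F : ℝ × ℝ → ℝ → ℝ
  Hc : ℕ → ℝ × ℝ → ℝ
  Fc : ℕ → ℝ × ℝ → ℝ
  q_pos : 0 < q
  smooth_H : ContDiffOn ℝ (⊤ : ℕ∞) (fun p : (ℝ × ℝ) × ℝ => H p.1 p.2) {p | 0 < p.2}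
  smooth_F : ContDiffOn ℝ (⊤ : ℕ∞) (fun p : (ℝ × ℝ) × ℝ => F p.1 p.2) {p | 0 < p.2}
  smooth_Hc : ∀ k, ContDiff ℝ (⊤ : ℕ∞) (Hc k)
  smooth_Fc : ∀ k, 1 ≤ k → ContDiff ℝ (⊤ : ℕ∞) (Fc k)
  center : (fun z : ℝ × ℝ => Hc 0 z - (z.1 ^ 2 + z.2 ^ 2) / 2)
    =O[𝓝 (0 : ℝ × ℝ)] (fun z => planeNorm z ^ 3)
  asymp_H : HasPowerAsymptotics q 2 (fun z t => H z t - Hc 0 z) Hc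
  asymp_F : HasPowerAsymptotics q 1 F Fc
  partialX_zero : ∀ t > (0 : ℝ), partialX (fun z => H z t) (0, 0) = 0
  partialY_zero : ∀ t > (0 : ℝ), partialY (fun z => H z t) (0, 0) = 0
  F_zero : ∀ t > (0 : ℝ), F (0, 0) t = 0

namespace AsympHamSystem

/-- Right-hand side of the system. -/
def field (S : AsympHamSystem) (t : ℝ) (z : ℝ × ℝ) : ℝ × ℝ :=
  (partialY (fun w => S.H w t) z, -partialX (fun w => S.H w t) z + S.F z t)

/-- `z` solves the system on `[t₀, ∞)`. -/
def IsSolution (S : AsympHamSystem) (t₀ : ℝ) (z : ℝ → ℝ × ℝ) : Prop :=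
  ∀ t ∈ Ici t₀, HasDerivWithinAt z (S.field t (z t)) (Ici t₀) t

/-- Lyapunov stability of the equilibrium `(0,0)`; `δ` may depend on the initial time. -/
def Stable (S : AsympHamSystem) : Prop :=
  ∀ t₀ > (0 : ℝ), ∀ ε > (0 : ℝ), ∃ δ > (0 : ℝ), ∀ z₀ : ℝ × ℝ, planeNorm z₀ < δ →
    (∃ z, S.IsSolution t₀ z ∧ z t₀ = z₀) ∧
    ∀ z, S.IsSolution t₀ z → z t₀ = z₀ → ∀ t ≥ t₀, planeNorm (z t) < ε

/-- Stability together with decay of all nearby solutions at some fixed power rate. -/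
def PolynomiallyStable (S : AsympHamSystem) : Prop :=
  S.Stable ∧ ∃ κ > (0 : ℝ), ∀ t₀ > (0 : ℝ), ∃ δ > (0 : ℝ), ∃ C : ℝ, ∀ z, S.IsSolution t₀ z →
    planeNorm (z t₀) < δ → ∀ t ≥ t₀, planeNorm (z t) ≤ C * t ^ (-κ)

/-- Stability together with decay of all nearby solutions like `exp (-c t^a)`, proportionally
to the size of the initial value. -/
def ExponentiallyStable (S : AsympHamSystem) (a : ℝ) : Prop :=
  S.Stable ∧ ∃ c > (0 : ℝ), ∀ t₀ > (0 : ℝ), ∃ δ > (0 : ℝ), ∃ C : ℝ, ∀ z, S.IsSolution t₀ z →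
    planeNorm (z t₀) < δ → ∀ t ≥ t₀,
      planeNorm (z t) ≤ C * planeNorm (z t₀) * Real.exp (-c * (t ^ a - t₀ ^ a))

/-- Energy-angle coordinates of the limiting system: for `0 < E ≤ E₀` the curve
`φ ↦ (X φ E, Y φ E)` is the closed orbit around the origin on the level `H_0 = E`, of least period
`2π / ω(E)` in time, run through with `φ = ω(E) t`. The initial phase on each orbit is chosen so
that the coordinates are smooth in `(φ, √E)`; the value `E = 0` corresponds to the equilibrium. -/
structure EnergyAngle (S : AsympHamSystem) where
  E₀ : ℝ
  ω : ℝ → ℝ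
  X : ℝ → ℝ → ℝ
  Y : ℝ → ℝ → ℝ
  E₀_pos : 0 < E₀
  ω_pos : ∀ E ∈ Ioc 0 E₀, 0 < ω E
  hasDeriv_X : ∀ E ∈ Ioc 0 E₀, ∀ φ,
    HasDerivAt (fun u => X u E) (partialY (S.Hc 0) (X φ E, Y φ E) / ω E) φ
  hasDeriv_Y : ∀ E ∈ Ioc 0 E₀, ∀ φ,
    HasDerivAt (fun u => Y u E) (-partialX (S.Hc 0) (X φ E, Y φ E) / ω E) φ
  energy : ∀ E ∈ Ioc 0 E₀, ∀ φ, S.Hc 0 (X φ E, Y φ E) = E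
  periodic : ∀ E ∈ Ioc 0 E₀, ∀ φ,
    X (φ + 2 * Real.pi) E = X φ E ∧ Y (φ + 2 * Real.pi) E = Y φ E
  least_period : ∀ E ∈ Ioc 0 E₀, InjOn (fun φ => (X φ E, Y φ E)) (Ico 0 (2 * Real.pi))
  at_zero : ∀ φ, X φ 0 = 0 ∧ Y φ 0 = 0
  smooth : ContDiffOn ℝ (⊤ : ℕ∞) (fun p : ℝ × ℝ => (X p.1 (p.2 ^ 2), Y p.1 (p.2 ^ 2)))
    (univ ×ˢ Icc 0 (√E₀))

namespace EnergyAngle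

variable {S : AsympHamSystem}

/-- Mean value over one period in the angle. -/
def mean (h : ℝ → ℝ) : ℝ := (1 / (2 * Real.pi)) * ∫ φ in (0 : ℝ)..(2 * Real.pi), h φ

/-- `∂_φ X (φ, E)`. -/
def dφX (A : S.EnergyAngle) (E φ : ℝ) : ℝ := deriv (fun u => A.X u E) φ

/-- `∂_E X (φ, E)`. -/
def dEX (A : S.EnergyAngle) (E φ : ℝ) : ℝ := deriv (fun e => A.X φ e) E

/-- `f_k(E,φ) = -ω (∂_φ [H_k(X,Y)] - F_k(X,Y) ∂_φ X)`. -/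
def f (A : S.EnergyAngle) (k : ℕ) (E φ : ℝ) : ℝ :=
  -A.ω E * (deriv (fun u => S.Hc k (A.X u E, A.Y u E)) φ
    - S.Fc k (A.X φ E, A.Y φ E) * A.dφX E φ)

/-- `g_k(E,φ) = ω (∂_E [H_k(X,Y)] - F_k(X,Y) ∂_E X)`. -/
def g (A : S.EnergyAngle) (k : ℕ) (E φ : ℝ) : ℝ :=
  A.ω E * (deriv (fun e => S.Hc k (A.X φ e, A.Y φ e)) E
    - S.Fc k (A.X φ E, A.Y φ E) * A.dEX E φ)

/-- The expression `Z_k` in terms of `Λ_1, …, Λ_{k-1}` and `v_1, …, v_{k-1}`. The first sum is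
the coefficient of `t^{-k/q}` in the Taylor expansion of
`∑_j t^{-j/q} (Λ_j(E + ∑_i t^{-i/q} v_i) - Λ_j(E))`; its inner sum runs over the ordered
`p`-tuples of positive integers with sum `k - j`. -/
def zExpr (A : S.EnergyAngle) (L : ℕ → ℝ → ℝ) (v : ℕ → ℝ → ℝ → ℝ) (k : ℕ) (E φ : ℝ) : ℝ :=
  (∑ j ∈ Finset.Icc 1 (k - 1), ∑ p ∈ Finset.Icc 1 (k - j),
      (1 / (p.factorial : ℝ)) * iteratedDeriv p (L j) E *
        ∑ a ∈ (Finset.Nat.antidiagonalTuple p (k - j)).filter (fun a => ∀ i, 1 ≤ a i),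
          ∏ i, v (a i) E φ)
  - (∑ j ∈ Finset.Icc 1 (k - 1),
      (A.f j E φ * deriv (fun e => v (k - j) e φ) E
        + A.g j E φ * deriv (fun u => v (k - j) E u) φ))
  + (if S.q < k then (((k : ℝ) - (S.q : ℝ)) / (S.q : ℝ)) * v (k - S.q) E φ else 0)

/-- `Λ_k = ⟨f_k⟩ - ⟨Z_k⟩`, from the lower-order coefficients. -/
def nextLam (A : S.EnergyAngle) (L : ℕ → ℝ → ℝ) (v : ℕ → ℝ → ℝ → ℝ) (k : ℕ) (E : ℝ) : ℝ :=
  mean (A.f k E) - mean (A.zExpr L v k E)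

/-- The `2π`-periodic solution `v_k` of `ω ∂_φ v_k = Λ_k - f_k + Z_k`, from the lower-order
coefficients. The constant `H_k(0,0)`, on which the system does not depend, is subtracted, so
that `v_k` vanishes at `E = 0`. -/
def nextV (A : S.EnergyAngle) (L : ℕ → ℝ → ℝ) (v : ℕ → ℝ → ℝ → ℝ) (k : ℕ) (E φ : ℝ) : ℝ :=
  S.Hc k (A.X φ E, A.Y φ E) - S.Hc k (0, 0)
    + (1 / A.ω E) * ∫ u in (0 : ℝ)..φ,
        (A.nextLam L v k E - A.ω E * S.Fc k (A.X u E, A.Y u E) * A.dφX E u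
          + A.zExpr L v k E u)

/-- The sequences `(Λ_j)` and `(v_j)`, filled in for `1 ≤ j ≤ N`. -/
def coeffs (A : S.EnergyAngle) : ℕ → (ℕ → ℝ → ℝ) × (ℕ → ℝ → ℝ → ℝ)
  | 0 => (fun _ _ => 0, fun _ _ _ => 0)
  | N + 1 =>
    (Function.update (coeffs A N).1 (N + 1)
        (A.nextLam (coeffs A N).1 (coeffs A N).2 (N + 1)),
      Function.update (coeffs A N).2 (N + 1)
        (A.nextV (coeffs A N).1 (coeffs A N).2 (N + 1)))

/-- The functions `Λ_k` of the averaged equation. -/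
def Lam (A : S.EnergyAngle) (k : ℕ) : ℝ → ℝ := (A.coeffs k).1 k

/-- The coefficients `v_k` of `V_N(E,φ,t) = E + ∑_{k=1}^N t^{-k/q} v_k(E,φ)`. -/
def v (A : S.EnergyAngle) (k : ℕ) : ℝ → ℝ → ℝ := (A.coeffs k).2 k

theorem coeffs_of_le (A : S.EnergyAngle) {j N : ℕ} (h : j ≤ N) :
    (A.coeffs N).1 j = A.Lam j ∧ (A.coeffs N).2 j = A.v j := by
  induction N with
  | zero =>
    obtain rfl : j = 0 := by omega
    exact ⟨rfl, rfl⟩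
  | succ N ih =>
    rcases Nat.lt_or_ge j (N + 1) with hj | hj
    · have hne : j ≠ N + 1 := by omega
      simpa [coeffs, Function.update_of_ne hne] using ih (by omega)
    · obtain rfl : j = N + 1 := by omega
      exact ⟨rfl, rfl⟩

theorem zExpr_congr (A : S.EnergyAngle) {L L' : ℕ → ℝ → ℝ} {w w' : ℕ → ℝ → ℝ → ℝ} {k : ℕ}
    (hL : ∀ j < k, L j = L' j) (hw : ∀ j < k, w j = w' j) :
    A.zExpr L w k = A.zExpr L' w' k := by
  funext E φ
  unfold zExpr
  have hq := S.q_pos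
  congr 1
  · congr 1
    · refine Finset.sum_congr rfl fun j hj => Finset.sum_congr rfl fun p _ => ?_
      rw [Finset.mem_Icc] at hj
      rw [hL j (by omega)]
      congr 1
      refine Finset.sum_congr rfl fun a ha => Finset.prod_congr rfl fun i _ => ?_
      rw [Finset.mem_filter, Finset.Nat.mem_antidiagonalTuple] at ha
      have h1 : a i ≤ ∑ i, a i := Finset.single_le_sum (fun _ _ => Nat.zero_le _)
        (Finset.mem_univ i)
      rw [hw (a i) (by omega)]
    · refine Finset.sum_congr rfl fun j hj => ?_
      rw [Finset.mem_Icc] at hj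
      rw [hw (k - j) (by omega)]
  · split_ifs with h
    · rw [hw (k - S.q) (by omega)]
    · rfl

/-- `Λ_k = ⟨f_k⟩ - ⟨Z_k⟩`. -/
theorem Lam_eq (A : S.EnergyAngle) {k : ℕ} (hk : 1 ≤ k) (E : ℝ) :
    A.Lam k E = mean (A.f k E) - mean (A.zExpr A.Lam A.v k E) := by
  obtain ⟨N, rfl⟩ : ∃ N, k = N + 1 := ⟨k - 1, by omega⟩
  have h := A.zExpr_congr (L := (A.coeffs N).1) (w := (A.coeffs N).2) (k := N + 1)
    (fun j hj => (A.coeffs_of_le (j := j) (N := N) (by omega)).1)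
    (fun j hj => (A.coeffs_of_le (j := j) (N := N) (by omega)).2)
  simp [Lam, coeffs, nextLam, h]

/-- `v_k = H_k(X,Y) - H_k(0,0) + ω⁻¹ ∫_0^φ (Λ_k - ω F_k(X,Y) ∂_φ X + Z_k)`. -/
theorem v_eq (A : S.EnergyAngle) {k : ℕ} (hk : 1 ≤ k) (E φ : ℝ) :
    A.v k E φ = S.Hc k (A.X φ E, A.Y φ E) - S.Hc k (0, 0)
      + (1 / A.ω E) * ∫ u in (0 : ℝ)..φ,
        (A.Lam k E - A.ω E * S.Fc k (A.X u E, A.Y u E) * A.dφX E u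
          + A.zExpr A.Lam A.v k E u) := by
  obtain ⟨N, rfl⟩ : ∃ N, k = N + 1 := ⟨k - 1, by omega⟩
  have h := A.zExpr_congr (L := (A.coeffs N).1) (w := (A.coeffs N).2) (k := N + 1)
    (fun j hj => (A.coeffs_of_le (j := j) (N := N) (by omega)).1)
    (fun j hj => (A.coeffs_of_le (j := j) (N := N) (by omega)).2)
  have hL : A.nextLam (A.coeffs N).1 (A.coeffs N).2 (N + 1) E = A.Lam (N + 1) E := by
    simp [Lam, coeffs]
  simp only [v, coeffs, nextV, Function.update_self, hL]
  rw [h]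

end EnergyAngle

end AsympHamSystem

end

/-! ### Differentiation under the integral sign for bounded integrands -/

/-! The proof is averaging combined with a Lyapunov function. The function `V = E + ∑ t^{-k/q} v_k`,
summed up to `k = n`, is a near-identity change of the energy. Each `v_k` is a periodic solution of
the homological equation `ω ∂_φ v_k = Λ_k - f_k + Z_k`, solvable because `Λ_k` is chosen to make the
mean of the right-hand side vanish. Along solutions all oscillating terms of order up to `t^{-n/q}`
then cancel, and what remains is `∑ t^{-k/q} (Λ_k(E) + Taylor correction)` (`lyapDeriv_eq`).

The remainder has to be small near the equilibrium as well as for large times: it must be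
`O(t^{-(n+1)/q} E)`, or it would swamp the linear term `λ t^{-n/q} E`. Every coefficient is
therefore tracked as a power of `√E` times a function smooth in `(φ, √E)` (`SmoothOfOrder`). An
energy derivative costs two orders, but `f_j` has order two and `g_j` order zero, so the recursion
keeps `Λ_k` and `v_k` at order two, that is `O(E)`. In the Taylor correction, `p` derivatives of
`Λ_j` lose `2p` orders and the `p` factors `v_i` return them, so this correction is `O(E^s)` like
the `Λ_j` that enter it. To pass from coordinates to solutions, the energy-angle coordinates must
cover a punctured neighbourhood of the origin, which follows from an open-closed argument
(`exists_toPlane_eq`).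

The outcome is `exists_lyap_ineq`: `V` is comparable to `r²` and satisfies `V' ≤ a t^{-m/q} V^s + b
t^{-l/q} V` for any `a > γ`, `b > λ`, with `l = n`, or with any `l ≤ n` when `b ≥ 0`. The curve `M
t^{-κ}` with `κ (s - 1) = (l - m)/q` balances the two terms and is a barrier once `κ < -(a M^{s-1} +
b) t^{1-l/q}` (`le_mul_rpow_of_deriv_le`). A large `M` achieves this when `γ < 0`; a small `M` does
when the linear part is damping strongly enough. If `λ < 0` and `n < q`, the nonlinear term is
dominated below the barrier and the remaining linear inequality integrates to exponential decay. If
`q ≤ m` and `γ < 0`, the nonlinear term can be dropped and the linear coefficient is integrable in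
time.

These estimates hold from late starting times and inside a small ball. Gronwall's inequality on a
compact time interval carries them to every `t₀`, and global existence comes from a clamped vector
field together with the same a priori bounds. -/

theorem intervalIntegrable_of_continuousOn_of_abs_le {f : ℝ → ℝ} {a b C : ℝ}
    (hf : ContinuousOn f (uIoc a b)) (hC : ∀ x ∈ uIoc a b, |f x| ≤ C) :
    IntervalIntegrable f MeasureTheory.volume a b := by
  rw [intervalIntegrable_iff]
  exact MeasureTheory.IntegrableOn.of_bound (by simp [uIoc]) 
    (hf.aestronglyMeasurable measurableSet_uIoc) C
    ((MeasureTheory.ae_restrict_iff' measurableSet_uIoc).2 (Eventually.of_forall hC))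

/-- A constant dominates because the interval is finite. Continuity is asked only on the half-open
interval, since integrands such as `u (σ² E) φ` are uncontrolled at `σ = 0`. -/
theorem hasDerivAt_intervalIntegral_of_abs_le {F F' : ℝ → ℝ → ℝ} {a b x₀ C : ℝ} {s : Set ℝ}
    (hs : s ∈ 𝓝 x₀) (hF : ∀ x ∈ s, ContinuousOn (F x) (uIoc a b))
    (hFC : ∀ y ∈ uIoc a b, |F x₀ y| ≤ C) (hF' : ContinuousOn (F' x₀) (uIoc a b))
    (hF'C : ∀ y ∈ uIoc a b, ∀ x ∈ s, |F' x y| ≤ C)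
    (hd : ∀ y ∈ uIoc a b, ∀ x ∈ s, HasDerivAt (fun x => F x y) (F' x y) x) :
    HasDerivAt (fun x => ∫ y in a..b, F x y) (∫ y in a..b, F' x₀ y) x₀ := by
  refine (intervalIntegral.hasDerivAt_integral_of_dominated_loc_of_deriv_le
    (bound := fun _ => C) hs ?_ ?_ ?_ ?_ ?_ ?_).2
  · filter_upwards [hs] with x hx
    exact (hF x hx).aestronglyMeasurable measurableSet_uIoc
  · exact intervalIntegrable_of_continuousOn_of_abs_le (hF x₀ (mem_of_mem_nhds hs)) hFC
  · exact hF'.aestronglyMeasurable measurableSet_uIoc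
  · exact Eventually.of_forall fun y hy x hx => hF'C y hy x hx
  · simp
  · exact Eventually.of_forall fun y hy x hx => hd y hy x hx

/-! ### Functions of energy and angle that are smooth in the angle and in `√E` -/

/-- Derivative in the angle. -/
noncomputable def angleDeriv (u : ℝ → ℝ → ℝ) (E φ : ℝ) : ℝ := deriv (u E) φ

/-- Derivative in the radial variable `√E`. -/
noncomputable def radialDeriv (u : ℝ → ℝ → ℝ) (E φ : ℝ) : ℝ := 2 * √E * deriv (fun e => u e φ) E

/-- Bounded for `0 < E < R`, locally uniformly in the angle. -/
def AngleBdd (R : ℝ) (u : ℝ → ℝ → ℝ) : Prop :=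
  ∀ M, ∃ C, ∀ E ∈ Ioo 0 R, ∀ φ ∈ Icc (-M) M, |u E φ| ≤ C

/-- All derivatives in the angle and in `√E` up to order `k` exist for `0 < E < R` and are bounded,
locally uniformly in the angle. -/
def BddSmooth (R : ℝ) : ℕ → (ℝ → ℝ → ℝ) → Prop
  | 0, u => AngleBdd R u
  | k + 1, u => AngleBdd R u ∧ (∀ E ∈ Ioo 0 R, ∀ φ, DifferentiableAt ℝ (u E) φ) ∧
      (∀ E ∈ Ioo 0 R, ∀ φ, DifferentiableAt ℝ (fun e => u e φ) E) ∧
      BddSmooth R k (angleDeriv u) ∧ BddSmooth R k (radialDeriv u)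

namespace BddSmooth

variable {R : ℝ} {k : ℕ} {u w : ℝ → ℝ → ℝ}

theorem bdd (h : BddSmooth R k u) : AngleBdd R u := by
  cases k with
  | zero => exact h
  | succ k => exact h.1

theorem bdd_of_abs_le (h : AngleBdd R u) {C : ℝ} 
    (hw : ∀ E ∈ Ioo 0 R, ∀ φ, |w E φ| ≤ C * |u E φ|) : AngleBdd R w := by
  intro M
  obtain ⟨D, hD⟩ := h M
  refine ⟨|C| * D, fun E hE φ hφ => (hw E hE φ).trans ?_⟩
  exact mul_le_mul (le_abs_self C) (hD E hE φ hφ) (abs_nonneg _) (abs_nonneg _)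

theorem mono_one (h : BddSmooth R (k + 1) u) : BddSmooth R k u := by
  induction k generalizing u with
  | zero => exact h.1
  | succ k ih => exact ⟨h.1, h.2.1, h.2.2.1, ih h.2.2.2.1, ih h.2.2.2.2⟩

theorem hasDerivAt_angle (h : BddSmooth R (k + 1) u) {E : ℝ} (hE : E ∈ Ioo 0 R) (φ : ℝ) :
    HasDerivAt (u E) (angleDeriv u E φ) φ := (h.2.1 E hE φ).hasDerivAt

theorem hasDerivAt_radial (h : BddSmooth R (k + 1) u) {E : ℝ} (hE : E ∈ Ioo 0 R) (φ : ℝ) :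
    HasDerivAt (fun e => u e φ) (radialDeriv u E φ / (2 * √E)) E := by
  have h1 := (h.2.2.1 E hE φ).hasDerivAt
  have h2 : 0 < √E := Real.sqrt_pos.2 hE.1
  refine HasDerivAt.congr_deriv h1 ?_
  simp only [radialDeriv]
  field_simp

theorem congr (h : BddSmooth R k u) (huw : ∀ E ∈ Ioo 0 R, ∀ φ, w E φ = u E φ) :
    BddSmooth R k w := by
  have hb : ∀ {u w : ℝ → ℝ → ℝ}, AngleBdd R u → (∀ E ∈ Ioo 0 R, ∀ φ, w E φ = u E φ) →
      AngleBdd R w := fun h huw =>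
    bdd_of_abs_le h (C := 1) fun E hE φ => by rw [huw E hE φ, one_mul]
  induction k generalizing u w with
  | zero => exact hb h huw
  | succ k ih =>
    have e1 : ∀ E ∈ Ioo 0 R, w E = u E := fun E hE => funext (huw E hE)
    have e2 : ∀ E ∈ Ioo 0 R, ∀ φ, (fun e => w e φ) =ᶠ[𝓝 E] (fun e => u e φ) := fun E hE φ => by
      filter_upwards [isOpen_Ioo.mem_nhds hE] with e he using huw e he φ
    refine ⟨hb h.1 huw, fun E hE φ => ?_, fun E hE φ => ?_, ?_, ?_⟩
    · rw [e1 E hE]; exact h.2.1 E hE φ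
    · exact (e2 E hE φ).differentiableAt_iff.2 (h.2.2.1 E hE φ)
    · exact ih h.2.2.2.1 fun E hE φ => by simp only [angleDeriv, e1 E hE]
    · exact ih h.2.2.2.2 fun E hE φ => by simp only [radialDeriv, (e2 E hE φ).deriv_eq]

/-- The induction step behind the closure properties: it suffices to exhibit the two derivatives.
The divisor `2√E` in the energy derivative reflects `∂/∂√E = 2√E ∂/∂E`. -/
theorem succ_intro {u₁ u₂ : ℝ → ℝ → ℝ} (h : AngleBdd R u)
    (h1 : ∀ E ∈ Ioo 0 R, ∀ φ, HasDerivAt (u E) (u₁ E φ) φ)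
    (h2 : ∀ E ∈ Ioo 0 R, ∀ φ, HasDerivAt (fun e => u e φ) (u₂ E φ / (2 * √E)) E)
    (b1 : BddSmooth R k u₁) (b2 : BddSmooth R k u₂) : BddSmooth R (k + 1) u := by
  refine ⟨h, fun E hE φ => (h1 E hE φ).differentiableAt,
    fun E hE φ => (h2 E hE φ).differentiableAt, b1.congr fun E hE φ => (h1 E hE φ).deriv,
    b2.congr fun E hE φ => ?_⟩
  have h3 : 0 < √E := Real.sqrt_pos.2 hE.1
  simp only [radialDeriv, (h2 E hE φ).deriv]
  field_simp

theorem const (c : ℝ) : BddSmooth R k (fun _ _ => c) := by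
  induction k generalizing c with
  | zero => exact fun M => ⟨|c|, fun _ _ _ _ => le_rfl⟩
  | succ k ih =>
    exact succ_intro (fun M => ⟨|c|, fun _ _ _ _ => le_rfl⟩) (u₁ := fun _ _ => 0)
      (u₂ := fun _ _ => 0) (fun E _ φ => hasDerivAt_const φ c)
      (fun E _ φ => by simpa using hasDerivAt_const E c) (ih 0) (ih 0)

theorem sqrt : BddSmooth R k (fun E _ => √E) := by
  have hb : AngleBdd R (fun E _ => √E) := fun M => ⟨√R, fun E hE φ _ => by
    rw [abs_of_nonneg (Real.sqrt_nonneg _)]; exact Real.sqrt_le_sqrt hE.2.le⟩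
  cases k with
  | zero => exact hb
  | succ k =>
    exact succ_intro hb (u₁ := fun _ _ => 0) (u₂ := fun _ _ => 1)
      (fun E _ φ => hasDerivAt_const φ _)
      (fun E hE φ => Real.hasDerivAt_sqrt hE.1.ne') (const 0) (const 1)

theorem add (hu : BddSmooth R k u) (hw : BddSmooth R k w) :
    BddSmooth R k (fun E φ => u E φ + w E φ) := by
  have hb : ∀ {u w : ℝ → ℝ → ℝ}, AngleBdd R u → AngleBdd R w →
      AngleBdd R (fun E φ => u E φ + w E φ) := fun hu hw M => by
    obtain ⟨C, hC⟩ := hu M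
    obtain ⟨D, hD⟩ := hw M
    exact ⟨C + D, fun E hE φ hφ => (abs_add_le _ _).trans
      (add_le_add (hC E hE φ hφ) (hD E hE φ hφ))⟩
  induction k generalizing u w with
  | zero => exact hb hu hw
  | succ k ih =>
    refine succ_intro (hb hu.1 hw.1)
      (fun E hE φ => (hu.hasDerivAt_angle hE φ).add (hw.hasDerivAt_angle hE φ))
      (u₂ := fun E φ => radialDeriv u E φ + radialDeriv w E φ) (fun E hE φ => ?_)
      (ih hu.2.2.2.1 hw.2.2.2.1) (ih hu.2.2.2.2 hw.2.2.2.2)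
    rw [add_div]
    exact (hu.hasDerivAt_radial hE φ).add (hw.hasDerivAt_radial hE φ)

theorem mul (hu : BddSmooth R k u) (hw : BddSmooth R k w) :
    BddSmooth R k (fun E φ => u E φ * w E φ) := by
  have hb : ∀ {u w : ℝ → ℝ → ℝ}, AngleBdd R u → AngleBdd R w →
      AngleBdd R (fun E φ => u E φ * w E φ) := fun hu hw M => by
    obtain ⟨C, hC⟩ := hu M
    obtain ⟨D, hD⟩ := hw M
    refine ⟨C * D, fun E hE φ hφ => ?_⟩
    rw [abs_mul]
    exact mul_le_mul (hC E hE φ hφ) (hD E hE φ hφ) (abs_nonneg _)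
      ((abs_nonneg _).trans (hC E hE φ hφ))
  induction k generalizing u w with
  | zero => exact hb hu hw
  | succ k ih =>
    refine succ_intro (hb hu.1 hw.1)
      (fun E hE φ => (hu.hasDerivAt_angle hE φ).mul (hw.hasDerivAt_angle hE φ))
      (u₂ := fun E φ => radialDeriv u E φ * w E φ + u E φ * radialDeriv w E φ) (fun E hE φ => ?_)
      (add (ih hu.2.2.2.1 hw.mono_one) (ih hu.mono_one hw.2.2.2.1))
      (add (ih hu.2.2.2.2 hw.mono_one) (ih hu.mono_one hw.2.2.2.2))
    have := (hu.hasDerivAt_radial hE φ).mul (hw.hasDerivAt_radial hE φ)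
    refine HasDerivAt.congr_deriv this ?_
    ring

theorem inv (hu : BddSmooth R k u) {c : ℝ} (hc : 0 < c) (h : ∀ E ∈ Ioo 0 R, ∀ φ, c ≤ |u E φ|) :
    BddSmooth R k (fun E φ => (u E φ)⁻¹) := by
  have hb : AngleBdd R (fun E φ => (u E φ)⁻¹) := fun M => ⟨c⁻¹, fun E hE φ _ => by
    rw [abs_inv]; exact inv_anti₀ hc (h E hE φ)⟩
  have hne : ∀ E ∈ Ioo 0 R, ∀ φ, u E φ ≠ 0 := fun E hE φ =>
    abs_pos.1 (hc.trans_le (h E hE φ))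
  induction k with
  | zero => exact hb
  | succ k ih =>
    have hi := ih hu.mono_one
    refine succ_intro hb (u₁ := fun E φ => (-1 * angleDeriv u E φ) * ((u E φ)⁻¹ * (u E φ)⁻¹))
      (u₂ := fun E φ => (-1 * radialDeriv u E φ) * ((u E φ)⁻¹ * (u E φ)⁻¹))
      (fun E hE φ => ?_) (fun E hE φ => ?_)
      (mul (mul (const _) hu.2.2.2.1) (mul hi hi)) (mul (mul (const _) hu.2.2.2.2) (mul hi hi))
    · refine HasDerivAt.congr_deriv ((hu.hasDerivAt_angle hE φ).inv (hne E hE φ)) ?_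
      field_simp
    · refine HasDerivAt.congr_deriv ((hu.hasDerivAt_radial hE φ).inv (hne E hE φ)) ?_
      have := hne E hE φ
      have h3 : 0 < √E := Real.sqrt_pos.2 hE.1
      field_simp

theorem eval (hu : BddSmooth R k u) (φ₀ : ℝ) : BddSmooth R k (fun E _ => u E φ₀) := by
  have hb : ∀ {u : ℝ → ℝ → ℝ}, AngleBdd R u → AngleBdd R (fun E _ => u E φ₀) := fun h M => by
    obtain ⟨C, hC⟩ := h |φ₀|
    exact ⟨C, fun E hE _ _ => hC E hE φ₀ (abs_le.1 le_rfl)⟩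
  induction k generalizing u with
  | zero => exact hb hu
  | succ k ih =>
    exact succ_intro (hb hu.1) (u₁ := fun _ _ => 0) (u₂ := fun E _ => radialDeriv u E φ₀)
      (fun E _ φ => hasDerivAt_const φ _) (fun E hE φ => hu.hasDerivAt_radial hE φ₀)
      (const 0) (ih hu.2.2.2.2)

theorem continuous_angle (h : BddSmooth R (k + 1) u) {E : ℝ} (hE : E ∈ Ioo 0 R) :
    Continuous (u E) := continuous_iff_continuousAt.2 fun φ => (h.2.1 E hE φ).continuousAt

theorem prim (hu : BddSmooth R (k + 1) u) :
    BddSmooth R k (fun E φ => ∫ x in (0 : ℝ)..φ, u E x) := by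
  have hmem : ∀ {φ M y : ℝ}, φ ∈ Icc (-M) M → y ∈ uIoc 0 φ → y ∈ Icc (-M) M :=
    fun {φ M y} hφ hy => by
    rcases le_total 0 φ with h0 | h0
    · rw [uIoc_of_le h0] at hy
      exact ⟨by linarith [hφ.1, hφ.2, hy.1], hy.2.trans hφ.2⟩
    · rw [uIoc_of_ge h0] at hy
      exact ⟨hφ.1.trans hy.1.le, by linarith [hφ.1, hφ.2, hy.2]⟩
  have hb : ∀ {u : ℝ → ℝ → ℝ}, AngleBdd R u → AngleBdd R (fun E φ => ∫ x in (0 : ℝ)..φ, u E x) :=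
    fun {u} h M => by
    obtain ⟨C, hC⟩ := h M
    refine ⟨|C| * |M|, fun E hE φ hφ => ?_⟩
    have h1 := intervalIntegral.norm_integral_le_of_norm_le_const (f := u E) (a := 0) (b := φ)
      (C := |C|) fun x hx => (hC E hE x (hmem hφ hx)).trans (le_abs_self C)
    rw [sub_zero] at h1
    refine h1.trans (mul_le_mul_of_nonneg_left ?_ (abs_nonneg _))
    exact abs_le_abs hφ.2 (by linarith [hφ.1])
  induction k generalizing u with
  | zero => exact hb hu.1
  | succ k ih =>
    refine succ_intro (hb hu.1) (u₁ := u) (u₂ := fun E φ => ∫ x in (0 : ℝ)..φ, radialDeriv u E x)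
      (fun E hE φ => ?_) (fun E hE φ => ?_) hu.mono_one.mono_one (ih hu.2.2.2.2)
    · have hc := hu.continuous_angle hE
      exact intervalIntegral.integral_hasDerivAt_right (hc.intervalIntegrable _ _)
        (hc.stronglyMeasurableAtFilter _ _) hc.continuousAt
    · rw [← intervalIntegral.integral_div]
      obtain ⟨C, hC⟩ := hu.1 |φ|
      obtain ⟨D, hD⟩ := hu.2.2.2.2.bdd |φ|
      have hφ : φ ∈ Icc (-|φ|) |φ| := abs_le.1 le_rfl
      -- Staying above `E / 2` bounds the factor `1 / √e` of the energy derivative.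
      have hs : Ioo (E / 2) R ∈ 𝓝 E := isOpen_Ioo.mem_nhds ⟨by linarith [hE.1], hE.2⟩
      have hsub : ∀ e ∈ Ioo (E / 2) R, e ∈ Ioo 0 R := fun e he => ⟨by linarith [he.1, hE.1], he.2⟩
      refine hasDerivAt_intervalIntegral_of_abs_le (C := max C (|D| / (2 * √(E / 2)))) hs
        (F := u) (F' := fun e x => radialDeriv u e x / (2 * √e))
        (fun e he => (hu.continuous_angle (hsub e he)).continuousOn)
        (fun y hy => (hC E hE y (hmem hφ hy)).trans (le_max_left _ _))
        ((hu.2.2.2.2.continuous_angle hE).div_const _).continuousOn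
        (fun y hy e he => le_trans ?_ (le_max_right _ _))
        (fun y hy e he => hu.hasDerivAt_radial (hsub e he) y)
      have h0 : 0 < √(E / 2) := Real.sqrt_pos.2 (by linarith [hE.1])
      have h2 : √(E / 2) ≤ √e := Real.sqrt_le_sqrt he.1.le
      rw [abs_div, abs_of_pos (by linarith : 0 < 2 * √e)]
      exact div_le_div₀ (abs_nonneg _) ((hD e (hsub e he) y (hmem hφ hy)).trans (le_abs_self D))
        (by linarith) (by linarith)

theorem sq_mul_mem {E σ : ℝ} (hE : E ∈ Ioo 0 R) (hσ : σ ∈ uIoc (0 : ℝ) 1) :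
    σ ^ 2 * E ∈ Ioo 0 R := by
  rw [uIoc_of_le zero_le_one] at hσ
  have h1 : 0 < σ ^ 2 := pow_pos hσ.1 2
  have h2 : σ ^ 2 ≤ 1 := pow_le_one₀ hσ.1.le hσ.2
  exact ⟨mul_pos h1 hE.1, by nlinarith [hE.1, hE.2]⟩

theorem continuousOn_dilate (hu : BddSmooth R (k + 1) u) {E : ℝ} (hE : E ∈ Ioo 0 R) (φ : ℝ) :
    ContinuousOn (fun σ : ℝ => u (σ ^ 2 * E) φ) (uIoc 0 1) := fun σ hσ => by
  have h1 : ContinuousAt (fun e => u e φ) (σ ^ 2 * E) :=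
    (hu.2.2.1 _ (sq_mul_mem hE hσ) φ).continuousAt
  have h2 : ContinuousAt (fun σ : ℝ => σ ^ 2 * E) σ := by fun_prop
  exact (ContinuousAt.comp (f := fun σ : ℝ => σ ^ 2 * E) (g := fun e => u e φ) h1
    h2).continuousWithinAt

/-- Averages over dilations in `√E`. -/
theorem integral_dilate (hu : BddSmooth R (k + 1) u) (j : ℕ) :
    BddSmooth R k (fun E φ => ∫ σ in (0 : ℝ)..1, σ ^ j * u (σ ^ 2 * E) φ) := by
  have hpow : ∀ {σ : ℝ} (j : ℕ), σ ∈ uIoc (0 : ℝ) 1 → |σ ^ j| ≤ 1 := fun j hσ => by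
    rw [uIoc_of_le zero_le_one] at hσ
    rw [abs_of_nonneg (pow_nonneg hσ.1.le _)]
    exact pow_le_one₀ hσ.1.le hσ.2
  have hmulbd : ∀ {σ C y : ℝ} (j : ℕ), σ ∈ uIoc (0 : ℝ) 1 → |y| ≤ C → |σ ^ j * y| ≤ C :=
    fun {σ C y} j hσ hy => by
      rw [abs_mul]
      nlinarith [hpow j hσ, abs_nonneg (σ ^ j), abs_nonneg y]
  have hb : ∀ {u : ℝ → ℝ → ℝ} (j : ℕ), AngleBdd R u →
      AngleBdd R (fun E φ => ∫ σ in (0 : ℝ)..1, σ ^ j * u (σ ^ 2 * E) φ) := fun {u} j h M => by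
    obtain ⟨C, hC⟩ := h M
    refine ⟨C, fun E hE φ hφ => ?_⟩
    have h1 := intervalIntegral.norm_integral_le_of_norm_le_const
      (f := fun σ => σ ^ j * u (σ ^ 2 * E) φ) (a := 0) (b := 1)
      (C := C) fun σ hσ => hmulbd j hσ (hC _ (sq_mul_mem hE hσ) φ hφ)
    simpa using h1
  induction k generalizing u j with
  | zero => exact hb j hu.1
  | succ k ih =>
    -- As `√(σ² E) = σ √E`, each radial derivative produces one more factor `σ`; this is why the
    -- weight `σ ^ j` has to be general for the induction.
    refine succ_intro (hb j hu.1)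
      (u₁ := fun E φ => ∫ σ in (0 : ℝ)..1, σ ^ j * angleDeriv u (σ ^ 2 * E) φ)
      (u₂ := fun E φ => ∫ σ in (0 : ℝ)..1, σ ^ (j + 1) * radialDeriv u (σ ^ 2 * E) φ)
      (fun E hE φ => ?_) (fun E hE φ => ?_) (ih hu.2.2.2.1 j) (ih hu.2.2.2.2 (j + 1))
    · obtain ⟨C, hC⟩ := hu.1 (|φ| + 1)
      obtain ⟨D, hD⟩ := hu.2.2.2.1.bdd (|φ| + 1)
      have hs : Ioo (φ - 1) (φ + 1) ∈ 𝓝 φ := isOpen_Ioo.mem_nhds ⟨by linarith, by linarith⟩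
      have hsub : ∀ x ∈ Ioo (φ - 1) (φ + 1), x ∈ Icc (-(|φ| + 1)) (|φ| + 1) := fun x hx =>
        ⟨by linarith [neg_abs_le φ, hx.1], by linarith [le_abs_self φ, hx.2]⟩
      exact hasDerivAt_intervalIntegral_of_abs_le (C := max C D) hs
        (F := fun x σ => σ ^ j * u (σ ^ 2 * E) x)
        (F' := fun x σ => σ ^ j * angleDeriv u (σ ^ 2 * E) x)
        (fun x _ => (continuousOn_pow j).mul (hu.continuousOn_dilate hE x))
        (fun σ hσ => (hmulbd j hσ (hC _ (sq_mul_mem hE hσ) φ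
          (hsub φ (mem_of_mem_nhds hs)))).trans (le_max_left _ _))
        ((continuousOn_pow j).mul (hu.2.2.2.1.continuousOn_dilate hE φ))
        (fun σ hσ x hx => (hmulbd j hσ (hD _ (sq_mul_mem hE hσ) x (hsub x hx))).trans
          (le_max_right _ _))
        (fun σ hσ x _ => (hu.hasDerivAt_angle (sq_mul_mem hE hσ) x).const_mul _)
    · rw [← intervalIntegral.integral_div]
      obtain ⟨C, hC⟩ := hu.1 |φ|
      obtain ⟨D, hD⟩ := hu.2.2.2.2.bdd |φ|
      have hφ : φ ∈ Icc (-|φ|) |φ| := abs_le.1 le_rfl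
      have hs : Ioo (E / 2) R ∈ 𝓝 E := isOpen_Ioo.mem_nhds ⟨by linarith [hE.1], hE.2⟩
      have hsub : ∀ e ∈ Ioo (E / 2) R, e ∈ Ioo 0 R := fun e he => ⟨by linarith [he.1, hE.1], he.2⟩
      refine hasDerivAt_intervalIntegral_of_abs_le (C := max C (|D| / (2 * √(E / 2)))) hs
        (F := fun e σ => σ ^ j * u (σ ^ 2 * e) φ)
        (F' := fun e σ => σ ^ (j + 1) * radialDeriv u (σ ^ 2 * e) φ / (2 * √e))
        (fun e he => (continuousOn_pow j).mul (hu.continuousOn_dilate (hsub e he) φ))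
        (fun σ hσ => (hmulbd j hσ (hC _ (sq_mul_mem hE hσ) φ hφ)).trans (le_max_left _ _))
        (((continuousOn_pow (j + 1)).mul (hu.2.2.2.2.continuousOn_dilate hE φ)).div_const _)
        (fun σ hσ e he => le_trans ?_ (le_max_right _ _))
        (fun σ hσ e he => ?_)
      · have h0 : 0 < √(E / 2) := Real.sqrt_pos.2 (by linarith [hE.1])
        have h2 : √(E / 2) ≤ √e := Real.sqrt_le_sqrt he.1.le
        rw [abs_div, abs_of_pos (by linarith : 0 < 2 * √e)]
        exact div_le_div₀ (abs_nonneg _) ((hmulbd (j + 1) hσ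
          (hD _ (sq_mul_mem (hsub e he) hσ) φ hφ)).trans (le_abs_self D)) (by linarith)
          (by linarith)
      · have h1 := hu.hasDerivAt_radial (sq_mul_mem (hsub e he) hσ) φ
        have h2 : HasDerivAt (fun e : ℝ => σ ^ 2 * e) (σ ^ 2) e := by
          simpa using (hasDerivAt_id e).const_mul (σ ^ 2)
        have h3 := (HasDerivAt.comp e h1 h2).const_mul (σ ^ j)
        rw [uIoc_of_le zero_le_one] at hσ
        have hs2 : √(σ ^ 2 * e) = σ * √e := by
          rw [Real.sqrt_mul (sq_nonneg σ), Real.sqrt_sq hσ.1.le]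
        refine HasDerivAt.congr_deriv h3 ?_
        have h4 : 0 < √e := Real.sqrt_pos.2 (hsub e he).1
        have h5 := hσ.1
        rw [hs2]
        field_simp
        ring

/-- Hadamard's lemma in the variable `√E`: integrate the radial derivative along `σ ↦ σ² E`. The
hypothesis `hC` supplies the boundary value zero at `σ = 0`, where `u` itself is not controlled. -/
theorem eq_sqrt_mul_integral (hu : BddSmooth R (k + 2) u) {E φ C : ℝ} (hE : E ∈ Ioo 0 R)
    (hC : ∀ e ∈ Ioo 0 R, |u e φ| ≤ C * √e) :
    u E φ = √E * ∫ σ in (0 : ℝ)..1, radialDeriv u (σ ^ 2 * E) φ := by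
  have hu2 := hu.2.2.2.2
  obtain ⟨D, hD⟩ := hu2.bdd |φ|
  have hφ : φ ∈ Icc (-|φ|) |φ| := abs_le.1 le_rfl
  have hσ' : ∀ σ ∈ Ioo (0 : ℝ) 1, σ ∈ uIoc (0 : ℝ) 1 := fun σ hσ => by
    rw [uIoc_of_le zero_le_one]; exact ⟨hσ.1, hσ.2.le⟩
  have key := intervalIntegral.integral_eq_sub_of_hasDerivAt_of_tendsto (a := (0 : ℝ)) (b := 1)
    (f := fun σ => u (σ ^ 2 * E) φ) (f' := fun σ => √E * radialDeriv u (σ ^ 2 * E) φ)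
    (fa := 0) (fb := u E φ) one_pos (fun σ hσ => ?_) ?_ ?_ ?_
  · rw [intervalIntegral.integral_const_mul, sub_zero] at key
    exact key.symm
  · have h1 := hu.hasDerivAt_radial (sq_mul_mem hE (hσ' σ hσ)) φ
    have h2 : HasDerivAt (fun σ : ℝ => σ ^ 2 * E) (2 * σ * E) σ := by
      simpa using (hasDerivAt_pow 2 σ).mul_const E
    have h3 := HasDerivAt.comp σ h1 h2
    have hs2 : √(σ ^ 2 * E) = σ * √E := by
      rw [Real.sqrt_mul (sq_nonneg σ), Real.sqrt_sq hσ.1.le]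
    refine HasDerivAt.congr_deriv h3 ?_
    have h4 : 0 < √E := Real.sqrt_pos.2 hE.1
    have h5 := hσ.1
    rw [hs2]
    field_simp
    rw [Real.sq_sqrt hE.1.le, mul_comm]
  · refine (intervalIntegrable_of_continuousOn_of_abs_le (C := D)
      (hu2.continuousOn_dilate hE φ) fun σ hσ => hD _ (sq_mul_mem hE hσ) φ hφ).const_mul _
  · have h1 : ∀ᶠ σ : ℝ in 𝓝[>] 0, |u (σ ^ 2 * E) φ| ≤ C * √(σ ^ 2 * E) := by
      filter_upwards [Ioo_mem_nhdsGT (zero_lt_one' ℝ)] with σ hσ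
      exact hC _ (sq_mul_mem hE (hσ' σ hσ))
    refine squeeze_zero_norm' h1 ?_
    have h2 : Tendsto (fun σ : ℝ => C * √(σ ^ 2 * E)) (𝓝 0) (𝓝 (C * √((0 : ℝ) ^ 2 * E))) := by
      apply Continuous.tendsto; fun_prop
    simpa using h2.mono_left nhdsWithin_le_nhds
  · have h1 : ContinuousAt (fun e => u e φ) ((1 : ℝ) ^ 2 * E) := by
      rw [one_pow, one_mul]; exact (hu.2.2.1 E hE φ).continuousAt
    have h2 : ContinuousAt (fun σ : ℝ => σ ^ 2 * E) 1 := by fun_prop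
    have h3 := (ContinuousAt.comp (f := fun σ : ℝ => σ ^ 2 * E) (g := fun e => u e φ) h1 h2)
    have h4 := h3.tendsto
    simp only [Function.comp_def, one_pow, one_mul] at h4
    exact h4.mono_left nhdsWithin_le_nhds

/-- Composition with a smooth function of the plane. -/
theorem comp {h : ℝ × ℝ → ℝ} (hh : ContDiff ℝ (⊤ : ℕ∞) h) (hu : BddSmooth R k u)
    (hw : BddSmooth R k w) : BddSmooth R k (fun E φ => h (u E φ, w E φ)) := by
  have hb : ∀ {h : ℝ × ℝ → ℝ}, Continuous h → AngleBdd R u → AngleBdd R w →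
      AngleBdd R (fun E φ => h (u E φ, w E φ)) := fun {h} hh hu hw M => by
    obtain ⟨C, hC⟩ := hu M
    obtain ⟨D, hD⟩ := hw M
    obtain ⟨B, hB⟩ := ((isCompact_Icc (a := -C) (b := C)).prod
      (isCompact_Icc (a := -D) (b := D))).exists_bound_of_continuousOn hh.continuousOn
    exact ⟨B, fun E hE φ hφ => hB _ ⟨abs_le.1 (hC E hE φ hφ), abs_le.1 (hD E hE φ hφ)⟩⟩
  induction k generalizing h with
  | zero => exact hb hh.continuous hu hw
  | succ k ih =>
    have hd : ∀ e : ℝ × ℝ, ContDiff ℝ (⊤ : ℕ∞) fun z => fderiv ℝ h z e := fun e =>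
      (hh.fderiv_right (m := (⊤ : ℕ∞)) (by simp)).clm_apply contDiff_const
    have hx := ih (hd (1, 0)) hu.mono_one hw.mono_one
    have hy := ih (hd (0, 1)) hu.mono_one hw.mono_one
    have hlin : ∀ (z : ℝ × ℝ) (a b : ℝ), fderiv ℝ h z (a, b)
        = fderiv ℝ h z (1, 0) * a + fderiv ℝ h z (0, 1) * b := fun z a b => by
      have : ((a, b) : ℝ × ℝ) = a • (1, 0) + b • (0, 1) := by simp
      rw [this, map_add, map_smul, map_smul, smul_eq_mul, smul_eq_mul]
      ring
    have hD : ∀ z, HasFDerivAt h (fderiv ℝ h z) z := fun z =>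
      (hh.differentiable (by simp) z).hasFDerivAt
    refine succ_intro (hb hh.continuous hu.1 hw.1)
      (fun E hE φ => ?_) (fun E hE φ => ?_) (add (mul hx hu.2.2.2.1) (mul hy hw.2.2.2.1))
      (add (mul hx hu.2.2.2.2) (mul hy hw.2.2.2.2))
    · rw [← hlin]
      exact (hD _).comp_hasDerivAt φ ((hu.hasDerivAt_angle hE φ).prodMk (hw.hasDerivAt_angle hE φ))
    · have h1 := (hD _).comp_hasDerivAt E
        ((hu.hasDerivAt_radial hE φ).prodMk (hw.hasDerivAt_radial hE φ))
      rw [hlin] at h1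
      refine HasDerivAt.congr_deriv h1 ?_
      ring

end BddSmooth

/-- `u = (√E) ^ k * w` for `0 < E < R`, with `w` smooth and bounded with all its derivatives in the
angle and in `√E`. -/
def SmoothOfOrder (R : ℝ) (k : ℤ) (u : ℝ → ℝ → ℝ) : Prop :=
  ∃ w, (∀ n, BddSmooth R n w) ∧ ∀ E ∈ Ioo 0 R, ∀ φ, u E φ = √E ^ k * w E φ

namespace SmoothOfOrder

variable {R : ℝ} {k l : ℤ} {u w : ℝ → ℝ → ℝ}

theorem of_bddSmooth (h : ∀ n, BddSmooth R n u) : SmoothOfOrder R 0 u :=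
  ⟨u, h, fun E _ φ => by simp⟩

theorem bddSmooth (h : SmoothOfOrder R 0 u) (n : ℕ) : BddSmooth R n u := by
  obtain ⟨w, hw, e⟩ := h
  exact (hw n).congr fun E hE φ => by simpa using e E hE φ

theorem congr (h : SmoothOfOrder R k u) (huw : ∀ E ∈ Ioo 0 R, ∀ φ, w E φ = u E φ) :
    SmoothOfOrder R k w := by
  obtain ⟨u', hu', e⟩ := h
  exact ⟨u', hu', fun E hE φ => by rw [huw E hE φ, e E hE φ]⟩

theorem bound (h : SmoothOfOrder R k u) (M : ℝ) :
    ∃ C, 0 ≤ C ∧ ∀ E ∈ Ioo 0 R, ∀ φ ∈ Icc (-M) M, |u E φ| ≤ C * √E ^ k := by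
  obtain ⟨w, hw, e⟩ := h
  obtain ⟨C, hC⟩ := (hw 0).bdd M
  refine ⟨|C|, abs_nonneg C, fun E hE φ hφ => ?_⟩
  have h0 : 0 < √E ^ k := zpow_pos (Real.sqrt_pos.2 hE.1) k
  rw [e E hE φ, abs_mul, abs_of_pos h0, mul_comm]
  exact mul_le_mul_of_nonneg_right ((hC E hE φ hφ).trans (le_abs_self C)) h0.le

theorem const (c : ℝ) : SmoothOfOrder R 0 (fun _ _ => c) :=
  of_bddSmooth fun _ => BddSmooth.const c

theorem zero : SmoothOfOrder R k (fun _ _ => 0) :=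
  ⟨fun _ _ => 0, fun _ => BddSmooth.const 0, fun _ _ _ => by simp⟩

theorem sqrt_zpow : SmoothOfOrder R k (fun E _ => √E ^ k) :=
  ⟨fun _ _ => 1, fun _ => BddSmooth.const 1, fun _ _ _ => by simp⟩

theorem add (hu : SmoothOfOrder R k u) (hw : SmoothOfOrder R k w) :
    SmoothOfOrder R k (fun E φ => u E φ + w E φ) := by
  obtain ⟨u', hu', e⟩ := hu
  obtain ⟨w', hw', e'⟩ := hw
  exact ⟨_, fun n => (hu' n).add (hw' n), fun E hE φ => by
    simp only [e E hE φ, e' E hE φ, mul_add]⟩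

theorem mul (hu : SmoothOfOrder R k u) (hw : SmoothOfOrder R l w) :
    SmoothOfOrder R (k + l) (fun E φ => u E φ * w E φ) := by
  obtain ⟨u', hu', e⟩ := hu
  obtain ⟨w', hw', e'⟩ := hw
  refine ⟨_, fun n => (hu' n).mul (hw' n), fun E hE φ => ?_⟩
  simp only [e E hE φ, e' E hE φ, zpow_add₀ (Real.sqrt_pos.2 hE.1).ne']
  ring

theorem const_mul (c : ℝ) (hu : SmoothOfOrder R k u) :
    SmoothOfOrder R k (fun E φ => c * u E φ) := by
  simpa using (const c).mul hu

theorem neg (hu : SmoothOfOrder R k u) : SmoothOfOrder R k (fun E φ => -u E φ) := by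
  simpa using hu.const_mul (-1)

theorem sub (hu : SmoothOfOrder R k u) (hw : SmoothOfOrder R k w) :
    SmoothOfOrder R k (fun E φ => u E φ - w E φ) := by
  simpa [sub_eq_add_neg] using hu.add hw.neg

theorem sum {ι : Type*} {s : Finset ι} {u : ι → ℝ → ℝ → ℝ}
    (h : ∀ i ∈ s, SmoothOfOrder R k (u i)) :
    SmoothOfOrder R k (fun E φ => ∑ i ∈ s, u i E φ) := by
  classical
  induction s using Finset.induction_on with
  | empty => simpa using zero
  | insert i s hi ih =>
    simp only [Finset.sum_insert hi]
    exact (h i (Finset.mem_insert_self i s)).add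
      (ih fun j hj => h j (Finset.mem_insert_of_mem hj))

theorem prod {ι : Type*} {s : Finset ι} {u : ι → ℝ → ℝ → ℝ}
    (h : ∀ i ∈ s, SmoothOfOrder R k (u i)) :
    SmoothOfOrder R (k * s.card) (fun E φ => ∏ i ∈ s, u i E φ) := by
  classical
  induction s using Finset.induction_on with
  | empty => simpa using const 1
  | insert i s hi ih =>
    simp only [Finset.prod_insert hi, Finset.card_insert_of_notMem hi]
    have := (h i (Finset.mem_insert_self i s)).mul
      (ih fun j hj => h j (Finset.mem_insert_of_mem hj))
    convert this using 1
    push_cast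
    ring

theorem of_le (hu : SmoothOfOrder R l u) (hkl : k ≤ l) : SmoothOfOrder R k u := by
  obtain ⟨n, rfl⟩ := Int.exists_add_of_le hkl
  obtain ⟨u', hu', e⟩ := hu
  have hp : ∀ n m : ℕ, BddSmooth R m (fun E _ => √E ^ n) := fun n m => by
    induction n with
    | zero => simpa using BddSmooth.const 1
    | succ n ih => simpa only [pow_succ] using ih.mul BddSmooth.sqrt
  refine ⟨_, fun m => (hp n m).mul (hu' m), fun E hE φ => ?_⟩
  rw [e E hE φ, zpow_add₀ (Real.sqrt_pos.2 hE.1).ne', zpow_natCast, mul_assoc]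

theorem differentiableAt_angle (hu : SmoothOfOrder R k u) {E : ℝ} (hE : E ∈ Ioo 0 R) (φ : ℝ) :
    DifferentiableAt ℝ (u E) φ := by
  obtain ⟨w, hw, e⟩ := hu
  rw [show u E = fun φ => √E ^ k * w E φ from funext (e E hE)]
  exact ((hw 1).2.1 E hE φ).const_mul _

theorem continuous_angle (hu : SmoothOfOrder R k u) {E : ℝ} (hE : E ∈ Ioo 0 R) :
    Continuous (u E) :=
  continuous_iff_continuousAt.2 fun φ => (hu.differentiableAt_angle hE φ).continuousAt

theorem angleDeriv (hu : SmoothOfOrder R k u) :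
    SmoothOfOrder R k (fun E φ => deriv (u E) φ) := by
  obtain ⟨w, hw, e⟩ := hu
  refine ⟨_, fun n => (hw (n + 1)).2.2.2.1, fun E hE φ => ?_⟩
  beta_reduce
  rw [show u E = fun φ => √E ^ k * w E φ from funext (e E hE)]
  exact (((hw 1).hasDerivAt_angle hE φ).const_mul _).deriv

/-- Since `∂/∂E = (2√E)⁻¹ ∂/∂√E`, differentiating both the power and the smooth factor costs two
orders in `√E`. -/
theorem exists_hasDerivAt_energy (hu : SmoothOfOrder R k u) :
    ∃ d, SmoothOfOrder R (k - 2) d ∧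
      ∀ E ∈ Ioo 0 R, ∀ φ, HasDerivAt (fun e => u e φ) (d E φ) E := by
  obtain ⟨w, hw, e⟩ := hu
  refine ⟨fun E φ => √E ^ (k - 2) * (k / 2 * w E φ + 1 / 2 * (√E * radialDeriv w E φ)),
    ⟨_, fun n => ((BddSmooth.const _).mul (hw n)).add
      ((BddSmooth.const _).mul (BddSmooth.sqrt.mul (hw (n + 1)).2.2.2.2)), fun _ _ _ => rfl⟩,
    fun E hE φ => ?_⟩
  have h0 : 0 < √E := Real.sqrt_pos.2 hE.1
  have h1 : HasDerivAt (fun e => √e ^ k) (k * √E ^ (k - 1) * (1 / (2 * √E))) E :=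
    (hasDerivAt_zpow k (√E) (Or.inl h0.ne')).comp E (Real.hasDerivAt_sqrt hE.1.ne')
  have h2 := h1.mul ((hw 1).hasDerivAt_radial hE φ)
  have h3 : (fun e => u e φ) =ᶠ[𝓝 E] fun e => √e ^ k * w e φ := by
    filter_upwards [isOpen_Ioo.mem_nhds hE] with e' he using e e' he φ
  refine (h2.congr_of_eventuallyEq h3).congr_deriv ?_
  have h4 : √E ^ (k - 1) = √E ^ (k - 2) * √E := by
    rw [← zpow_add_one₀ h0.ne']; congr 1; ring
  have h5 : √E ^ k = √E ^ (k - 2) * √E * √E := by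
    rw [← zpow_add_one₀ h0.ne', ← zpow_add_one₀ h0.ne']; congr 1; ring
  rw [h4, h5]
  field_simp

theorem differentiableAt_energy (hu : SmoothOfOrder R k u) {E : ℝ} (hE : E ∈ Ioo 0 R) (φ : ℝ) :
    DifferentiableAt ℝ (fun e => u e φ) E := by
  obtain ⟨d, -, hd⟩ := hu.exists_hasDerivAt_energy
  exact (hd E hE φ).differentiableAt

theorem energyDeriv (hu : SmoothOfOrder R k u) :
    SmoothOfOrder R (k - 2) (fun E φ => deriv (fun e => u e φ) E) := by
  obtain ⟨d, hd, h⟩ := hu.exists_hasDerivAt_energy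
  exact hd.congr fun E hE φ => (h E hE φ).deriv

theorem iteratedDeriv {L : ℝ → ℝ} (hL : SmoothOfOrder R k (fun E _ => L E)) (p : ℕ) :
    SmoothOfOrder R (k - 2 * p) (fun E _ => iteratedDeriv p L E) := by
  induction p with
  | zero => simpa using hL
  | succ p ih =>
    simp only [iteratedDeriv_succ]
    have := ih.energyDeriv
    convert this using 1
    push_cast
    ring

theorem prim (hu : SmoothOfOrder R k u) :
    SmoothOfOrder R k (fun E φ => ∫ x in (0 : ℝ)..φ, u E x) := by
  obtain ⟨w, hw, e⟩ := hu
  refine ⟨_, fun n => (hw (n + 1)).prim, fun E hE φ => ?_⟩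
  rw [← intervalIntegral.integral_const_mul]
  exact intervalIntegral.integral_congr fun x _ => e E hE x

theorem eval (hu : SmoothOfOrder R k u) (φ₀ : ℝ) : SmoothOfOrder R k (fun E _ => u E φ₀) := by
  obtain ⟨w, hw, e⟩ := hu
  exact ⟨_, fun n => (hw n).eval φ₀, fun E hE _ => e E hE φ₀⟩

theorem mean (hu : SmoothOfOrder R k u) :
    SmoothOfOrder R k (fun E _ => AsympHamSystem.EnergyAngle.mean (u E)) :=
  (hu.prim.eval (2 * Real.pi)).const_mul _

theorem comp {h : ℝ × ℝ → ℝ} (hh : ContDiff ℝ (⊤ : ℕ∞) h) (hu : SmoothOfOrder R 0 u)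
    (hw : SmoothOfOrder R 0 w) : SmoothOfOrder R 0 (fun E φ => h (u E φ, w E φ)) :=
  of_bddSmooth fun n => (hu.bddSmooth n).comp hh (hw.bddSmooth n)

theorem inv (hu : SmoothOfOrder R 0 u) {c : ℝ} (hc : 0 < c)
    (h : ∀ E ∈ Ioo 0 R, ∀ φ, c ≤ |u E φ|) : SmoothOfOrder R 0 (fun E φ => (u E φ)⁻¹) :=
  of_bddSmooth fun n => (hu.bddSmooth n).inv hc h

/-- A function of order `k` that decays at the next order has order `k + 1`. -/
theorem raise (hu : SmoothOfOrder R k u)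
    (h : ∀ φ, ∃ C, ∀ᶠ E in 𝓝[>] 0, |u E φ| ≤ C * √E ^ (k + 1)) : SmoothOfOrder R (k + 1) u := by
  obtain ⟨w, hw, e⟩ := hu
  refine ⟨fun E φ => ∫ σ in (0 : ℝ)..1, σ ^ 0 * radialDeriv w (σ ^ 2 * E) φ,
    fun n => (hw (n + 2)).2.2.2.2.integral_dilate 0, fun E hE φ => ?_⟩
  obtain ⟨C, hC⟩ := h φ
  obtain ⟨D, hD⟩ := (hw 0).bdd |φ|
  have hφ : φ ∈ Icc (-|φ|) |φ| := abs_le.1 le_rfl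
  obtain ⟨δ, hδ, hC'⟩ := mem_nhdsGT_iff_exists_Ioo_subset.1 hC
  have hδ0 : 0 < √δ := Real.sqrt_pos.2 hδ
  -- The assumed decay is available only for `e < δ`. For larger `e` the plain bound on `w` is
  -- enough, because `√e ≥ √δ`.
  have hb : ∀ e ∈ Ioo 0 R, |w e φ| ≤ (|C| + |D| / √δ) * √e := fun e' he => by
    have h0 : 0 < √e' := Real.sqrt_pos.2 he.1
    rcases lt_or_ge e' δ with h1 | h1
    · have h2 : |u e' φ| ≤ C * √e' ^ (k + 1) := hC' ⟨he.1, h1⟩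
      rw [e e' he φ, abs_mul, abs_of_pos (zpow_pos h0 k), zpow_add_one₀ h0.ne'] at h2
      have h3 : |w e' φ| ≤ C * √e' := by
        have := zpow_pos h0 k
        refine le_of_mul_le_mul_left ?_ this
        linarith
      refine h3.trans (mul_le_mul_of_nonneg_right ?_ h0.le)
      exact (le_abs_self C).trans (le_add_of_nonneg_right (by positivity))
    · have h2 : √δ ≤ √e' := Real.sqrt_le_sqrt h1
      calc |w e' φ| ≤ |D| := (hD e' he φ hφ).trans (le_abs_self D)
        _ = |D| / √δ * √δ := by field_simp
        _ ≤ |D| / √δ * √e' := mul_le_mul_of_nonneg_left h2 (by positivity)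
        _ ≤ _ := mul_le_mul_of_nonneg_right (le_add_of_nonneg_left (abs_nonneg C)) h0.le
  have h1 := (hw 2).eq_sqrt_mul_integral (k := 0) hE hb
  rw [e E hE φ, h1, zpow_add_one₀ (Real.sqrt_pos.2 hE.1).ne', mul_assoc]
  simp

end SmoothOfOrder

/-! ### Calculus in the plane -/

theorem partialX_eq {h : ℝ × ℝ → ℝ} {z : ℝ × ℝ} (hd : DifferentiableAt ℝ h z) :
    partialX h z = fderiv ℝ h z (1, 0) := by
  have h1 : HasDerivAt (fun x : ℝ => (x, z.2)) ((1, 0) : ℝ × ℝ) z.1 :=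
    (hasDerivAt_id z.1).prodMk (hasDerivAt_const z.1 z.2)
  exact (HasFDerivAt.comp_hasDerivAt (f := fun x : ℝ => (x, z.2)) z.1
    hd.hasFDerivAt h1).deriv

theorem partialY_eq {h : ℝ × ℝ → ℝ} {z : ℝ × ℝ} (hd : DifferentiableAt ℝ h z) :
    partialY h z = fderiv ℝ h z (0, 1) := by
  have h1 : HasDerivAt (fun y : ℝ => (z.1, y)) ((0, 1) : ℝ × ℝ) z.2 :=
    (hasDerivAt_const z.2 z.1).prodMk (hasDerivAt_id z.2)
  exact (HasFDerivAt.comp_hasDerivAt (f := fun y : ℝ => (z.1, y)) z.2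
    hd.hasFDerivAt h1).deriv

theorem clm_apply_eq (L : ℝ × ℝ →L[ℝ] ℝ) (e : ℝ × ℝ) :
    L e = L (1, 0) * e.1 + L (0, 1) * e.2 := by
  have : e = e.1 • ((1, 0) : ℝ × ℝ) + e.2 • ((0, 1) : ℝ × ℝ) := by ext <;> simp
  conv_lhs => rw [this, map_add, map_smul, map_smul, smul_eq_mul, smul_eq_mul]
  ring

theorem fderiv_apply_eq {h : ℝ × ℝ → ℝ} {z : ℝ × ℝ} (hd : DifferentiableAt ℝ h z) (e : ℝ × ℝ) :
    fderiv ℝ h z e = partialX h z * e.1 + partialY h z * e.2 := by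
  rw [clm_apply_eq, partialX_eq hd, partialY_eq hd]

theorem ContDiff.partialX {h : ℝ × ℝ → ℝ} (hh : ContDiff ℝ (⊤ : ℕ∞) h) :
    ContDiff ℝ (⊤ : ℕ∞) (_root_.partialX h) := by
  have : _root_.partialX h = fun z => fderiv ℝ h z (1, 0) :=
    funext fun z => partialX_eq (hh.differentiable (by simp) z)
  rw [this]
  exact (hh.fderiv_right (m := (⊤ : ℕ∞)) (by simp)).clm_apply contDiff_const

theorem ContDiff.partialY {h : ℝ × ℝ → ℝ} (hh : ContDiff ℝ (⊤ : ℕ∞) h) :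
    ContDiff ℝ (⊤ : ℕ∞) (_root_.partialY h) := by
  have : _root_.partialY h = fun z => fderiv ℝ h z (0, 1) :=
    funext fun z => partialY_eq (hh.differentiable (by simp) z)
  rw [this]
  exact (hh.fderiv_right (m := (⊤ : ℕ∞)) (by simp)).clm_apply contDiff_const

/-- A smooth function is Lipschitz on balls. -/
theorem ContDiff.exists_abs_sub_le {h : ℝ × ℝ → ℝ} (hh : ContDiff ℝ (⊤ : ℕ∞) h) (r : ℝ) :
    ∃ C, 0 ≤ C ∧ ∀ z ∈ Metric.closedBall (0 : ℝ × ℝ) r, ∀ w ∈ Metric.closedBall (0 : ℝ × ℝ) r,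
      |h z - h w| ≤ C * ‖z - w‖ := by
  obtain ⟨C, hC⟩ := (isCompact_closedBall (0 : ℝ × ℝ) r).exists_bound_of_continuousOn
    (hh.continuous_fderiv (by simp)).continuousOn
  refine ⟨|C|, abs_nonneg C, fun z hz w hw => ?_⟩
  exact (convex_closedBall (0 : ℝ × ℝ) r).norm_image_sub_le_of_norm_fderiv_le
    (fun x _ => hh.differentiable (by simp) x) (fun x hx => (hC x hx).trans (le_abs_self C)) hw hz

/-- A smooth function vanishing to second order at the origin. -/
theorem ContDiff.exists_abs_sub_le_sq {h : ℝ × ℝ → ℝ} (hh : ContDiff ℝ (⊤ : ℕ∞) h)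
    (h0 : fderiv ℝ h 0 = 0) (r : ℝ) :
    ∃ C, 0 ≤ C ∧ ∀ z ∈ Metric.closedBall (0 : ℝ × ℝ) r, |h z - h 0| ≤ C * ‖z‖ ^ 2 := by
  have hd : ContDiff ℝ (⊤ : ℕ∞) (fderiv ℝ h) := hh.fderiv_right (m := (⊤ : ℕ∞)) (by simp)
  obtain ⟨C, hC⟩ := (isCompact_closedBall (0 : ℝ × ℝ) r).exists_bound_of_continuousOn
    (hd.continuous_fderiv (by simp)).continuousOn
  refine ⟨|C|, abs_nonneg C, fun z hz => ?_⟩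
  have hle : ‖z‖ ≤ r := by simpa using hz
  have hz0 : (0 : ℝ × ℝ) ∈ Metric.closedBall (0 : ℝ × ℝ) ‖z‖ := by simp
  have hsub : Metric.closedBall (0 : ℝ × ℝ) ‖z‖ ⊆ Metric.closedBall 0 r :=
    Metric.closedBall_subset_closedBall hle
  have h1 : ∀ x ∈ Metric.closedBall (0 : ℝ × ℝ) ‖z‖, ‖fderiv ℝ h x‖ ≤ |C| * ‖z‖ := fun x hx => by
    have h2 := (convex_closedBall (0 : ℝ × ℝ) ‖z‖).norm_image_sub_le_of_norm_fderiv_le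
      (f := fderiv ℝ h) (fun x _ => hd.differentiable (by simp) x)
      (fun x hx => (hC x (hsub hx)).trans (le_abs_self C)) hz0 hx
    rw [h0, sub_zero, sub_zero] at h2
    exact h2.trans (mul_le_mul_of_nonneg_left (by simpa using hx) (abs_nonneg C))
  have h3 := (convex_closedBall (0 : ℝ × ℝ) ‖z‖).norm_image_sub_le_of_norm_fderiv_le
    (f := h) (fun x _ => hh.differentiable (by simp) x) h1 hz0
    (show z ∈ Metric.closedBall (0 : ℝ × ℝ) ‖z‖ by simp)
  rw [sub_zero] at h3
  calc _ ≤ |C| * ‖z‖ * ‖z‖ := h3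
    _ = _ := by ring

/-- Smoothness up to the boundary in `(φ, √E)`. -/
theorem ContDiffOn.bddSmooth {G : ℝ × ℝ → ℝ} {r : ℝ} (hr : 0 < r)
    (hG : ContDiffOn ℝ (⊤ : ℕ∞) G (univ ×ˢ Icc 0 r)) (k : ℕ) :
    BddSmooth (r ^ 2) k (fun E φ => G (φ, √E)) := by
  have hS : UniqueDiffOn ℝ (univ ×ˢ Icc (0 : ℝ) r : Set (ℝ × ℝ)) :=
    uniqueDiffOn_univ.prod (uniqueDiffOn_Icc hr)
  have hmem : ∀ {E : ℝ}, E ∈ Ioo 0 (r ^ 2) → √E ∈ Ioo 0 r := fun hE =>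
    ⟨Real.sqrt_pos.2 hE.1, (Real.sqrt_lt' hr).2 hE.2⟩
  have hb : ∀ {G : ℝ × ℝ → ℝ}, ContinuousOn G (univ ×ˢ Icc 0 r) →
      AngleBdd (r ^ 2) (fun E φ => G (φ, √E)) := fun {G} hG M => by
    obtain ⟨C, hC⟩ := ((isCompact_Icc (a := -M) (b := M)).prod
      (isCompact_Icc (a := 0) (b := r))).exists_bound_of_continuousOn
      (hG.mono (prod_mono_left (subset_univ _)))
    exact ⟨C, fun E hE φ hφ => hC (φ, √E) ⟨hφ, Ioo_subset_Icc_self (hmem hE)⟩⟩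
  induction k generalizing G with
  | zero => exact hb hG.continuousOn
  | succ k ih =>
    -- Derivatives within the closed strip are continuous up to `√E = 0`, which makes them bounded
    -- on compact angle ranges. At interior points they are the ordinary derivatives.
    have hd : ∀ e : ℝ × ℝ, ContDiffOn ℝ (⊤ : ℕ∞)
        (fun p => fderivWithin ℝ G (univ ×ˢ Icc 0 r) p e) (univ ×ˢ Icc 0 r) := fun e =>
      (hG.fderivWithin hS (m := (⊤ : ℕ∞)) (by simp)).clm_apply contDiffOn_const
    have hD : ∀ {E : ℝ}, E ∈ Ioo 0 (r ^ 2) → ∀ φ : ℝ,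
        HasFDerivAt G (fderivWithin ℝ G (univ ×ˢ Icc 0 r) (φ, √E)) (φ, √E) := fun {E} hE φ => by
      have hn : (univ ×ˢ Icc (0 : ℝ) r : Set (ℝ × ℝ)) ∈ 𝓝 (φ, √E) :=
        prod_mem_nhds univ_mem (Icc_mem_nhds (hmem hE).1 (hmem hE).2)
      exact ((hG.differentiableOn (by simp) _ (mem_of_mem_nhds hn)).hasFDerivWithinAt).hasFDerivAt hn
    refine BddSmooth.succ_intro (hb hG.continuousOn) (fun E hE φ => ?_) (fun E hE φ => ?_)
      (ih (hd (1, 0))) (ih (hd (0, 1)))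
    · exact HasFDerivAt.comp_hasDerivAt (f := fun x : ℝ => (x, √E)) φ (hD hE φ)
        ((hasDerivAt_id φ).prodMk (hasDerivAt_const φ (√E)))
    · have h1 := HasFDerivAt.comp_hasDerivAt (f := fun e : ℝ => (φ, √e)) E (hD hE φ)
        ((hasDerivAt_const E φ).prodMk (Real.hasDerivAt_sqrt hE.1.ne'))
      refine h1.congr_deriv ?_
      rw [clm_apply_eq]
      simp only
      ring

/-! ### Vanishing of the coefficients at the equilibrium -/

/-- Uniqueness of asymptotic coefficients: when those before the `N`-th vanish, dividing by
`t^{-N/q}` and letting `t → ∞` kills the `N`-th. -/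
theorem eq_zero_of_norm_sum_le {V : Type*} [NormedAddCommGroup V] [NormedSpace ℝ V] {q : ℕ}
    (hq : 0 < q) {a : ℕ → V}
    (h : ∀ N : ℕ, ∃ C T : ℝ, ∀ t ≥ T, 0 < t →
      ‖∑ k ∈ Finset.range (N + 1), t ^ (-(k : ℝ) / (q : ℝ)) • a k‖
        ≤ C * t ^ (-((N : ℝ) + 1) / (q : ℝ))) (k : ℕ) : a k = 0 := by
  induction k using Nat.strong_induction_on with
  | _ N ih =>
    obtain ⟨C, T, hC⟩ := h N
    have hq' : (0 : ℝ) < q := Nat.cast_pos.2 hq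
    have h1 : ∀ᶠ t : ℝ in atTop, ‖a N‖ ≤ C * t ^ (-(1 / (q : ℝ))) := by
      filter_upwards [eventually_ge_atTop T, eventually_gt_atTop 0] with t ht ht0
      have h2 := hC t ht ht0
      rw [Finset.sum_range_succ, Finset.sum_eq_zero (fun k hk => by
        rw [ih k (Finset.mem_range.1 hk), smul_zero]), zero_add, norm_smul, Real.norm_eq_abs,
        abs_of_pos (Real.rpow_pos_of_pos ht0 _)] at h2
      have h3 : t ^ (-((N : ℝ) + 1) / (q : ℝ))
          = t ^ (-(N : ℝ) / (q : ℝ)) * t ^ (-(1 / (q : ℝ))) := by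
        rw [← Real.rpow_add ht0]; congr 1; ring
      rw [h3] at h2
      refine le_of_mul_le_mul_left ?_ (Real.rpow_pos_of_pos ht0 (-(N : ℝ) / (q : ℝ)))
      linarith
    have h4 : Tendsto (fun t : ℝ => C * t ^ (-(1 / (q : ℝ)))) atTop (𝓝 0) := by
      simpa using (tendsto_rpow_neg_atTop (y := 1 / (q : ℝ)) (by positivity)).const_mul C
    exact norm_le_zero_iff.1 (ge_of_tendsto h4 h1)

namespace AsympHamSystem

variable (S : AsympHamSystem)

theorem contDiff_H {t : ℝ} (ht : 0 < t) : ContDiff ℝ (⊤ : ℕ∞) (fun z => S.H z t) :=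
  contDiffOn_univ.1 (S.smooth_H.comp (contDiff_id.prodMk contDiff_const).contDiffOn
    (fun _ _ => ht))

theorem contDiff_F {t : ℝ} (ht : 0 < t) : ContDiff ℝ (⊤ : ℕ∞) (fun z => S.F z t) :=
  contDiffOn_univ.1 (S.smooth_F.comp (contDiff_id.prodMk contDiff_const).contDiffOn
    (fun _ _ => ht))

theorem fderiv_H_zero {t : ℝ} (ht : 0 < t) : fderiv ℝ (fun z => S.H z t) 0 = 0 := by
  refine ContinuousLinearMap.ext fun e => ?_
  have hd := (S.contDiff_H ht).differentiable (by simp) 0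
  rw [fderiv_apply_eq hd]
  have h1 := S.partialX_zero t ht
  have h2 := S.partialY_zero t ht
  rw [Prod.mk_zero_zero] at h1 h2
  simp [h1, h2]

theorem hasFDerivAt_remainder (N : ℕ) {t : ℝ} (ht : 0 < t) (z : ℝ × ℝ) :
    HasFDerivAt (fun w => S.H w t - S.Hc 0 w
        - ∑ k ∈ Finset.Icc 1 N, t ^ (-(k : ℝ) / (S.q : ℝ)) * S.Hc k w)
      (fderiv ℝ (fun w => S.H w t) z - fderiv ℝ (S.Hc 0) z
        - ∑ k ∈ Finset.Icc 1 N, t ^ (-(k : ℝ) / (S.q : ℝ)) • fderiv ℝ (S.Hc k) z) z := by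
  refine ((((S.contDiff_H ht).differentiable (by simp) z).hasFDerivAt).sub
    (((S.smooth_Hc 0).differentiable (by simp) z).hasFDerivAt)).sub
    (HasFDerivAt.fun_sum fun k _ => ?_)
  exact (((S.smooth_Hc k).differentiable (by simp) z).hasFDerivAt).const_mul _

/-- The gradient of `H` vanishes at the origin for all `t > 0`, so its expansion there is an
expansion of zero. -/
theorem fderiv_Hc_zero (k : ℕ) : fderiv ℝ (S.Hc k) 0 = 0 := by
  refine eq_zero_of_norm_sum_le S.q_pos (a := fun k => fderiv ℝ (S.Hc k) 0) (fun N => ?_) k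
  obtain ⟨C, T, hT, h⟩ := S.asymp_H N {0} isCompact_singleton 1 (by norm_num)
  refine ⟨C, T, fun t ht ht0 => ?_⟩
  have h1 := h t ht 0 rfl
  rw [norm_iteratedFDeriv_one, (S.hasFDerivAt_remainder N ht0 0).fderiv, S.fderiv_H_zero ht0,
    zero_sub, ← norm_neg, neg_sub, sub_neg_eq_add, add_comm] at h1
  refine le_of_eq_of_le (congrArg norm ?_) h1
  rw [Finset.range_eq_Ico, Finset.sum_eq_sum_Ico_succ_bot (Nat.succ_pos N)]
  simp
  rfl

theorem Fc_zero {k : ℕ} (hk : 1 ≤ k) : S.Fc k 0 = 0 := by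
  -- The expansion of `F` starts at `k = 1`; the index zero is filled with a zero coefficient.
  have key := eq_zero_of_norm_sum_le S.q_pos (a := fun k => if k = 0 then 0 else S.Fc k 0)
    (fun N => ?_) k
  · simpa [Nat.one_le_iff_ne_zero.1 hk] using key
  obtain ⟨C, T, hT, h⟩ := S.asymp_F N {0} isCompact_singleton 0 (by norm_num)
  refine ⟨C, T, fun t ht ht0 => ?_⟩
  have h1 := h t ht 0 rfl
  have h2 := S.F_zero t ht0
  rw [Prod.mk_zero_zero] at h2
  rw [norm_iteratedFDeriv_zero, h2, zero_sub, norm_neg] at h1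
  refine le_of_eq_of_le (congrArg norm ?_) h1
  rw [Finset.range_eq_Ico, Finset.sum_eq_sum_Ico_succ_bot (Nat.succ_pos N)]
  simp only [if_true, smul_zero, zero_add]
  refine Finset.sum_congr rfl fun i hi => ?_
  have : i ≠ 0 := by have := (Finset.mem_Ico.1 hi).1; omega
  simp [this]

theorem Hc_zero_zero : S.Hc 0 0 = 0 := by
  obtain ⟨C, hC⟩ := S.center.bound
  simpa [planeNorm] using hC.self_of_nhds

end AsympHamSystem

namespace AsympHamSystem.EnergyAngle

variable {S : AsympHamSystem} (A : S.EnergyAngle)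

/-! ### Regularity of the energy-angle coordinates -/

/-- One-sided differentiability at `√E = 0` gives `|G| ≤ C √E` there, and `raise` turns this bound
into a factor `√E`. -/
theorem smoothOfOrder_one_of_contDiffOn {G : ℝ × ℝ → ℝ} {r : ℝ} (hr : 0 < r)
    (hG : ContDiffOn ℝ (⊤ : ℕ∞) G (univ ×ˢ Icc 0 r)) (h0 : ∀ φ, G (φ, 0) = 0) :
    SmoothOfOrder (r ^ 2) 1 (fun E φ => G (φ, √E)) := by
  have h1 := (SmoothOfOrder.of_bddSmooth (ContDiffOn.bddSmooth hr hG)).raise fun φ => ?_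
  · simpa using h1
  have hd : DifferentiableWithinAt ℝ (fun ρ => G (φ, ρ)) (Icc 0 r) 0 := by
    have h2 := hG.differentiableOn (by simp) (φ, 0) ⟨mem_univ _, by simp [hr.le]⟩
    exact DifferentiableWithinAt.comp (g := G) (f := fun ρ : ℝ => (φ, ρ)) 0 h2 (by fun_prop)
      fun ρ hρ => ⟨mem_univ _, hρ⟩
  obtain ⟨C, hC⟩ := hd.isBigO_sub.bound
  refine ⟨C, ?_⟩
  have ht : Tendsto (fun E : ℝ => √E) (𝓝[>] 0) (𝓝[Icc 0 r] 0) := by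
    refine tendsto_nhdsWithin_iff.2 ⟨?_, ?_⟩
    · have : Tendsto (fun E : ℝ => √E) (𝓝 0) (𝓝 √0) := Real.continuous_sqrt.tendsto 0
      rw [Real.sqrt_zero] at this
      exact this.mono_left nhdsWithin_le_nhds
    · filter_upwards [Ioo_mem_nhdsGT (pow_pos hr 2)] with E hE
      exact ⟨Real.sqrt_nonneg E, (Real.sqrt_le_left hr.le).2 hE.2.le⟩
  filter_upwards [ht.eventually hC] with E hE
  simpa [h0, abs_of_nonneg (Real.sqrt_nonneg E)] using hE

theorem smoothOfOrder_X : SmoothOfOrder A.E₀ 1 (fun E φ => A.X φ E) := by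
  have h := smoothOfOrder_one_of_contDiffOn (Real.sqrt_pos.2 A.E₀_pos) A.smooth.fst
    fun φ => by simpa using (A.at_zero φ).1
  rw [Real.sq_sqrt A.E₀_pos.le] at h
  exact h.congr fun E hE φ => by simp [Real.sq_sqrt hE.1.le]

theorem smoothOfOrder_Y : SmoothOfOrder A.E₀ 1 (fun E φ => A.Y φ E) := by
  have h := smoothOfOrder_one_of_contDiffOn (Real.sqrt_pos.2 A.E₀_pos) A.smooth.snd
    fun φ => by simpa using (A.at_zero φ).2
  rw [Real.sq_sqrt A.E₀_pos.le] at h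
  exact h.congr fun E hE φ => by simp [Real.sq_sqrt hE.1.le]

/-- `∂_φ Y (φ, E)`. -/
noncomputable def dφY (A : S.EnergyAngle) (E φ : ℝ) : ℝ := deriv (fun u => A.Y u E) φ

/-- `∂_E Y (φ, E)`. -/
noncomputable def dEY (A : S.EnergyAngle) (E φ : ℝ) : ℝ := deriv (fun e => A.Y φ e) E

theorem smoothOfOrder_dφX : SmoothOfOrder A.E₀ 1 A.dφX := A.smoothOfOrder_X.angleDeriv

theorem smoothOfOrder_dφY : SmoothOfOrder A.E₀ 1 A.dφY := A.smoothOfOrder_Y.angleDeriv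

theorem smoothOfOrder_dEX : SmoothOfOrder A.E₀ (-1) A.dEX := A.smoothOfOrder_X.energyDeriv

theorem smoothOfOrder_dEY : SmoothOfOrder A.E₀ (-1) A.dEY := A.smoothOfOrder_Y.energyDeriv

variable {A} {E : ℝ}

theorem mem_Ioc (hE : E ∈ Ioo 0 A.E₀) : E ∈ Ioc 0 A.E₀ := ⟨hE.1, hE.2.le⟩

theorem omega_pos (hE : E ∈ Ioo 0 A.E₀) : 0 < A.ω E := A.ω_pos E (mem_Ioc hE)

theorem hasDerivAt_X (hE : E ∈ Ioo 0 A.E₀) (φ : ℝ) :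
    HasDerivAt (fun u => A.X u E) (A.dφX E φ) φ :=
  (A.smoothOfOrder_X.differentiableAt_angle hE φ).hasDerivAt

theorem hasDerivAt_Y (hE : E ∈ Ioo 0 A.E₀) (φ : ℝ) :
    HasDerivAt (fun u => A.Y u E) (A.dφY E φ) φ :=
  (A.smoothOfOrder_Y.differentiableAt_angle hE φ).hasDerivAt

theorem hasDerivAt_X_energy (hE : E ∈ Ioo 0 A.E₀) (φ : ℝ) :
    HasDerivAt (fun e => A.X φ e) (A.dEX E φ) E :=
  (A.smoothOfOrder_X.differentiableAt_energy hE φ).hasDerivAt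

theorem hasDerivAt_Y_energy (hE : E ∈ Ioo 0 A.E₀) (φ : ℝ) :
    HasDerivAt (fun e => A.Y φ e) (A.dEY E φ) E :=
  (A.smoothOfOrder_Y.differentiableAt_energy hE φ).hasDerivAt

theorem partialY_Hc (hE : E ∈ Ioo 0 A.E₀) (φ : ℝ) :
    partialY (S.Hc 0) (A.X φ E, A.Y φ E) = A.ω E * A.dφX E φ := by
  have h := (A.hasDeriv_X E (mem_Ioc hE) φ).deriv
  have h0 := (omega_pos hE).ne'
  rw [dφX, h]
  field_simp

theorem partialX_Hc (hE : E ∈ Ioo 0 A.E₀) (φ : ℝ) :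
    partialX (S.Hc 0) (A.X φ E, A.Y φ E) = -(A.ω E * A.dφY E φ) := by
  have h := (A.hasDeriv_Y E (mem_Ioc hE) φ).deriv
  have h0 := (omega_pos hE).ne'
  rw [dφY, h]
  field_simp

theorem hasDerivAt_comp_angle {h : ℝ × ℝ → ℝ} (hh : Differentiable ℝ h) (hE : E ∈ Ioo 0 A.E₀)
    (φ : ℝ) : HasDerivAt (fun u => h (A.X u E, A.Y u E))
      (partialX h (A.X φ E, A.Y φ E) * A.dφX E φ + partialY h (A.X φ E, A.Y φ E) * A.dφY E φ) φ := by
  have h1 := HasFDerivAt.comp_hasDerivAt (f := fun u => (A.X u E, A.Y u E)) φ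
    (hh (A.X φ E, A.Y φ E)).hasFDerivAt ((hasDerivAt_X hE φ).prodMk (hasDerivAt_Y hE φ))
  rwa [fderiv_apply_eq (hh _)] at h1

theorem hasDerivAt_comp_energy {h : ℝ × ℝ → ℝ} (hh : Differentiable ℝ h) (hE : E ∈ Ioo 0 A.E₀)
    (φ : ℝ) : HasDerivAt (fun e => h (A.X φ e, A.Y φ e))
      (partialX h (A.X φ E, A.Y φ E) * A.dEX E φ + partialY h (A.X φ E, A.Y φ E) * A.dEY E φ) E := by
  have h1 := HasFDerivAt.comp_hasDerivAt (f := fun e => (A.X φ e, A.Y φ e)) E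
    (hh (A.X φ E, A.Y φ E)).hasFDerivAt
    ((hasDerivAt_X_energy hE φ).prodMk (hasDerivAt_Y_energy hE φ))
  rwa [fderiv_apply_eq (hh _)] at h1

/-- The Jacobian determinant of the energy-angle coordinates. -/
theorem omega_mul_det (hE : E ∈ Ioo 0 A.E₀) (φ : ℝ) :
    A.ω E * (A.dφX E φ * A.dEY E φ - A.dφY E φ * A.dEX E φ) = 1 := by
  have h1 := hasDerivAt_comp_energy ((S.smooth_Hc 0).differentiable (by simp)) hE φ
  have h2 : (fun e => S.Hc 0 (A.X φ e, A.Y φ e)) =ᶠ[𝓝 E] fun e => e := by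
    filter_upwards [isOpen_Ioo.mem_nhds hE] with e he using A.energy e (mem_Ioc he) φ
  have h3 := (h1.congr_of_eventuallyEq h2.symm).unique (hasDerivAt_id E)
  rw [partialX_Hc hE, partialY_Hc hE] at h3
  linarith

variable (A)

/-- `1 / ω` is the Jacobian determinant of the coordinates, in which the orders `1` and `-1` cancel.
Passing to `ω` itself requires a lower bound for `1 / ω`, that is `exists_omega_le`. -/
theorem smoothOfOrder_inv_omega : SmoothOfOrder A.E₀ 0 (fun E _ => (A.ω E)⁻¹) := by
  have h := (A.smoothOfOrder_dφX.mul A.smoothOfOrder_dEY).sub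
    (A.smoothOfOrder_dφY.mul A.smoothOfOrder_dEX)
  exact h.congr fun E hE φ => (eq_inv_of_mul_eq_one_right (omega_mul_det hE φ)).symm

variable {A} in
theorem periodic_X (hE : E ∈ Ioo 0 A.E₀) :
    Function.Periodic (fun u => A.X u E) (2 * Real.pi) :=
  fun φ => (A.periodic E (mem_Ioc hE) φ).1

variable {A} in
theorem periodic_Y (hE : E ∈ Ioo 0 A.E₀) :
    Function.Periodic (fun u => A.Y u E) (2 * Real.pi) :=
  fun φ => (A.periodic E (mem_Ioc hE) φ).2

theorem exists_mem_closedBall : ∃ r, ∀ E ∈ Ioo 0 A.E₀, ∀ φ ∈ Icc 0 (2 * Real.pi),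
    (A.X φ E, A.Y φ E) ∈ Metric.closedBall (0 : ℝ × ℝ) r := by
  obtain ⟨C, hC⟩ := ((A.smoothOfOrder_X.of_le (by norm_num : (0 : ℤ) ≤ 1)).bddSmooth 0).bdd
    (2 * Real.pi)
  obtain ⟨D, hD⟩ := ((A.smoothOfOrder_Y.of_le (by norm_num : (0 : ℤ) ≤ 1)).bddSmooth 0).bdd
    (2 * Real.pi)
  refine ⟨max C D, fun E hE φ hφ => ?_⟩
  have hφ' : φ ∈ Icc (-(2 * Real.pi)) (2 * Real.pi) := ⟨by linarith [hφ.1, Real.pi_pos], hφ.2⟩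
  rw [mem_closedBall_zero_iff, Prod.norm_def]
  exact max_le_max (hC E hE φ hφ') (hD E hE φ hφ')

/-- The frequency is bounded: the period of a closed orbit is bounded from below in terms of a
Lipschitz constant of the vector field. -/
theorem exists_omega_le : ∃ C, 0 < C ∧ ∀ E ∈ Ioo 0 A.E₀, A.ω E ≤ C := by
  obtain ⟨r, hr⟩ := A.exists_mem_closedBall
  obtain ⟨C, hC0, hC⟩ := (S.smooth_Hc 0).partialY.exists_abs_sub_le r
  obtain ⟨D, hD0, hD⟩ := (S.smooth_Hc 0).partialX.exists_abs_sub_le r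
  have hpi := Real.pi_pos
  refine ⟨(max C D + 1) * (2 * Real.pi), by positivity, fun E hE => ?_⟩
  have hω := omega_pos hE
  set W : ℝ → ℝ × ℝ := fun φ => (A.dφX E φ, A.dφY E φ) with hW
  set P : ℝ → ℝ × ℝ := fun φ => (A.X φ E, A.Y φ E) with hP
  have hPd : ∀ φ, HasDerivAt P (W φ) φ := fun φ => (hasDerivAt_X hE φ).prodMk (hasDerivAt_Y hE φ)
  have hWc : Continuous W :=
    (A.smoothOfOrder_dφX.continuous_angle hE).prodMk (A.smoothOfOrder_dφY.continuous_angle hE)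
  -- At the angle of maximal speed the speed controls the diameter of the whole orbit. It is
  -- positive there because the orbit is not a point.
  obtain ⟨φm, hφm, hmax⟩ := (isCompact_Icc (a := (0 : ℝ)) (b := 2 * Real.pi)).exists_isMaxOn
    (nonempty_Icc.2 (by positivity)) hWc.norm.continuousOn
  have hPl : ∀ a ∈ Icc 0 (2 * Real.pi), ∀ b ∈ Icc 0 (2 * Real.pi),
      ‖P a - P b‖ ≤ ‖W φm‖ * (2 * Real.pi) := fun a ha b hb => by
    have h1 := (convex_Icc (0 : ℝ) (2 * Real.pi)).norm_image_sub_le_of_norm_hasDerivWithin_le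
      (f := P) (f' := W) (fun x _ => (hPd x).hasDerivWithinAt) (fun x hx => hmax hx) hb ha
    refine h1.trans (mul_le_mul_of_nonneg_left ?_ (norm_nonneg _))
    rw [Real.norm_eq_abs, abs_le]
    exact ⟨by linarith [ha.1, hb.2], by linarith [ha.2, hb.1]⟩
  have hpos : 0 < ‖W φm‖ := by
    rw [norm_pos_iff]
    intro h0
    have h1 : ‖P 0 - P Real.pi‖ ≤ 0 := by
      simpa [h0] using hPl 0 ⟨le_rfl, by positivity⟩ Real.pi ⟨by positivity, by linarith⟩
    have h2 : P 0 = P Real.pi := sub_eq_zero.1 (norm_le_zero_iff.1 h1)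
    have := A.least_period E (mem_Ioc hE) ⟨le_rfl, by positivity⟩
      ⟨Real.pi_pos.le, by linarith⟩ h2
    linarith
  -- By Rolle, each velocity component vanishes somewhere on the orbit. Up to sign `ω g` is a
  -- component of the Hamiltonian field, hence Lipschitz, so at `φm` it is at most `L` times the
  -- orbit diameter. Cancelling the speed afterwards bounds `ω`.
  have key : ∀ (c g : ℝ → ℝ) (L : ℝ), 0 ≤ L → c 0 = c (2 * Real.pi) → (∀ φ, HasDerivAt c (g φ) φ) →
      (∀ a ∈ Icc 0 (2 * Real.pi), ∀ b ∈ Icc 0 (2 * Real.pi),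
        A.ω E * |g a - g b| ≤ L * ‖P a - P b‖) →
      A.ω E * |g φm| ≤ L * (‖W φm‖ * (2 * Real.pi)) := fun c g L hL hc hd hg => by
    obtain ⟨ξ, hξ, h0⟩ := exists_hasDerivAt_eq_zero (f := c) (f' := g)
      (by positivity : (0 : ℝ) < 2 * Real.pi)
      (fun x _ => (hd x).continuousAt.continuousWithinAt) hc fun x _ => hd x
    have h1 := hg φm hφm ξ (Ioo_subset_Icc_self hξ)
    rw [h0, sub_zero] at h1
    exact h1.trans (mul_le_mul_of_nonneg_left (hPl _ hφm _ (Ioo_subset_Icc_self hξ)) hL)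
  have k1 := key (fun φ => A.X φ E) (A.dφX E) C hC0 (by simpa using (periodic_X hE 0).symm)
    (hasDerivAt_X hE) fun a ha b hb => by
      have := hC _ (hr E hE a ha) _ (hr E hE b hb)
      rwa [partialY_Hc hE, partialY_Hc hE, ← mul_sub, abs_mul, abs_of_pos hω] at this
  have k2 := key (fun φ => A.Y φ E) (A.dφY E) D hD0 (by simpa using (periodic_Y hE 0).symm)
    (hasDerivAt_Y hE) fun a ha b hb => by
      have := hD _ (hr E hE a ha) _ (hr E hE b hb)
      rwa [partialX_Hc hE, partialX_Hc hE, neg_sub_neg, ← mul_sub, abs_mul, abs_of_pos hω,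
        abs_sub_comm] at this
  have k3 : A.ω E * ‖W φm‖ ≤ (max C D + 1) * (‖W φm‖ * (2 * Real.pi)) := by
    have hM : 0 ≤ ‖W φm‖ * (2 * Real.pi) := by positivity
    have hn : ‖W φm‖ = max |A.dφX E φm| |A.dφY E φm| := rfl
    rcases max_choice |A.dφX E φm| |A.dφY E φm| with h | h
    · rw [← hn] at h
      rw [← h] at k1
      rw [h] at k1 ⊢
      rw [h] at hM
      exact k1.trans (mul_le_mul_of_nonneg_right (by linarith [le_max_left C D]) hM)
    · rw [← hn] at h
      rw [← h] at k2
      rw [h] at k2 ⊢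
      rw [h] at hM
      exact k2.trans (mul_le_mul_of_nonneg_right (by linarith [le_max_right C D]) hM)
  refine le_of_mul_le_mul_right ?_ hpos
  linarith

theorem smoothOfOrder_omega : SmoothOfOrder A.E₀ 0 (fun E _ => A.ω E) := by
  obtain ⟨C, hC0, hC⟩ := A.exists_omega_le
  have h := A.smoothOfOrder_inv_omega.inv (c := C⁻¹) (by positivity) fun E hE _ => by
    rw [abs_of_pos (inv_pos.2 (omega_pos hE))]
    exact inv_anti₀ (omega_pos hE) (hC E hE)
  simpa using h

theorem smoothOfOrder_comp {h : ℝ × ℝ → ℝ} (hh : ContDiff ℝ (⊤ : ℕ∞) h) :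
    SmoothOfOrder A.E₀ 0 (fun E φ => h (A.X φ E, A.Y φ E)) :=
  SmoothOfOrder.comp hh (A.smoothOfOrder_X.of_le (by norm_num))
    (A.smoothOfOrder_Y.of_le (by norm_num))

theorem exists_norm_le (M : ℝ) : ∃ C, 0 ≤ C ∧ ∀ E ∈ Ioo 0 A.E₀, ∀ φ ∈ Icc (-M) M,
    ‖(A.X φ E, A.Y φ E)‖ ≤ C * √E := by
  obtain ⟨C, hC0, hC⟩ := A.smoothOfOrder_X.bound M
  obtain ⟨D, hD0, hD⟩ := A.smoothOfOrder_Y.bound M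
  refine ⟨max C D, hC0.trans (le_max_left _ _), fun E hE φ hφ => ?_⟩
  have h1 := hC E hE φ hφ
  have h2 := hD E hE φ hφ
  rw [zpow_one] at h1 h2
  rw [Prod.norm_def]
  exact max_le (h1.trans (mul_le_mul_of_nonneg_right (le_max_left _ _) (Real.sqrt_nonneg _)))
    (h2.trans (mul_le_mul_of_nonneg_right (le_max_right _ _) (Real.sqrt_nonneg _)))

theorem smoothOfOrder_comp_one {h : ℝ × ℝ → ℝ} (hh : ContDiff ℝ (⊤ : ℕ∞) h) (h0 : h 0 = 0) :
    SmoothOfOrder A.E₀ 1 (fun E φ => h (A.X φ E, A.Y φ E)) := by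
  refine (A.smoothOfOrder_comp hh).raise (k := 0) fun φ => ?_
  obtain ⟨C, hC0, hC⟩ := A.exists_norm_le |φ|
  obtain ⟨D, hD0, hD⟩ := hh.exists_abs_sub_le (C * √A.E₀)
  refine ⟨D * C, ?_⟩
  filter_upwards [Ioo_mem_nhdsGT A.E₀_pos] with E hE
  have h1 := hC E hE φ (abs_le.1 le_rfl)
  have h2 := hD (A.X φ E, A.Y φ E) (by
    rw [mem_closedBall_zero_iff]
    exact h1.trans (mul_le_mul_of_nonneg_left (Real.sqrt_le_sqrt hE.2.le) hC0)) 0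
    (by simp; positivity)
  rw [h0, sub_zero, sub_zero] at h2
  rw [zero_add, zpow_one, mul_assoc]
  exact h2.trans (mul_le_mul_of_nonneg_left h1 hD0)

/-- A critical point at the origin makes the increment quadratic in `‖z‖`, and `‖z‖` is of size
`√E`. -/
theorem smoothOfOrder_comp_two {h : ℝ × ℝ → ℝ} (hh : ContDiff ℝ (⊤ : ℕ∞) h)
    (h0 : fderiv ℝ h 0 = 0) :
    SmoothOfOrder A.E₀ 2 (fun E φ => h (A.X φ E, A.Y φ E) - h (0, 0)) := by
  refine (A.smoothOfOrder_comp_one (h := fun z => h z - h (0, 0)) (hh.sub contDiff_const)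
    (sub_self _)).raise (k := 1) fun φ => ?_
  obtain ⟨C, hC0, hC⟩ := A.exists_norm_le |φ|
  obtain ⟨D, hD0, hD⟩ := hh.exists_abs_sub_le_sq h0 (C * √A.E₀)
  refine ⟨D * C ^ 2, ?_⟩
  filter_upwards [Ioo_mem_nhdsGT A.E₀_pos] with E hE
  have h1 := hC E hE φ (abs_le.1 le_rfl)
  have h2 := hD (A.X φ E, A.Y φ E) (by
    rw [mem_closedBall_zero_iff]
    exact h1.trans (mul_le_mul_of_nonneg_left (Real.sqrt_le_sqrt hE.2.le) hC0))
  refine h2.trans ?_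
  rw [show ((1 : ℤ) + 1) = ((2 : ℕ) : ℤ) by norm_num, zpow_natCast, mul_assoc, ← mul_pow]
  exact mul_le_mul_of_nonneg_left (pow_le_pow_left₀ (norm_nonneg _) h1 2) hD0

theorem smoothOfOrder_Hc (k : ℕ) :
    SmoothOfOrder A.E₀ 2 (fun E φ => S.Hc k (A.X φ E, A.Y φ E) - S.Hc k (0, 0)) :=
  A.smoothOfOrder_comp_two (S.smooth_Hc k) (S.fderiv_Hc_zero k)

theorem smoothOfOrder_Fc {k : ℕ} (hk : 1 ≤ k) :
    SmoothOfOrder A.E₀ 1 (fun E φ => S.Fc k (A.X φ E, A.Y φ E)) :=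
  A.smoothOfOrder_comp_one (S.smooth_Fc k hk) (S.Fc_zero hk)

/-- Together with order zero for `g`, this shows that `f ∂_E + g ∂_φ` preserves the order in `√E`:
the factor `E` in `f` pays for the energy derivative. -/
theorem smoothOfOrder_f {k : ℕ} (hk : 1 ≤ k) : SmoothOfOrder A.E₀ 2 (A.f k) := by
  have h := (A.smoothOfOrder_omega.neg).mul ((A.smoothOfOrder_Hc k).angleDeriv.sub
    ((A.smoothOfOrder_Fc hk).mul A.smoothOfOrder_dφX))
  exact h.congr fun E hE φ => by simp [f]

theorem smoothOfOrder_g {k : ℕ} (hk : 1 ≤ k) : SmoothOfOrder A.E₀ 0 (A.g k) := by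
  have h := (A.smoothOfOrder_omega).mul ((A.smoothOfOrder_Hc k).energyDeriv.sub
    ((A.smoothOfOrder_Fc hk).mul A.smoothOfOrder_dEX))
  exact h.congr fun E hE φ => by simp [g]

/-! ### Regularity of the averaging coefficients -/

/-- The Taylor part of `Z_k`. -/
noncomputable def taylorPart (L : ℕ → ℝ → ℝ) (v : ℕ → ℝ → ℝ → ℝ) (k : ℕ) (E φ : ℝ) : ℝ :=
  ∑ j ∈ Finset.Icc 1 (k - 1), ∑ p ∈ Finset.Icc 1 (k - j),
      (1 / (p.factorial : ℝ)) * iteratedDeriv p (L j) E *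
        ∑ a ∈ (Finset.Nat.antidiagonalTuple p (k - j)).filter (fun a => ∀ i, 1 ≤ a i),
          ∏ i, v (a i) E φ

/-- The `p`-th derivative loses `2p` orders and the `p` factors `v`, each of order two, restore
them. The order `l` is left free: the recursion uses `l = 2`, the stability estimate `l = 2s`. -/
theorem smoothOfOrder_taylorPart {R : ℝ} {l : ℤ} {L : ℕ → ℝ → ℝ} {v : ℕ → ℝ → ℝ → ℝ} {k : ℕ}
    (hL : ∀ j, 1 ≤ j → j < k → SmoothOfOrder R l (fun E _ => L j E))
    (hv : ∀ j, 1 ≤ j → j < k → SmoothOfOrder R 2 (v j)) :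
    SmoothOfOrder R l (taylorPart L v k) := by
  refine SmoothOfOrder.sum fun j hj => SmoothOfOrder.sum fun p hp => ?_
  rw [Finset.mem_Icc] at hj hp
  have h1 := ((hL j hj.1 (by omega)).iteratedDeriv p).const_mul (1 / (p.factorial : ℝ))
  have h2 : SmoothOfOrder R (2 * p) (fun E φ =>
      ∑ a ∈ (Finset.Nat.antidiagonalTuple p (k - j)).filter (fun a => ∀ i, 1 ≤ a i),
          ∏ i, v (a i) E φ) := by
    refine SmoothOfOrder.sum fun a ha => ?_
    rw [Finset.mem_filter, Finset.Nat.mem_antidiagonalTuple] at ha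
    have h3 : SmoothOfOrder R (2 * (Finset.univ : Finset (Fin p)).card)
        (fun E φ => ∏ i, v (a i) E φ) := by
      refine SmoothOfOrder.prod fun i _ => hv _ (ha.2 i) ?_
      have h1 : a i ≤ ∑ i, a i := Finset.single_le_sum (fun _ _ => Nat.zero_le _)
        (Finset.mem_univ i)
      omega
    simpa using h3
  simpa using h1.mul h2

theorem smoothOfOrder_zExpr {L : ℕ → ℝ → ℝ} {v : ℕ → ℝ → ℝ → ℝ} {k : ℕ}
    (hL : ∀ j, 1 ≤ j → j < k → SmoothOfOrder A.E₀ 2 (fun E _ => L j E))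
    (hv : ∀ j, 1 ≤ j → j < k → SmoothOfOrder A.E₀ 2 (v j)) :
    SmoothOfOrder A.E₀ 2 (A.zExpr L v k) := by
  refine SmoothOfOrder.add (SmoothOfOrder.sub (smoothOfOrder_taylorPart hL hv)
    (SmoothOfOrder.sum fun j hj => ?_)) ?_
  · rw [Finset.mem_Icc] at hj
    have h1 := hv (k - j) (by omega) (by omega)
    exact ((A.smoothOfOrder_f hj.1).mul h1.energyDeriv).add
      ((A.smoothOfOrder_g hj.1).mul h1.angleDeriv)
  · by_cases h : S.q < k
    · simp only [h, if_true]
      have := S.q_pos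
      exact (hv (k - S.q) (by omega) (by omega)).const_mul _
    · simp only [h, if_false]
      exact SmoothOfOrder.zero

theorem smoothOfOrder_Lam_v {k : ℕ} (hk : 1 ≤ k) :
    SmoothOfOrder A.E₀ 2 (fun E _ => A.Lam k E) ∧ SmoothOfOrder A.E₀ 2 (A.v k) := by
  induction k using Nat.strong_induction_on with
  | _ k ih =>
    have hZ := A.smoothOfOrder_zExpr (fun j hj hjk => (ih j hjk hj).1)
      (fun j hj hjk => (ih j hjk hj).2)
    have hLam : SmoothOfOrder A.E₀ 2 (fun E _ => A.Lam k E) :=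
      ((A.smoothOfOrder_f hk).mean.sub hZ.mean).congr fun E _ _ => A.Lam_eq hk E
    refine ⟨hLam, ?_⟩
    have h1 := ((hLam.sub ((A.smoothOfOrder_omega.mul (A.smoothOfOrder_Fc hk)).mul
      A.smoothOfOrder_dφX)).add hZ).prim
    have h2 := (A.smoothOfOrder_Hc k).add (A.smoothOfOrder_inv_omega.mul h1)
    refine h2.congr fun E hE φ => ?_
    rw [A.v_eq hk, one_div]

theorem smoothOfOrder_Lam {k : ℕ} (hk : 1 ≤ k) : SmoothOfOrder A.E₀ 2 (fun E _ => A.Lam k E) :=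
  (A.smoothOfOrder_Lam_v hk).1

theorem smoothOfOrder_v {k : ℕ} (hk : 1 ≤ k) : SmoothOfOrder A.E₀ 2 (A.v k) :=
  (A.smoothOfOrder_Lam_v hk).2

theorem smoothOfOrder_Z {k : ℕ} : SmoothOfOrder A.E₀ 2 (A.zExpr A.Lam A.v k) :=
  A.smoothOfOrder_zExpr (fun _ hj _ => A.smoothOfOrder_Lam hj) fun _ hj _ => A.smoothOfOrder_v hj

/-- The homological equation `ω ∂_φ v_k = Λ_k - f_k + Z_k`. -/
theorem omega_mul_deriv_v {k : ℕ} (hk : 1 ≤ k) (hE : E ∈ Ioo 0 A.E₀) (φ : ℝ) :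
    A.ω E * deriv (fun u => A.v k E u) φ
      = A.Lam k E - A.f k E φ + A.zExpr A.Lam A.v k E φ := by
  have hI := ((A.smoothOfOrder_Lam hk).sub ((A.smoothOfOrder_omega.mul (A.smoothOfOrder_Fc hk)).mul
      A.smoothOfOrder_dφX)).add (A.smoothOfOrder_Z (k := k))
  have hc := hI.continuous_angle hE
  have h1 := intervalIntegral.integral_hasDerivAt_right (hc.intervalIntegrable 0 φ)
    (hc.stronglyMeasurableAtFilter _ _) hc.continuousAt
  have h2 := hasDerivAt_comp_angle ((S.smooth_Hc k).differentiable (by simp)) hE φ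
  have h3 := (h2.sub_const (S.Hc k (0, 0))).fun_add (h1.const_mul (1 / A.ω E))
  have h4 : (fun u => A.v k E u) = _ := funext fun u => A.v_eq hk E u
  have h0 := (omega_pos hE).ne'
  rw [h4, h3.deriv, f, h2.deriv]
  field_simp
  ring

/-! ### Periodicity -/

/-- `2π`-periodic in the angle for `0 < E < R`. -/
def AnglePeriodic (R : ℝ) (u : ℝ → ℝ → ℝ) : Prop :=
  ∀ E ∈ Ioo 0 R, ∀ φ, u E (φ + 2 * Real.pi) = u E φ

theorem AnglePeriodic.angleDeriv {R : ℝ} {u : ℝ → ℝ → ℝ} (h : AnglePeriodic R u) :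
    AnglePeriodic R (fun E φ => deriv (u E) φ) := fun E hE φ => by
  simp only
  rw [← deriv_comp_add_const]
  congr 1
  exact funext (h E hE)

theorem AnglePeriodic.energyDeriv {R : ℝ} {u : ℝ → ℝ → ℝ} (h : AnglePeriodic R u) :
    AnglePeriodic R (fun E φ => deriv (fun e => u e φ) E) := fun E hE φ => by
  refine EventuallyEq.deriv_eq ?_
  filter_upwards [isOpen_Ioo.mem_nhds hE] with e he using h e he φ

theorem anglePeriodic_X : AnglePeriodic A.E₀ (fun E φ => A.X φ E) := fun _ hE => periodic_X hE

theorem anglePeriodic_Y : AnglePeriodic A.E₀ (fun E φ => A.Y φ E) := fun _ hE => periodic_Y hE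

theorem anglePeriodic_comp (h : ℝ × ℝ → ℝ) :
    AnglePeriodic A.E₀ (fun E φ => h (A.X φ E, A.Y φ E)) := fun E hE φ => by
  have h1 := A.anglePeriodic_X E hE φ
  have h2 := A.anglePeriodic_Y E hE φ
  simp only at h1 h2 ⊢
  rw [h1, h2]

theorem anglePeriodic_f (k : ℕ) : AnglePeriodic A.E₀ (A.f k) := fun E hE φ => by
  have h1 := (A.anglePeriodic_comp (S.Hc k)).angleDeriv E hE φ
  have h2 := A.anglePeriodic_comp (S.Fc k) E hE φ
  have h3 := A.anglePeriodic_X.angleDeriv E hE φ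
  simp only at h1 h2 h3
  simp only [f, dφX, h1, h2, h3]

theorem anglePeriodic_g (k : ℕ) : AnglePeriodic A.E₀ (A.g k) := fun E hE φ => by
  have h1 := (A.anglePeriodic_comp (S.Hc k)).energyDeriv E hE φ
  have h2 := A.anglePeriodic_comp (S.Fc k) E hE φ
  have h3 := A.anglePeriodic_X.energyDeriv E hE φ
  simp only at h1 h2 h3
  simp only [g, dEX, h1, h2, h3]

theorem anglePeriodic_zExpr {L : ℕ → ℝ → ℝ} {v : ℕ → ℝ → ℝ → ℝ} {k : ℕ}
    (hv : ∀ j, 1 ≤ j → j < k → AnglePeriodic A.E₀ (v j)) :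
    AnglePeriodic A.E₀ (A.zExpr L v k) := fun E hE φ => by
  have hq := S.q_pos
  unfold zExpr
  refine congrArg₂ (· + ·) (congrArg₂ (· - ·) ?_ ?_) ?_
  · refine Finset.sum_congr rfl fun j hj => Finset.sum_congr rfl fun p _ => ?_
    rw [Finset.mem_Icc] at hj
    congr 1
    refine Finset.sum_congr rfl fun a ha => Finset.prod_congr rfl fun i _ => ?_
    rw [Finset.mem_filter, Finset.Nat.mem_antidiagonalTuple] at ha
    have h1 : a i ≤ ∑ i, a i := Finset.single_le_sum (fun _ _ => Nat.zero_le _)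
      (Finset.mem_univ i)
    exact hv _ (ha.2 i) (by omega) E hE φ
  · refine Finset.sum_congr rfl fun j hj => ?_
    rw [Finset.mem_Icc] at hj
    have h1 := (hv (k - j) (by omega) (by omega)).energyDeriv E hE φ
    have h2 := (hv (k - j) (by omega) (by omega)).angleDeriv E hE φ
    simp only at h1 h2
    rw [A.anglePeriodic_f j E hE φ, A.anglePeriodic_g j E hE φ, h1, h2]
  · split_ifs with h
    · rw [hv (k - S.q) (by omega) (by omega) E hE φ]
    · rfl

/-- The Hamiltonian part of `f` is an angular derivative of a periodic function and has mean zero,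
so only the `F`-part contributes. -/
theorem mean_f {k : ℕ} (hk : 1 ≤ k) (hE : E ∈ Ioo 0 A.E₀) :
    mean (A.f k E) = mean (fun u => A.ω E * S.Fc k (A.X u E, A.Y u E) * A.dφX E u) := by
  have h1 := (A.smoothOfOrder_Hc k).angleDeriv.continuous_angle hE
  simp only [deriv_sub_const_fun] at h1
  have h2 := ((A.smoothOfOrder_omega.mul (A.smoothOfOrder_Fc hk)).mul
    A.smoothOfOrder_dφX).continuous_angle hE
  have h3 : ∫ φ in (0 : ℝ)..(2 * Real.pi), deriv (fun u => S.Hc k (A.X u E, A.Y u E)) φ = 0 := by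
    rw [intervalIntegral.integral_deriv_eq_sub (fun φ _ =>
      (hasDerivAt_comp_angle ((S.smooth_Hc k).differentiable (by simp)) hE φ).differentiableAt)
      (h1.intervalIntegrable _ _)]
    have := A.anglePeriodic_comp (S.Hc k) E hE 0
    simp only [zero_add] at this
    rw [this, sub_self]
  unfold mean
  congr 1
  have h4 : ∀ φ, A.f k E φ = A.ω E * S.Fc k (A.X φ E, A.Y φ E) * A.dφX E φ
      - A.ω E * deriv (fun u => S.Hc k (A.X u E, A.Y u E)) φ := fun φ => by
    simp only [f]; ring
  simp only [h4]
  rw [intervalIntegral.integral_sub (h2.intervalIntegrable _ _)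
    ((h1.intervalIntegrable _ _).const_mul _), intervalIntegral.integral_const_mul, h3, mul_zero,
    sub_zero]

/-- The choice of `Λ_k` is exactly what makes the integrand of the primitive have zero mean over a
period. -/
theorem anglePeriodic_v {k : ℕ} (hk : 1 ≤ k) : AnglePeriodic A.E₀ (A.v k) := by
  induction k using Nat.strong_induction_on with
  | _ k ih =>
    intro E hE φ
    have hZ := A.anglePeriodic_zExpr (L := A.Lam) (v := A.v) (k := k) fun j hj hjk => ih j hjk hj
    have hF := ((A.smoothOfOrder_omega.mul (A.smoothOfOrder_Fc hk)).mul A.smoothOfOrder_dφX)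
    have hcF := hF.continuous_angle hE
    have hcZ := (A.smoothOfOrder_Z (k := k)).continuous_angle hE
    set I : ℝ → ℝ := fun u => A.Lam k E - A.ω E * S.Fc k (A.X u E, A.Y u E) * A.dφX E u
          + A.zExpr A.Lam A.v k E u with hI
    have hIc : Continuous I := (continuous_const.sub hcF).add hcZ
    have hIp : Function.Periodic I (2 * Real.pi) := fun u => by
      have h2 := A.anglePeriodic_comp (S.Fc k) E hE u
      have h3 := A.anglePeriodic_X.angleDeriv E hE u
      simp only at h2 h3
      simp only [hI, dφX, h2, h3, hZ E hE u]
    have hI0 : ∫ u in (0 : ℝ)..(2 * Real.pi), I u = 0 := by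
      have h1 := A.Lam_eq hk E
      rw [A.mean_f hk hE, mean, mean] at h1
      have h2 : Continuous fun u => A.Lam k E - A.ω E * S.Fc k (A.X u E, A.Y u E) * A.dφX E u :=
        continuous_const.sub hcF
      simp only [hI]
      rw [intervalIntegral.integral_add (h2.intervalIntegrable _ _) (hcZ.intervalIntegrable _ _),
        intervalIntegral.integral_sub intervalIntegrable_const (hcF.intervalIntegrable _ _),
        intervalIntegral.integral_const, h1]
      have := Real.pi_pos
      simp only [smul_eq_mul]
      field_simp
      ring
    have h5 : ∫ u in (0 : ℝ)..(φ + 2 * Real.pi), I u = ∫ u in (0 : ℝ)..φ, I u := by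
      rw [← intervalIntegral.integral_add_adjacent_intervals (hIc.intervalIntegrable 0 φ)
        (hIc.intervalIntegrable φ _), hIp.intervalIntegral_add_eq φ 0, zero_add, hI0, add_zero]
    rw [A.v_eq hk, A.v_eq hk, h5]
    have := A.anglePeriodic_comp (S.Hc k) E hE φ
    simp only at this
    rw [this]

end AsympHamSystem.EnergyAngle

/-! ### Joint differentiability -/

/-- Continuity in the angle at fixed energy combines with a Lipschitz estimate in the energy that is
uniform over nearby angles. -/
theorem BddSmooth.continuousAt_uncurry {R : ℝ} {w : ℝ → ℝ → ℝ} {k : ℕ} (hw : BddSmooth R (k + 1) w)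
    {E : ℝ} (hE : E ∈ Ioo 0 R) (φ : ℝ) :
    ContinuousAt (fun p : ℝ × ℝ => w p.1 p.2) (E, φ) := by
  obtain ⟨C, hC⟩ := hw.2.2.2.2.bdd (|φ| + 1)
  have h0 : 0 < √(E / 2) := Real.sqrt_pos.2 (by linarith [hE.1])
  have hsub : ∀ e ∈ Ioo (E / 2) R, e ∈ Ioo 0 R := fun e he => ⟨by linarith [he.1, hE.1], he.2⟩
  have hE2 : E ∈ Ioo (E / 2) R := ⟨by linarith [hE.1], hE.2⟩
  have h1 : Tendsto (fun p : ℝ × ℝ => w p.1 p.2 - w E p.2) (𝓝 (E, φ)) (𝓝 0) := by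
    have h2 : ∀ᶠ p : ℝ × ℝ in 𝓝 (E, φ),
        ‖w p.1 p.2 - w E p.2‖ ≤ |C| / (2 * √(E / 2)) * |p.1 - E| := by
      have h3 : Ioo (E / 2) R ×ˢ Ioo (φ - 1) (φ + 1) ∈ 𝓝 (E, φ) :=
        prod_mem_nhds (isOpen_Ioo.mem_nhds hE2)
          (isOpen_Ioo.mem_nhds ⟨by linarith, by linarith⟩)
      filter_upwards [h3] with p hp
      have hp2 : p.2 ∈ Icc (-(|φ| + 1)) (|φ| + 1) :=
        ⟨by linarith [neg_abs_le φ, hp.2.1], by linarith [le_abs_self φ, hp.2.2]⟩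
      refine (convex_Ioo (E / 2) R).norm_image_sub_le_of_norm_hasDerivWithin_le
        (f := fun e => w e p.2) (fun e he =>
        (hw.hasDerivAt_radial (hsub e he) p.2).hasDerivWithinAt) (fun e he => ?_) hE2 hp.1
      have h4 : √(E / 2) ≤ √e := Real.sqrt_le_sqrt he.1.le
      rw [Real.norm_eq_abs, abs_div, abs_of_pos (by linarith : 0 < 2 * √e)]
      exact div_le_div₀ (abs_nonneg _) ((hC e (hsub e he) p.2 hp2).trans (le_abs_self C))
        (by linarith) (by linarith)
    refine squeeze_zero_norm' h2 ?_
    have h5 : Continuous fun p : ℝ × ℝ => |C| / (2 * √(E / 2)) * |p.1 - E| := by fun_prop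
    simpa using h5.tendsto (E, φ)
  have h6 : Tendsto (fun p : ℝ × ℝ => w E p.2) (𝓝 (E, φ)) (𝓝 (w E φ)) :=
    ((hw.continuous_angle hE).comp continuous_snd).tendsto (E, φ)
  simpa [ContinuousAt] using h1.add h6

namespace SmoothOfOrder

variable {R : ℝ} {k : ℤ} {u : ℝ → ℝ → ℝ}

theorem continuousAt_uncurry (hu : SmoothOfOrder R k u) {E : ℝ} (hE : E ∈ Ioo 0 R) (φ : ℝ) :
    ContinuousAt (fun p : ℝ × ℝ => u p.1 p.2) (E, φ) := by
  obtain ⟨w, hw, e⟩ := hu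
  have h1 : ContinuousAt (fun p : ℝ × ℝ => √p.1 ^ k) (E, φ) :=
    ContinuousAt.zpow₀ (by fun_prop) k (Or.inl (Real.sqrt_pos.2 hE.1).ne')
  refine (h1.mul ((hw 1).continuousAt_uncurry hE φ)).congr ?_
  have : Ioo 0 R ×ˢ univ ∈ 𝓝 (E, φ) := prod_mem_nhds (isOpen_Ioo.mem_nhds hE) univ_mem
  filter_upwards [this] with p hp
  exact (e p.1 hp.1 p.2).symm

/-- Both partial derivatives are jointly continuous. Strictness is what the inverse function theorem
for the coordinate map needs. -/
theorem hasStrictFDerivAt (hu : SmoothOfOrder R k u) {E : ℝ} (hE : E ∈ Ioo 0 R) (φ : ℝ) :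
    HasStrictFDerivAt (fun p : ℝ × ℝ => u p.1 p.2)
      ((ContinuousLinearMap.toSpanSingleton ℝ (deriv (fun e => u e φ) E)).coprod
        (ContinuousLinearMap.toSpanSingleton ℝ (deriv (u E) φ))) (E, φ) := by
  have hn : ∀ᶠ p : ℝ × ℝ in 𝓝 (E, φ), p.1 ∈ Ioo 0 R := by
    filter_upwards [prod_mem_nhds (isOpen_Ioo.mem_nhds hE) univ_mem] with p hp using hp.1
  have hc : Continuous fun c : ℝ => ContinuousLinearMap.toSpanSingleton ℝ c := by
    have : (fun c : ℝ => ContinuousLinearMap.toSpanSingleton ℝ c)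
        = fun c : ℝ => c • ContinuousLinearMap.id ℝ ℝ := by
      ext c; simp
    rw [this]
    fun_prop
  refine hasStrictFDerivAt_uncurry_coprod (u := (E, φ)) (f := u)
    (f₁ := fun e x => ContinuousLinearMap.toSpanSingleton ℝ (deriv (fun e => u e x) e))
    (f₂ := fun e x => ContinuousLinearMap.toSpanSingleton ℝ (deriv (u e) x)) ?_ ?_ ?_ ?_
  · filter_upwards [hn] with p hp
    exact (hu.differentiableAt_energy hp p.2).hasDerivAt.hasFDerivAt
  · filter_upwards [hn] with p hp
    exact (hu.differentiableAt_angle hp p.2).hasDerivAt.hasFDerivAt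
  · exact hc.continuousAt.comp (hu.energyDeriv.continuousAt_uncurry hE φ)
  · exact hc.continuousAt.comp (hu.angleDeriv.continuousAt_uncurry hE φ)

end SmoothOfOrder

/-- The linear automorphism of the plane with a given matrix. -/
noncomputable def planeEquiv (a b c d w : ℝ) (h : w * (b * c - d * a) = 1) :
    (ℝ × ℝ) ≃L[ℝ] (ℝ × ℝ) :=
  LinearEquiv.toContinuousLinearEquiv
    { toFun := fun p => (a * p.1 + b * p.2, c * p.1 + d * p.2)
      invFun := fun p => (w * (b * p.2 - d * p.1), w * (c * p.1 - a * p.2))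
      map_add' := fun p p' => by ext <;> simp <;> ring
      map_smul' := fun t p => by ext <;> simp <;> ring
      left_inv := fun p => by
        ext
        · simp only; linear_combination p.1 * h
        · simp only; linear_combination p.2 * h
      right_inv := fun p => by
        ext
        · simp only; linear_combination p.1 * h
        · simp only; linear_combination p.2 * h }

/-- The radial contraction `z ↦ r z / (1 + ‖z‖)` maps the connected punctured plane onto this set.
-/
theorem isConnected_ball_diff_zero {r : ℝ} (hr : 0 < r) :
    IsConnected {z : ℝ × ℝ | z ≠ 0 ∧ ‖z‖ < r} := by
  have h1 : IsConnected ({0}ᶜ : Set (ℝ × ℝ)) := by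
    apply isConnected_compl_singleton_of_one_lt_rank
    simp [one_add_one_eq_two]
  have hd : Continuous fun z : ℝ × ℝ => r / (1 + ‖z‖) :=
    continuous_const.div (by fun_prop) fun z => by positivity
  have hc : Continuous fun z : ℝ × ℝ => (r / (1 + ‖z‖)) • z := hd.smul continuous_id
  have h2 := h1.image _ hc.continuousOn
  convert h2 using 1
  ext z
  simp only [mem_ofPred_eq, mem_image, mem_compl_iff, mem_singleton_iff]
  constructor
  · rintro ⟨hz, hzr⟩
    have h3 : 0 < r - ‖z‖ := by linarith
    refine ⟨(1 / (r - ‖z‖)) • z, by simp [hz, h3.ne'], ?_⟩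
    rw [norm_smul, Real.norm_eq_abs, abs_of_pos (by positivity), smul_smul]
    have : r / (1 + 1 / (r - ‖z‖) * ‖z‖) * (1 / (r - ‖z‖)) = 1 := by
      field_simp
      rw [sub_add_cancel]
    rw [this, one_smul]
  · rintro ⟨w, hw, rfl⟩
    have h3 : 0 < 1 + ‖w‖ := by positivity
    refine ⟨by simp [hw, hr.ne', h3.ne'], ?_⟩
    rw [norm_smul, Real.norm_eq_abs, abs_of_pos (by positivity), div_mul_eq_mul_div, div_lt_iff₀ h3]
    nlinarith

theorem norm_le_planeNorm (z : ℝ × ℝ) : ‖z‖ ≤ planeNorm z := by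
  rw [Prod.norm_def, planeNorm]
  exact max_le (Real.abs_le_sqrt (by nlinarith)) (Real.abs_le_sqrt (by nlinarith))

theorem planeNorm_le_norm (z : ℝ × ℝ) : planeNorm z ≤ 2 * ‖z‖ := by
  have h1 : |z.1| ≤ ‖z‖ := norm_fst_le z
  have h2 : |z.2| ≤ ‖z‖ := norm_snd_le z
  refine Real.sqrt_le_iff.2 ⟨by positivity, ?_⟩
  have h3 : z.1 ^ 2 ≤ ‖z‖ ^ 2 := sq_le_sq' (by linarith [neg_abs_le z.1]) (by linarith [le_abs_self z.1])
  have h4 : z.2 ^ 2 ≤ ‖z‖ ^ 2 := sq_le_sq' (by linarith [neg_abs_le z.2]) (by linarith [le_abs_self z.2])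
  nlinarith [sq_nonneg ‖z‖]

theorem planeNorm_sq (z : ℝ × ℝ) : planeNorm z ^ 2 = z.1 ^ 2 + z.2 ^ 2 :=
  Real.sq_sqrt (by positivity)

theorem planeNorm_nonneg (z : ℝ × ℝ) : 0 ≤ planeNorm z := Real.sqrt_nonneg _

/-- Near the origin the energy is comparable to the square of the radius. -/
theorem AsympHamSystem.exists_energy_bounds (S : AsympHamSystem) : ∃ r > 0, ∀ z : ℝ × ℝ, ‖z‖ < r →
    planeNorm z ^ 2 / 4 ≤ S.Hc 0 z ∧ S.Hc 0 z ≤ planeNorm z ^ 2 := by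
  obtain ⟨C, hC⟩ := S.center.bound
  obtain ⟨r, hr, h⟩ := Metric.eventually_nhds_iff.1 hC
  -- With `planeNorm z ≤ 2 ‖z‖`, this radius keeps the cubic remainder below a quarter of `planeNorm
  -- z ^ 2`.
  refine ⟨min r (1 / (8 * (|C| + 1))), by positivity, fun z hz => ?_⟩
  have h1 := h (y := z) (by simpa using hz.trans_le (min_le_left _ _))
  have h2 : ‖z‖ < 1 / (8 * (|C| + 1)) := hz.trans_le (min_le_right _ _)
  have h3 := planeNorm_le_norm z
  have h0 := planeNorm_nonneg z
  rw [← planeNorm_sq, Real.norm_eq_abs, Real.norm_eq_abs, abs_of_nonneg (pow_nonneg h0 3)] at h1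
  have h4 : C * planeNorm z ≤ 1 / 4 := by
    rw [lt_div_iff₀ (by positivity)] at h2
    nlinarith [le_abs_self C, norm_nonneg z, abs_nonneg C]
  have h5 : C * planeNorm z ^ 3 ≤ planeNorm z ^ 2 / 4 := by
    nlinarith [sq_nonneg (planeNorm z)]
  have h6 := abs_le.1 (h1.trans h5)
  constructor <;> linarith [h6.1, h6.2, sq_nonneg (planeNorm z)]

/-! ### Energy-angle coordinates as a parametrization of a punctured neighbourhood of the origin -/

namespace AsympHamSystem.EnergyAngle

variable {S : AsympHamSystem} (A : S.EnergyAngle)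

/-- The map from energy and angle to the plane. -/
def toPlane (p : ℝ × ℝ) : ℝ × ℝ := (A.X p.2 p.1, A.Y p.2 p.1)

variable {A} {E : ℝ}

theorem hasStrictFDerivAt_toPlane (hE : E ∈ Ioo 0 A.E₀) (φ : ℝ) :
    HasStrictFDerivAt A.toPlane
      (planeEquiv (A.dEX E φ) (A.dφX E φ) (A.dEY E φ) (A.dφY E φ) (A.ω E)
        (omega_mul_det hE φ) : (ℝ × ℝ) →L[ℝ] ℝ × ℝ) (E, φ) := by
  have h := (A.smoothOfOrder_X.hasStrictFDerivAt hE φ).prodMk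
    (A.smoothOfOrder_Y.hasStrictFDerivAt hE φ)
  refine h.congr_fderiv (ContinuousLinearMap.ext fun p => ?_)
  ext <;> simp [planeEquiv, dEX, dEY, dφX, dφY, mul_comm]

theorem Hc_toPlane {p : ℝ × ℝ} (hE : p.1 ∈ Ioo 0 A.E₀) : S.Hc 0 (A.toPlane p) = p.1 :=
  A.energy p.1 (mem_Ioc hE) p.2

theorem toPlane_ne_zero {p : ℝ × ℝ} (hE : p.1 ∈ Ioo 0 A.E₀) : A.toPlane p ≠ 0 := fun h => by
  have h1 := Hc_toPlane hE
  rw [h, S.Hc_zero_zero] at h1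
  exact hE.1.ne h1

theorem eq_toIcoMod {u : ℝ → ℝ → ℝ} (hu : AnglePeriodic A.E₀ u) (hE : E ∈ Ioo 0 A.E₀) (φ : ℝ) :
    u E (toIcoMod Real.two_pi_pos 0 φ) = u E φ :=
  Function.Periodic.sub_zsmul_eq (hu E hE) _

theorem toPlane_toIcoMod (hE : E ∈ Ioo 0 A.E₀) (φ : ℝ) :
    A.toPlane (E, toIcoMod Real.two_pi_pos 0 φ) = A.toPlane (E, φ) :=
  Prod.ext (eq_toIcoMod A.anglePeriodic_X hE φ) (eq_toIcoMod A.anglePeriodic_Y hE φ)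

/-- The value of `H_0` recovers the energy, and minimality of the period recovers the angle modulo
`2π`; hence periodic functions of `(E, φ)` descend to the plane. -/
theorem eq_of_toPlane_eq {u : ℝ → ℝ → ℝ} (hu : AnglePeriodic A.E₀ u) {p p' : ℝ × ℝ}
    (hp : p.1 ∈ Ioo 0 A.E₀) (hp' : p'.1 ∈ Ioo 0 A.E₀) (h : A.toPlane p = A.toPlane p') :
    u p.1 p.2 = u p'.1 p'.2 := by
  have h1 : p.1 = p'.1 := by rw [← Hc_toPlane hp, h, Hc_toPlane hp']
  have hI : ∀ φ, toIcoMod Real.two_pi_pos 0 φ ∈ Ico 0 (2 * Real.pi) := fun φ => by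
    simpa using toIcoMod_mem_Ico Real.two_pi_pos 0 φ
  have h2 : toIcoMod Real.two_pi_pos 0 p.2 = toIcoMod Real.two_pi_pos 0 p'.2 := by
    refine A.least_period p.1 (mem_Ioc hp) (hI _) (hI _) ?_
    have h3 := toPlane_toIcoMod hp p.2
    have h4 := toPlane_toIcoMod hp' p'.2
    rw [← h1] at h4
    simp only [toPlane] at h3 h4 h
    simp only
    rw [h3, h4, h1, ← h1, h, h1]
  rw [← eq_toIcoMod hu hp, ← eq_toIcoMod hu hp', h2, h1]

/-- Every point near the origin lies on one of the closed orbits. -/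
theorem exists_toPlane_eq (A : S.EnergyAngle) : ∃ r > 0, ∀ z : ℝ × ℝ, z ≠ 0 → ‖z‖ < r →
    ∃ E ∈ Ioo 0 A.E₀, ∃ φ ∈ Icc 0 (2 * Real.pi), A.toPlane (E, φ) = z := by
  have hE₀ := A.E₀_pos
  obtain ⟨r₁, hr₁, hb⟩ := S.exists_energy_bounds
  have hcont : Tendsto (S.Hc 0) (𝓝 0) (𝓝 0) := by
    simpa [S.Hc_zero_zero] using (S.smooth_Hc 0).continuous.tendsto 0
  obtain ⟨r₂, hr₂, hb₂⟩ := Metric.eventually_nhds_iff.1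
    (hcont.eventually (gt_mem_nhds (by linarith : (0 : ℝ) < A.E₀ / 2)))
  set r := min r₁ r₂ with hr
  have hr0 : 0 < r := lt_min hr₁ hr₂
  set D := {z : ℝ × ℝ | z ≠ 0 ∧ ‖z‖ < r} with hD
  -- Inside the punctured ball `D` the sets `U` and `K` coincide. `U` is open by the inverse
  -- function theorem and `K` is compact, its parameter range being closed up to `ρ = 0`. So `D ∩ U`
  -- is open and closed in the connected set `D`, and it is nonempty because orbits of small energy
  -- are close to the origin.
  set U := A.toPlane '' (Ioo 0 A.E₀ ×ˢ univ) with hU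
  set K := (fun p : ℝ × ℝ => (A.X p.1 (p.2 ^ 2), A.Y p.1 (p.2 ^ 2))) ''
    (Icc 0 (2 * Real.pi) ×ˢ Icc 0 (√(A.E₀ / 2))) with hK
  have hUo : IsOpen U := by
    rw [isOpen_iff_mem_nhds]
    rintro _ ⟨⟨E, φ⟩, ⟨hE, -⟩, rfl⟩
    rw [← (hasStrictFDerivAt_toPlane hE φ).map_nhds_eq_of_equiv]
    exact image_mem_map (prod_mem_nhds (isOpen_Ioo.mem_nhds hE) univ_mem)
  have hKc : IsClosed K := by
    refine (IsCompact.image_of_continuousOn (isCompact_Icc.prod isCompact_Icc) ?_).isClosed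
    refine A.smooth.continuousOn.mono (prod_mono (subset_univ _) (Icc_subset_Icc_right ?_))
    exact Real.sqrt_le_sqrt (by linarith)
  have hsq : ∀ {ρ : ℝ}, ρ ∈ Icc 0 √(A.E₀ / 2) → ρ ^ 2 ≤ A.E₀ / 2 := fun {ρ} hρ => by
    have := pow_le_pow_left₀ hρ.1 hρ.2 2
    rwa [Real.sq_sqrt (by linarith)] at this
  have hUK : ∀ z ∈ D, z ∈ U → z ∈ K := by
    rintro z hz ⟨⟨E, φ⟩, ⟨hE, -⟩, rfl⟩
    have h1 : S.Hc 0 (A.toPlane (E, φ)) < A.E₀ / 2 :=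
      hb₂ (by simpa using hz.2.trans_le (min_le_right _ _))
    rw [Hc_toPlane (p := (E, φ)) hE] at h1
    have h2 := toIcoMod_mem_Ico Real.two_pi_pos 0 φ
    rw [zero_add] at h2
    refine ⟨(toIcoMod Real.two_pi_pos 0 φ, √E), ⟨Ico_subset_Icc_self h2,
      Real.sqrt_nonneg _, Real.sqrt_le_sqrt h1.le⟩, ?_⟩
    simp only [Real.sq_sqrt hE.1.le]
    exact toPlane_toIcoMod hE φ
  have hKU : ∀ z ∈ D, z ∈ K → ∃ E ∈ Ioo 0 A.E₀, ∃ φ ∈ Icc 0 (2 * Real.pi),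
      A.toPlane (E, φ) = z := by
    rintro z hz ⟨⟨φ, ρ⟩, ⟨hφ, hρ⟩, rfl⟩
    rcases hρ.1.eq_or_lt with h0 | h0
    · simp only at h0
      refine absurd ?_ hz.1
      simp only [← h0]
      rw [zero_pow two_ne_zero, (A.at_zero φ).1, (A.at_zero φ).2]
      rfl
    · exact ⟨ρ ^ 2, ⟨pow_pos h0 2, by linarith [hsq hρ]⟩, φ, hφ, rfl⟩
  have hne : (D ∩ U).Nonempty := by
    obtain ⟨C, hC0, hC⟩ := A.exists_norm_le 0
    have h1 : Tendsto (fun E : ℝ => C * √E) (𝓝[>] 0) (𝓝 0) := by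
      have : Continuous fun E : ℝ => C * √E := by fun_prop
      simpa using (this.tendsto 0).mono_left nhdsWithin_le_nhds
    obtain ⟨E, hE1, hE⟩ := ((h1.eventually (gt_mem_nhds hr0)).and
      (Ioo_mem_nhdsGT hE₀)).exists
    exact ⟨A.toPlane (E, 0), ⟨toPlane_ne_zero (p := (E, 0)) hE,
      (hC E hE 0 (by simp)).trans_lt hE1⟩, (E, 0), ⟨hE, mem_univ _⟩, rfl⟩
  have hDU : D ⊆ U := fun z hz => by
    by_contra hzU
    have hzK : z ∉ K := fun h => by
      obtain ⟨E, hE, φ, -, rfl⟩ := hKU z hz h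
      exact hzU ⟨(E, φ), ⟨hE, mem_univ _⟩, rfl⟩
    have hcov : D ⊆ U ∪ Kᶜ := fun w hw => or_iff_not_imp_left.2 fun hwU hwK => hwU (by
      obtain ⟨E, hE, φ, -, rfl⟩ := hKU w hw hwK
      exact ⟨(E, φ), ⟨hE, mem_univ _⟩, rfl⟩)
    obtain ⟨x, hxD, hxU, hxK⟩ := (isConnected_ball_diff_zero hr0).isPreconnected U Kᶜ hUo
      hKc.isOpen_compl hcov hne ⟨z, hz, hzK⟩
    exact hxK (hUK x hxD hxU)
  exact ⟨r, hr0, fun z hz hzr => hKU z ⟨hz, hzr⟩ (hUK z ⟨hz, hzr⟩ (hDU ⟨hz, hzr⟩))⟩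

open Classical in
/-- A function of energy and angle as a function on the plane, extended by zero. -/
noncomputable def pullback (A : S.EnergyAngle) (u : ℝ → ℝ → ℝ) (z : ℝ × ℝ) : ℝ :=
  if h : ∃ p : ℝ × ℝ, p.1 ∈ Ioo 0 A.E₀ ∧ A.toPlane p = z then u h.choose.1 h.choose.2 else 0

theorem pullback_toPlane {u : ℝ → ℝ → ℝ} (hu : AnglePeriodic A.E₀ u) {p : ℝ × ℝ}
    (hp : p.1 ∈ Ioo 0 A.E₀) : A.pullback u (A.toPlane p) = u p.1 p.2 := by
  have h : ∃ p' : ℝ × ℝ, p'.1 ∈ Ioo 0 A.E₀ ∧ A.toPlane p' = A.toPlane p := ⟨p, hp, rfl⟩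
  rw [pullback, dif_pos h]
  exact eq_of_toPlane_eq hu h.choose_spec.1 hp h.choose_spec.2

theorem pullback_zero (u : ℝ → ℝ → ℝ) : A.pullback u 0 = 0 := by
  rw [pullback, dif_neg]
  rintro ⟨p, hp, h⟩
  exact toPlane_ne_zero hp h

/-- The derivative of a function of energy and angle with respect to the point of the plane. -/
theorem hasFDerivAt_pullback {k : ℤ} {u : ℝ → ℝ → ℝ} (hu : SmoothOfOrder A.E₀ k u)
    (hup : AnglePeriodic A.E₀ u) (hE : E ∈ Ioo 0 A.E₀) (φ : ℝ) :
    ∃ L : ℝ × ℝ →L[ℝ] ℝ, HasFDerivAt (A.pullback u) L (A.toPlane (E, φ)) ∧ ∀ e : ℝ × ℝ,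
      L e = deriv (fun e => u e φ) E * (A.ω E * (A.dφX E φ * e.2 - A.dφY E φ * e.1))
        + deriv (u E) φ * (A.ω E * (A.dEY E φ * e.1 - A.dEX E φ * e.2)) := by
  have hs := hasStrictFDerivAt_toPlane hE φ
  -- Near the point the pullback equals `u ∘ Ψ`, whatever representatives its definition picks; the
  -- chain rule then gives the inverse Jacobian.
  set Ψ := hs.localInverse A.toPlane _ (E, φ) with hΨ
  have h1 : HasFDerivAt Ψ _ (A.toPlane (E, φ)) := hs.to_localInverse.hasFDerivAt
  have h2 : Ψ (A.toPlane (E, φ)) = (E, φ) := hs.localInverse_apply_image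
  have h3 := (hu.hasStrictFDerivAt hE φ).hasFDerivAt
  rw [← h2] at h3
  refine ⟨_, (h3.comp (A.toPlane (E, φ)) h1).congr_of_eventuallyEq ?_, fun e => ?_⟩
  · have h4 : ∀ᶠ z in 𝓝 (A.toPlane (E, φ)), Ψ z ∈ Ioo 0 A.E₀ ×ˢ univ := by
      refine h1.continuousAt ?_
      rw [h2]
      exact prod_mem_nhds (isOpen_Ioo.mem_nhds hE) univ_mem
    filter_upwards [h4, hs.eventually_right_inverse] with z hz hz'
    have h5 := pullback_toPlane hup (p := Ψ z) hz.1
    rw [hz'] at h5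
    exact h5
  · simp [planeEquiv]
    ring

theorem abs_pullback_le {u : ℝ → ℝ → ℝ} (hu : SmoothOfOrder A.E₀ 2 u)
    (hup : AnglePeriodic A.E₀ u) : ∃ C, 0 ≤ C ∧ ∀ E ∈ Ioo 0 A.E₀, ∀ φ,
      |A.pullback u (A.toPlane (E, φ))| ≤ C * E := by
  obtain ⟨C, hC0, hC⟩ := hu.bound (2 * Real.pi)
  refine ⟨C, hC0, fun E hE φ => ?_⟩
  have h2 := toIcoMod_mem_Ico Real.two_pi_pos 0 φ
  rw [zero_add] at h2
  rw [pullback_toPlane hup hE, ← eq_toIcoMod hup hE]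
  refine (hC E hE _ ⟨by linarith [h2.1, Real.two_pi_pos], h2.2.le⟩).trans_eq ?_
  rw [show (2 : ℤ) = ((2 : ℕ) : ℤ) by norm_num, zpow_natCast, Real.sq_sqrt hE.1.le]

/-- A function that is `O(E)` is `O(‖z‖²)`. This allows the Lyapunov function to be differentiated
along a solution at the origin too, where the coordinates break down. -/
theorem hasFDerivAt_pullback_zero {u : ℝ → ℝ → ℝ} (hu : SmoothOfOrder A.E₀ 2 u)
    (hup : AnglePeriodic A.E₀ u) : HasFDerivAt (A.pullback u) (0 : ℝ × ℝ →L[ℝ] ℝ) 0 := by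
  obtain ⟨C, hC0, hC⟩ := abs_pullback_le hu hup
  obtain ⟨r, hr, h⟩ := A.exists_toPlane_eq
  obtain ⟨r', hr', h'⟩ := S.exists_energy_bounds
  have h1 : A.pullback u =O[𝓝 0] fun z => ‖z - 0‖ ^ 2 := by
    refine IsBigO.of_bound (C * 4) ?_
    filter_upwards [Metric.ball_mem_nhds (0 : ℝ × ℝ) (lt_min hr hr')] with z hz
    rw [mem_ball_zero_iff, lt_min_iff] at hz
    rw [sub_zero, norm_pow, norm_norm]
    rcases eq_or_ne z 0 with rfl | h0
    · simp [pullback_zero]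
    · obtain ⟨E, hE, φ, -, rfl⟩ := h z h0 hz.1
      have h2 := (h' _ hz.2).2
      rw [Hc_toPlane (p := (E, φ)) hE] at h2
      have h3 : planeNorm (A.toPlane (E, φ)) ^ 2 ≤ (2 * ‖A.toPlane (E, φ)‖) ^ 2 :=
        pow_le_pow_left₀ (planeNorm_nonneg _) (planeNorm_le_norm _) 2
      calc _ ≤ C * E := hC E hE φ
        _ ≤ C * (2 * ‖A.toPlane (E, φ)‖) ^ 2 :=
          mul_le_mul_of_nonneg_left (h2.trans h3) hC0
        _ = _ := by ring
  refine HasFDerivAt.of_isLittleO ?_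
  have h2 : (fun z : ℝ × ℝ => ‖z - 0‖ ^ 2) =o[𝓝 0] fun z => z - 0 := by
    refine (isLittleO_norm_pow_id one_lt_two).congr (fun z => by simp) (fun z => by simp)
  simpa [pullback_zero] using h1.trans_isLittleO h2

end AsympHamSystem.EnergyAngle

namespace AsympHamSystem

variable (S : AsympHamSystem)

/-! ### Expansion of the vector field -/

/-- The coefficients of the expansion of the vector field in powers of `t ^ (-1 / q)`. -/
noncomputable def fieldCoeff (j : ℕ) (z : ℝ × ℝ) : ℝ × ℝ :=
  (partialY (S.Hc j) z, -partialX (S.Hc j) z + if j = 0 then 0 else S.Fc j z)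

theorem differentiable_Hc (k : ℕ) : Differentiable ℝ (S.Hc k) :=
  (S.smooth_Hc k).differentiable (by simp)

/-- The gradient of the remainder vanishes at the origin and its second derivative is controlled by
the twice differentiated expansion, so the mean value inequality yields the extra factor `‖z‖`. -/
theorem exists_norm_fderiv_H_sub_le (N : ℕ) (r : ℝ) : ∃ C T : ℝ, 0 ≤ C ∧ 0 < T ∧ ∀ t ≥ T,
    ∀ z ∈ Metric.closedBall (0 : ℝ × ℝ) r, 
      ‖fderiv ℝ (fun w => S.H w t) z - fderiv ℝ (S.Hc 0) z
        - ∑ k ∈ Finset.Icc 1 N, t ^ (-(k : ℝ) / (S.q : ℝ)) • fderiv ℝ (S.Hc k) z‖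
        ≤ C * t ^ (-((N : ℝ) + 1) / (S.q : ℝ)) * ‖z‖ := by
  obtain ⟨C, T, hT, h⟩ := S.asymp_H N _ (isCompact_closedBall (0 : ℝ × ℝ) r) 2 le_rfl
  refine ⟨|C|, T, abs_nonneg C, hT, fun t ht z hz => ?_⟩
  have ht0 : 0 < t := hT.trans_le ht
  have hr : 0 ≤ r := (norm_nonneg z).trans (by simpa using hz)
  set G : ℝ × ℝ → ℝ := fun w => S.H w t - S.Hc 0 w
        - ∑ k ∈ Finset.Icc 1 N, t ^ (-(k : ℝ) / (S.q : ℝ)) * S.Hc k w with hG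
  have hGs : ContDiff ℝ (⊤ : ℕ∞) G := ((S.contDiff_H ht0).sub (S.smooth_Hc 0)).sub
    (ContDiff.sum fun k _ => contDiff_const.mul (S.smooth_Hc k))
  have hGd : ∀ z, fderiv ℝ G z = _ := fun z => (S.hasFDerivAt_remainder N ht0 z).fderiv
  have hG0 : fderiv ℝ G 0 = 0 := by
    rw [hGd]
    simp [S.fderiv_H_zero ht0, S.fderiv_Hc_zero]
  rw [← hGd]
  have h1 := (convex_closedBall (0 : ℝ × ℝ) r).norm_image_sub_le_of_norm_fderiv_le
    (f := fderiv ℝ G) (C := |C| * t ^ (-((N : ℝ) + 1) / (S.q : ℝ)))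
    (fun x _ => (hGs.fderiv_right (m := (⊤ : ℕ∞)) (by simp)).differentiable (by simp) x)
    (fun x hx => ?_) (Metric.mem_closedBall_self hr) hz
  · simpa [hG0] using h1
  · have h2 := h t ht x hx
    rw [← norm_iteratedFDeriv_fderiv, norm_iteratedFDeriv_one] at h2
    exact h2.trans (mul_le_mul_of_nonneg_right (le_abs_self C) (Real.rpow_nonneg ht0.le _))

theorem exists_abs_F_sub_le (N : ℕ) (r : ℝ) : ∃ C T : ℝ, 0 ≤ C ∧ 0 < T ∧ ∀ t ≥ T,
    ∀ z ∈ Metric.closedBall (0 : ℝ × ℝ) r,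
      |S.F z t - ∑ k ∈ Finset.Icc 1 N, t ^ (-(k : ℝ) / (S.q : ℝ)) * S.Fc k z|
        ≤ C * t ^ (-((N : ℝ) + 1) / (S.q : ℝ)) * ‖z‖ := by
  obtain ⟨C, T, hT, h⟩ := S.asymp_F N _ (isCompact_closedBall (0 : ℝ × ℝ) r) 1 le_rfl
  refine ⟨|C|, T, abs_nonneg C, hT, fun t ht z hz => ?_⟩
  have ht0 : 0 < t := hT.trans_le ht
  have hr : 0 ≤ r := (norm_nonneg z).trans (by simpa using hz)
  set G : ℝ × ℝ → ℝ := fun w => S.F w t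
        - ∑ k ∈ Finset.Icc 1 N, t ^ (-(k : ℝ) / (S.q : ℝ)) * S.Fc k w with hG
  have hGs : ContDiff ℝ (⊤ : ℕ∞) G := (S.contDiff_F ht0).sub
    (ContDiff.sum fun k hk => contDiff_const.mul (S.smooth_Fc k (Finset.mem_Icc.1 hk).1))
  have hG0 : G 0 = 0 := by
    have h2 := S.F_zero t ht0
    rw [Prod.mk_zero_zero] at h2
    simp only [hG, h2, zero_sub, neg_eq_zero]
    exact Finset.sum_eq_zero fun k hk => by rw [S.Fc_zero (Finset.mem_Icc.1 hk).1, mul_zero]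
  have h1 := (convex_closedBall (0 : ℝ × ℝ) r).norm_image_sub_le_of_norm_fderiv_le
    (f := G) (C := |C| * t ^ (-((N : ℝ) + 1) / (S.q : ℝ)))
    (fun x _ => hGs.differentiable (by simp) x)
    (fun x hx => ?_) (Metric.mem_closedBall_self hr) hz
  · simpa [hG0] using h1
  · have h2 := h t ht x hx
    rw [norm_iteratedFDeriv_one] at h2
    exact h2.trans (mul_le_mul_of_nonneg_right (le_abs_self C) (Real.rpow_nonneg ht0.le _))

theorem exists_norm_field_sub_le (N : ℕ) (r : ℝ) : ∃ C T : ℝ, 0 ≤ C ∧ 0 < T ∧ ∀ t ≥ T,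
    ∀ z ∈ Metric.closedBall (0 : ℝ × ℝ) r,
      ‖S.field t z - S.fieldCoeff 0 z
        - ∑ k ∈ Finset.Icc 1 N, t ^ (-(k : ℝ) / (S.q : ℝ)) • S.fieldCoeff k z‖
        ≤ C * t ^ (-((N : ℝ) + 1) / (S.q : ℝ)) * ‖z‖ := by
  obtain ⟨C, T, hC, hT, h⟩ := S.exists_norm_fderiv_H_sub_le N r
  obtain ⟨C', T', hC', hT', h'⟩ := S.exists_abs_F_sub_le N r
  refine ⟨C + C', max T T', by positivity, lt_max_of_lt_left hT, fun t ht z hz => ?_⟩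
  have ht0 : 0 < t := hT.trans_le ((le_max_left _ _).trans ht)
  have h1 := h t ((le_max_left _ _).trans ht) z hz
  have h2 := h' t ((le_max_right _ _).trans ht) z hz
  set P := fderiv ℝ (fun w => S.H w t) z - fderiv ℝ (S.Hc 0) z
        - ∑ k ∈ Finset.Icc 1 N, t ^ (-(k : ℝ) / (S.q : ℝ)) • fderiv ℝ (S.Hc k) z with hP
  have hd := (S.contDiff_H ht0).differentiable (by simp) z
  have e1 : P (1, 0) = partialX (fun w => S.H w t) z - partialX (S.Hc 0) z
      - ∑ k ∈ Finset.Icc 1 N, t ^ (-(k : ℝ) / (S.q : ℝ)) * partialX (S.Hc k) z := by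
    rw [partialX_eq hd, partialX_eq (S.differentiable_Hc 0 z), hP]
    simp [partialX_eq (S.differentiable_Hc _ z)]
  have e2 : P (0, 1) = partialY (fun w => S.H w t) z - partialY (S.Hc 0) z
      - ∑ k ∈ Finset.Icc 1 N, t ^ (-(k : ℝ) / (S.q : ℝ)) * partialY (S.Hc k) z := by
    rw [partialY_eq hd, partialY_eq (S.differentiable_Hc 0 z), hP]
    simp [partialY_eq (S.differentiable_Hc _ z)]
  have n1 : |P (1, 0)| ≤ ‖P‖ := by simpa using P.le_opNorm (1, 0)
  have n2 : |P (0, 1)| ≤ ‖P‖ := by simpa using P.le_opNorm (0, 1)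
  have hX : 0 ≤ t ^ (-((N : ℝ) + 1) / (S.q : ℝ)) * ‖z‖ := by positivity
  rw [Prod.norm_def]
  refine max_le ?_ ?_
  · have : (S.field t z - S.fieldCoeff 0 z
        - ∑ k ∈ Finset.Icc 1 N, t ^ (-(k : ℝ) / (S.q : ℝ)) • S.fieldCoeff k z).1 = P (0, 1) := by
      rw [e2]
      simp [field, fieldCoeff, Prod.fst_sum]
    rw [this]
    refine (n2.trans h1).trans ?_
    rw [mul_assoc, mul_assoc]
    exact mul_le_mul_of_nonneg_right (by linarith) hX
  · have : (S.field t z - S.fieldCoeff 0 z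
        - ∑ k ∈ Finset.Icc 1 N, t ^ (-(k : ℝ) / (S.q : ℝ)) • S.fieldCoeff k z).2
        = -P (1, 0) + (S.F z t - ∑ k ∈ Finset.Icc 1 N, t ^ (-(k : ℝ) / (S.q : ℝ)) * S.Fc k z) := by
      have h3 : ∑ k ∈ Finset.Icc 1 N, t ^ (-(k : ℝ) / (S.q : ℝ)) *
            (-partialX (S.Hc k) z + if k = 0 then 0 else S.Fc k z)
          = -∑ k ∈ Finset.Icc 1 N, t ^ (-(k : ℝ) / (S.q : ℝ)) * partialX (S.Hc k) z
            + ∑ k ∈ Finset.Icc 1 N, t ^ (-(k : ℝ) / (S.q : ℝ)) * S.Fc k z := by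
        rw [← Finset.sum_neg_distrib, ← Finset.sum_add_distrib]
        refine Finset.sum_congr rfl fun k hk => ?_
        have : k ≠ 0 := by have := (Finset.mem_Icc.1 hk).1; omega
        simp only [this, if_false]
        ring
      rw [e1]
      simp only [field, fieldCoeff, Prod.snd_sub, Prod.snd_sum, Prod.smul_snd, smul_eq_mul, h3,
        if_true]
      ring
    rw [this]
    refine (abs_add_le _ _).trans ?_
    rw [abs_neg, add_mul, add_mul]
    exact add_le_add (n1.trans h1) h2

namespace EnergyAngle

variable {S} (A : S.EnergyAngle)

/-- The derivative of a function of energy and angle along a vector of the plane. -/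
noncomputable def planeDeriv (u : ℝ → ℝ → ℝ) (E φ : ℝ) (e : ℝ × ℝ) : ℝ :=
  deriv (fun e => u e φ) E * (A.ω E * (A.dφX E φ * e.2 - A.dφY E φ * e.1))
    + deriv (u E) φ * (A.ω E * (A.dEY E φ * e.1 - A.dEX E φ * e.2))

variable {A}

theorem planeDeriv_add (u : ℝ → ℝ → ℝ) (E φ : ℝ) (e e' : ℝ × ℝ) :
    A.planeDeriv u E φ (e + e') = A.planeDeriv u E φ e + A.planeDeriv u E φ e' := by
  simp [planeDeriv]; ring

theorem planeDeriv_smul (u : ℝ → ℝ → ℝ) (E φ c : ℝ) (e : ℝ × ℝ) :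
    A.planeDeriv u E φ (c • e) = c * A.planeDeriv u E φ e := by
  simp [planeDeriv]; ring

theorem planeDeriv_sum {ι : Type*} (s : Finset ι) (u : ℝ → ℝ → ℝ) (E φ : ℝ) (e : ι → ℝ × ℝ) :
    A.planeDeriv u E φ (∑ i ∈ s, e i) = ∑ i ∈ s, A.planeDeriv u E φ (e i) := by
  classical
  induction s using Finset.induction_on with
  | empty => simp [planeDeriv]
  | insert i s hi ih => rw [Finset.sum_insert hi, Finset.sum_insert hi, planeDeriv_add, ih]

variable {E : ℝ}

/-- `f_j` and `g_j` are the energy and angle components of the `j`-th field coefficient. -/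
theorem planeDeriv_fieldCoeff (u : ℝ → ℝ → ℝ) (hE : E ∈ Ioo 0 A.E₀) (φ : ℝ) {j : ℕ} (hj : 1 ≤ j) :
    A.planeDeriv u E φ (S.fieldCoeff j (A.toPlane (E, φ)))
      = A.f j E φ * deriv (fun e => u e φ) E + A.g j E φ * deriv (u E) φ := by
  have h1 := (hasDerivAt_comp_angle (S.differentiable_Hc j) hE φ).deriv
  have h2 := (hasDerivAt_comp_energy (S.differentiable_Hc j) hE φ).deriv
  have hj0 : j ≠ 0 := by omega
  simp only [planeDeriv, fieldCoeff, f, g, h1, h2, toPlane, hj0, if_false]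
  ring

theorem planeDeriv_fieldCoeff_zero (u : ℝ → ℝ → ℝ) (hE : E ∈ Ioo 0 A.E₀) (φ : ℝ) :
    A.planeDeriv u E φ (S.fieldCoeff 0 (A.toPlane (E, φ))) = A.ω E * deriv (u E) φ := by
  have h := omega_mul_det hE φ
  simp only [planeDeriv, fieldCoeff, toPlane, partialX_Hc hE, partialY_Hc hE, if_true]
  linear_combination (A.ω E * deriv (u E) φ) * h

theorem exists_abs_le {u : ℝ → ℝ → ℝ} (hu : SmoothOfOrder A.E₀ 2 u) :
    ∃ C, 0 ≤ C ∧ ∀ E ∈ Ioo 0 A.E₀, ∀ φ ∈ Icc 0 (2 * Real.pi), |u E φ| ≤ C * E := by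
  obtain ⟨C, hC0, hC⟩ := hu.bound (2 * Real.pi)
  refine ⟨C, hC0, fun E hE φ hφ => ?_⟩
  refine (hC E hE φ ⟨by linarith [hφ.1, Real.two_pi_pos], hφ.2⟩).trans_eq ?_
  rw [show (2 : ℤ) = ((2 : ℕ) : ℤ) by norm_num, zpow_natCast, Real.sq_sqrt hE.1.le]

/-- Both cartesian components of the gradient have order one. A field remainder of size `‖z‖`, hence
of size `√E`, therefore contributes at most a multiple of `E`. -/
theorem exists_abs_planeDeriv_le {u : ℝ → ℝ → ℝ} (hu : SmoothOfOrder A.E₀ 2 u) :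
    ∃ C, 0 ≤ C ∧ ∀ E ∈ Ioo 0 A.E₀, ∀ φ ∈ Icc 0 (2 * Real.pi), ∀ e : ℝ × ℝ,
      |A.planeDeriv u E φ e| ≤ C * √E * ‖e‖ := by
  have h1 : SmoothOfOrder A.E₀ 1 (fun E φ => A.ω E * (deriv (u E) φ * A.dEY E φ)
      - A.ω E * (deriv (fun e => u e φ) E * A.dφY E φ)) :=
    (A.smoothOfOrder_omega.mul (hu.angleDeriv.mul A.smoothOfOrder_dEY)).sub
      (A.smoothOfOrder_omega.mul (hu.energyDeriv.mul A.smoothOfOrder_dφY))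
  have h2 : SmoothOfOrder A.E₀ 1 (fun E φ => A.ω E * (deriv (fun e => u e φ) E * A.dφX E φ)
      - A.ω E * (deriv (u E) φ * A.dEX E φ)) :=
    (A.smoothOfOrder_omega.mul (hu.energyDeriv.mul A.smoothOfOrder_dφX)).sub
      (A.smoothOfOrder_omega.mul (hu.angleDeriv.mul A.smoothOfOrder_dEX))
  obtain ⟨C, hC0, hC⟩ := h1.bound (2 * Real.pi)
  obtain ⟨D, hD0, hD⟩ := h2.bound (2 * Real.pi)
  refine ⟨C + D, by positivity, fun E hE φ hφ e => ?_⟩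
  have hφ' : φ ∈ Icc (-(2 * Real.pi)) (2 * Real.pi) := ⟨by linarith [hφ.1, Real.two_pi_pos], hφ.2⟩
  have h3 := hC E hE φ hφ'
  have h4 := hD E hE φ hφ'
  rw [zpow_one] at h3 h4
  have h5 : A.planeDeriv u E φ e = (A.ω E * (deriv (u E) φ * A.dEY E φ)
      - A.ω E * (deriv (fun e => u e φ) E * A.dφY E φ)) * e.1
      + (A.ω E * (deriv (fun e => u e φ) E * A.dφX E φ)
      - A.ω E * (deriv (u E) φ * A.dEX E φ)) * e.2 := by
    rw [planeDeriv]; ring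
  rw [h5]
  refine (abs_add_le _ _).trans ?_
  rw [abs_mul, abs_mul, add_mul, add_mul]
  exact add_le_add (mul_le_mul h3 (norm_fst_le e) (abs_nonneg _) (by positivity))
    (mul_le_mul h4 (norm_snd_le e) (abs_nonneg _) (by positivity))

theorem smoothOfOrder_energy (R : ℝ) : SmoothOfOrder R 2 (fun E _ => E) := by
  refine (SmoothOfOrder.sqrt_zpow (R := R) (k := 2)).congr fun E hE _ => ?_
  rw [show (2 : ℤ) = ((2 : ℕ) : ℤ) by norm_num, zpow_natCast, Real.sq_sqrt hE.1.le]

/-! ### The Lyapunov function and its derivative -/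

/-- The function `V_N = E + ∑ t ^ (-k / q) v_k` on the plane. -/
noncomputable def lyap (A : S.EnergyAngle) (N : ℕ) (z : ℝ × ℝ) (t : ℝ) : ℝ :=
  S.Hc 0 z + ∑ k ∈ Finset.Icc 1 N, t ^ (-(k : ℝ) / (S.q : ℝ)) * A.pullback (A.v k) z

/-- The derivative of `V_N` along the vector field in terms of energy and angle. -/
noncomputable def lyapDeriv (A : S.EnergyAngle) (N : ℕ) (t E φ : ℝ) : ℝ :=
  A.planeDeriv (fun E _ => E) E φ (S.field t (A.toPlane (E, φ)))
    + ∑ k ∈ Finset.Icc 1 N, (t ^ (-(k : ℝ) / (S.q : ℝ)) *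
        A.planeDeriv (A.v k) E φ (S.field t (A.toPlane (E, φ)))
      - (k : ℝ) / (S.q : ℝ) * t ^ (-(((k + S.q : ℕ) : ℝ)) / (S.q : ℝ)) * A.v k E φ)

/-- Differentiation in time shifts the index by `q`; this is the origin of the term with `v_{k-q}`
in `Z_k`. -/
theorem rpow_neg_div_sub_one {q : ℕ} (hq : 0 < q) (t : ℝ) (k : ℕ) :
    t ^ (-(k : ℝ) / (q : ℝ) - 1) = t ^ (-(((k + q : ℕ) : ℝ)) / (q : ℝ)) := by
  have : (q : ℝ) ≠ 0 := by positivity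
  congr 1
  push_cast
  field_simp
  ring

theorem hasDerivWithinAt_lyap (hE : E ∈ Ioo 0 A.E₀) (φ : ℝ) (N : ℕ) {t : ℝ} (ht : 0 < t)
    {c : ℝ → ℝ × ℝ} {s : Set ℝ} (hct : c t = A.toPlane (E, φ))
    (hc : HasDerivWithinAt c (S.field t (A.toPlane (E, φ))) s t) :
    HasDerivWithinAt (fun τ => A.lyap N (c τ) τ) (A.lyapDeriv N t E φ) s t := by
  have h0 : HasDerivWithinAt (fun τ => S.Hc 0 (c τ))
      (A.planeDeriv (fun E _ => E) E φ (S.field t (A.toPlane (E, φ)))) s t := by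
    have h1 := (S.differentiable_Hc 0 (c t)).hasFDerivAt.comp_hasDerivWithinAt t hc
    refine h1.congr_deriv ?_
    rw [fderiv_apply_eq (S.differentiable_Hc 0 _), hct]
    simp only [toPlane, planeDeriv, partialX_Hc hE, partialY_Hc hE]
    simp
    ring
  refine h0.fun_add (HasDerivWithinAt.fun_sum fun k hk => ?_)
  have hk1 := (Finset.mem_Icc.1 hk).1
  obtain ⟨L, hL, hLe⟩ := hasFDerivAt_pullback (A.smoothOfOrder_v hk1) (A.anglePeriodic_v hk1) hE φ
  rw [← hct] at hL
  have h1 := hL.comp_hasDerivWithinAt t hc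
  have h2 : HasDerivAt (fun τ : ℝ => τ ^ (-(k : ℝ) / (S.q : ℝ))) _ t :=
    Real.hasDerivAt_rpow_const (Or.inl ht.ne')
  refine (h2.hasDerivWithinAt.fun_mul h1).congr_deriv ?_
  have h3 : (A.pullback (A.v k) ∘ c) t = A.v k E φ := by
    rw [Function.comp_apply, hct]
    exact pullback_toPlane (A.anglePeriodic_v hk1) (p := (E, φ)) hE
  rw [h3, rpow_neg_div_sub_one S.q_pos, hLe, planeDeriv]
  ring

theorem hasDerivWithinAt_lyap_zero (N : ℕ) {t : ℝ} (ht : 0 < t)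
    {c : ℝ → ℝ × ℝ} {s : Set ℝ} (hct : c t = 0) {e : ℝ × ℝ} (hc : HasDerivWithinAt c e s t) :
    HasDerivWithinAt (fun τ => A.lyap N (c τ) τ) 0 s t := by
  have h0 : HasDerivWithinAt (fun τ => S.Hc 0 (c τ)) 0 s t := by
    have h1 := (S.differentiable_Hc 0 (c t)).hasFDerivAt.comp_hasDerivWithinAt t hc
    refine h1.congr_deriv ?_
    rw [hct, S.fderiv_Hc_zero]
    simp
  have h4 : HasDerivWithinAt (fun τ => ∑ k ∈ Finset.Icc 1 N,
      τ ^ (-(k : ℝ) / (S.q : ℝ)) * A.pullback (A.v k) (c τ))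
      (∑ k ∈ Finset.Icc 1 N, (0 : ℝ)) s t := by
    refine HasDerivWithinAt.fun_sum fun k hk => ?_
    have hk1 := (Finset.mem_Icc.1 hk).1
    have hL := hasFDerivAt_pullback_zero (A.smoothOfOrder_v hk1) (A.anglePeriodic_v hk1)
    rw [← hct] at hL
    have h1 := hL.comp_hasDerivWithinAt t hc
    have h2 : HasDerivAt (fun τ : ℝ => τ ^ (-(k : ℝ) / (S.q : ℝ))) _ t :=
      Real.hasDerivAt_rpow_const (Or.inl ht.ne')
    refine (h2.hasDerivWithinAt.fun_mul h1).congr_deriv ?_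
    simp [hct, pullback_zero]
  exact (h0.fun_add h4).congr_deriv (by simp)

end EnergyAngle

end AsympHamSystem

/-! ### Rearrangement of double sums -/

/-- Sorting by total index `j + k`: pairs of total at most `n` become the convolutions that occur in
`Z_k`, and the others are of higher order in time. -/
theorem sum_sum_Icc_eq (n : ℕ) (F : ℕ → ℕ → ℝ) :
    ∑ k ∈ Finset.Icc 1 n, ∑ j ∈ Finset.Icc 1 n, F j k
      = ∑ k ∈ Finset.Icc 1 n, ∑ j ∈ Finset.Icc 1 (k - 1), F j (k - j)
        + ∑ k ∈ Finset.Icc 1 n, ∑ j ∈ Finset.Icc 1 n with n < j + k, F j k := by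
  have h1 : ∀ k, ∑ j ∈ Finset.Icc 1 n, F j k = ∑ j ∈ Finset.Icc 1 n with ¬ n < j + k, F j k
      + ∑ j ∈ Finset.Icc 1 n with n < j + k, F j k := fun k => by
    rw [add_comm]; exact (Finset.sum_filter_add_sum_filter_not _ _ _).symm
  rw [Finset.sum_congr rfl fun k _ => h1 k, Finset.sum_add_distrib]
  congr 1
  rw [Finset.sum_sigma', Finset.sum_sigma']
  refine Finset.sum_bij' (fun x _ => ⟨x.1 + x.2, x.2⟩) (fun x _ => ⟨x.1 - x.2, x.2⟩) ?_ ?_ ?_ ?_ ?_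
  · rintro ⟨k, j⟩ h
    simp only [Finset.mem_sigma, Finset.mem_filter, Finset.mem_Icc] at h ⊢
    omega
  · rintro ⟨k, j⟩ h
    simp only [Finset.mem_sigma, Finset.mem_filter, Finset.mem_Icc] at h ⊢
    omega
  · rintro ⟨k, j⟩ h
    simp
  · rintro ⟨k, j⟩ h
    simp only [Finset.mem_sigma, Finset.mem_Icc] at h
    have : k - j + j = k := by omega
    simp [this]
  · rintro ⟨k, j⟩ h
    simp

theorem sum_Icc_shift_eq (n : ℕ) {q : ℕ} (hq : 0 < q) (G : ℕ → ℝ) :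
    ∑ k ∈ Finset.Icc 1 n, G k = ∑ k ∈ Finset.Icc 1 n, (if q < k then G (k - q) else 0)
        + ∑ k ∈ Finset.Icc 1 n with n < k + q, G k := by
  rw [← Finset.sum_filter_add_sum_filter_not _ (fun k => n < k + q), add_comm, ← Finset.sum_filter]
  congr 1
  refine Finset.sum_bij' (fun x _ => x + q) (fun x _ => x - q) ?_ ?_ ?_ ?_ ?_
  · intro k h
    simp only [Finset.mem_filter, Finset.mem_Icc] at h ⊢
    omega
  · intro k h
    simp only [Finset.mem_filter, Finset.mem_Icc] at h ⊢
    omega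
  · intro k h
    simp
  · intro k h
    simp only [Finset.mem_filter, Finset.mem_Icc] at h
    omega
  · intro k h
    simp

theorem rpow_neg_div_mul {q : ℕ} {t : ℝ} (ht : 0 < t) (j k : ℕ) :
    t ^ (-(j : ℝ) / (q : ℝ)) * t ^ (-(k : ℝ) / (q : ℝ))
      = t ^ (-((j + k : ℕ) : ℝ) / (q : ℝ)) := by
  rw [← Real.rpow_add ht]
  congr 1
  push_cast
  ring

theorem rpow_neg_div_le {q : ℕ} {t : ℝ} (ht : 1 ≤ t) {j k : ℕ} (hjk : j ≤ k) :
    t ^ (-(k : ℝ) / (q : ℝ)) ≤ t ^ (-(j : ℝ) / (q : ℝ)) := by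
  refine Real.rpow_le_rpow_of_exponent_le ht ?_
  have : (j : ℝ) ≤ k := Nat.cast_le.2 hjk
  exact div_le_div_of_nonneg_right (by linarith) (Nat.cast_nonneg q)

namespace AsympHamSystem.EnergyAngle

variable {S : AsympHamSystem} {A : S.EnergyAngle} {E : ℝ}

theorem planeDeriv_field (u : ℝ → ℝ → ℝ) (hE : E ∈ Ioo 0 A.E₀) (φ : ℝ) (N : ℕ) (t : ℝ) :
    A.planeDeriv u E φ (S.field t (A.toPlane (E, φ))) = A.ω E * deriv (u E) φ
      + ∑ j ∈ Finset.Icc 1 N, t ^ (-(j : ℝ) / (S.q : ℝ)) *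
          (A.f j E φ * deriv (fun e => u e φ) E + A.g j E φ * deriv (u E) φ)
      + A.planeDeriv u E φ (S.field t (A.toPlane (E, φ)) - S.fieldCoeff 0 (A.toPlane (E, φ))
          - ∑ k ∈ Finset.Icc 1 N,
              t ^ (-(k : ℝ) / (S.q : ℝ)) • S.fieldCoeff k (A.toPlane (E, φ))) := by
  have h : S.field t (A.toPlane (E, φ)) = S.fieldCoeff 0 (A.toPlane (E, φ))
      + ∑ k ∈ Finset.Icc 1 N, t ^ (-(k : ℝ) / (S.q : ℝ)) • S.fieldCoeff k (A.toPlane (E, φ))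
      + (S.field t (A.toPlane (E, φ)) - S.fieldCoeff 0 (A.toPlane (E, φ))
          - ∑ k ∈ Finset.Icc 1 N,
              t ^ (-(k : ℝ) / (S.q : ℝ)) • S.fieldCoeff k (A.toPlane (E, φ))) := by abel
  conv_lhs => rw [h]
  rw [planeDeriv_add, planeDeriv_add, planeDeriv_fieldCoeff_zero u hE, planeDeriv_sum]
  congr 2
  refine Finset.sum_congr rfl fun j hj => ?_
  rw [planeDeriv_smul, planeDeriv_fieldCoeff u hE φ (Finset.mem_Icc.1 hj).1]

/-- The derivative of `V_N` along the vector field, up to terms of higher order in time. -/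
theorem lyapDeriv_eq (hE : E ∈ Ioo 0 A.E₀) (φ : ℝ) (N : ℕ) {t : ℝ} (ht : 0 < t) :
    A.lyapDeriv N t E φ = ∑ k ∈ Finset.Icc 1 N, t ^ (-(k : ℝ) / (S.q : ℝ)) *
        (A.Lam k E + taylorPart A.Lam A.v k E φ)
      + ∑ k ∈ Finset.Icc 1 N, ∑ j ∈ Finset.Icc 1 N with N < j + k,
          t ^ (-((j + k : ℕ) : ℝ) / (S.q : ℝ)) *
            (A.f j E φ * deriv (fun e => A.v k e φ) E + A.g j E φ * deriv (A.v k E) φ)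
      - ∑ k ∈ Finset.Icc 1 N with N < k + S.q,
          (k : ℝ) / (S.q : ℝ) * t ^ (-(((k + S.q : ℕ) : ℝ)) / (S.q : ℝ)) * A.v k E φ
      + (A.planeDeriv (fun E _ => E) E φ
          (S.field t (A.toPlane (E, φ)) - S.fieldCoeff 0 (A.toPlane (E, φ))
          - ∑ k ∈ Finset.Icc 1 N,
              t ^ (-(k : ℝ) / (S.q : ℝ)) • S.fieldCoeff k (A.toPlane (E, φ)))
        + ∑ k ∈ Finset.Icc 1 N, t ^ (-(k : ℝ) / (S.q : ℝ)) * A.planeDeriv (A.v k) E φ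
          (S.field t (A.toPlane (E, φ)) - S.fieldCoeff 0 (A.toPlane (E, φ))
          - ∑ k ∈ Finset.Icc 1 N,
              t ^ (-(k : ℝ) / (S.q : ℝ)) • S.fieldCoeff k (A.toPlane (E, φ)))) := by
  set e := S.field t (A.toPlane (E, φ)) - S.fieldCoeff 0 (A.toPlane (E, φ))
          - ∑ k ∈ Finset.Icc 1 N,
              t ^ (-(k : ℝ) / (S.q : ℝ)) • S.fieldCoeff k (A.toPlane (E, φ)) with he
  set p : ℕ → ℕ → ℝ := fun j k =>
    A.f j E φ * deriv (fun e => A.v k e φ) E + A.g j E φ * deriv (A.v k E) φ with hp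
  have h0 : A.planeDeriv (fun E _ => E) E φ (S.field t (A.toPlane (E, φ)))
      = ∑ j ∈ Finset.Icc 1 N, t ^ (-(j : ℝ) / (S.q : ℝ)) * A.f j E φ
        + A.planeDeriv (fun E _ => E) E φ e := by
    rw [planeDeriv_field _ hE φ N t, ← he]
    simp
  have h1 : ∀ k ∈ Finset.Icc 1 N, t ^ (-(k : ℝ) / (S.q : ℝ)) *
        A.planeDeriv (A.v k) E φ (S.field t (A.toPlane (E, φ)))
      - (k : ℝ) / (S.q : ℝ) * t ^ (-(((k + S.q : ℕ) : ℝ)) / (S.q : ℝ)) * A.v k E φ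
      = t ^ (-(k : ℝ) / (S.q : ℝ)) * (A.Lam k E + taylorPart A.Lam A.v k E φ)
        - t ^ (-(k : ℝ) / (S.q : ℝ)) * A.f k E φ
        - ∑ j ∈ Finset.Icc 1 (k - 1), t ^ (-((j + (k - j) : ℕ) : ℝ) / (S.q : ℝ)) * p j (k - j)
        + (if S.q < k then ((k - S.q : ℕ) : ℝ) / (S.q : ℝ)
            * t ^ (-(((k - S.q + S.q : ℕ) : ℝ)) / (S.q : ℝ)) * A.v (k - S.q) E φ else 0)
        + ∑ j ∈ Finset.Icc 1 N, t ^ (-((j + k : ℕ) : ℝ) / (S.q : ℝ)) * p j k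
        - (k : ℝ) / (S.q : ℝ) * t ^ (-(((k + S.q : ℕ) : ℝ)) / (S.q : ℝ)) * A.v k E φ
        + t ^ (-(k : ℝ) / (S.q : ℝ)) * A.planeDeriv (A.v k) E φ e := fun k hk => by
    have hk1 := (Finset.mem_Icc.1 hk).1
    have h2 : A.ω E * deriv (A.v k E) φ = _ := A.omega_mul_deriv_v hk1 hE φ
    rw [planeDeriv_field _ hE φ N t, ← he, h2]
    have h3 : ∑ j ∈ Finset.Icc 1 (k - 1), t ^ (-((j + (k - j) : ℕ) : ℝ) / (S.q : ℝ)) * p j (k - j)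
        = t ^ (-(k : ℝ) / (S.q : ℝ)) * ∑ j ∈ Finset.Icc 1 (k - 1), p j (k - j) := by
      rw [Finset.mul_sum]
      refine Finset.sum_congr rfl fun j hj => ?_
      have := Finset.mem_Icc.1 hj
      rw [show j + (k - j) = k by omega]
    have h4 : ∑ j ∈ Finset.Icc 1 N, t ^ (-((j + k : ℕ) : ℝ) / (S.q : ℝ)) * p j k
        = t ^ (-(k : ℝ) / (S.q : ℝ)) *
          ∑ j ∈ Finset.Icc 1 N, t ^ (-(j : ℝ) / (S.q : ℝ)) * p j k := by
      rw [Finset.mul_sum]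
      refine Finset.sum_congr rfl fun j _ => ?_
      rw [← rpow_neg_div_mul ht]
      ring
    have h5 : (if S.q < k then ((k - S.q : ℕ) : ℝ) / (S.q : ℝ)
            * t ^ (-(((k - S.q + S.q : ℕ) : ℝ)) / (S.q : ℝ)) * A.v (k - S.q) E φ else 0)
        = t ^ (-(k : ℝ) / (S.q : ℝ)) *
          (if S.q < k then (((k : ℝ) - (S.q : ℝ)) / (S.q : ℝ)) * A.v (k - S.q) E φ else 0) := by
      split_ifs with hqk
      · rw [Nat.sub_add_cancel hqk.le, Nat.cast_sub hqk.le]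
        ring
      · ring
    have h6 : A.zExpr A.Lam A.v k E φ = taylorPart A.Lam A.v k E φ
        - ∑ j ∈ Finset.Icc 1 (k - 1), p j (k - j)
        + (if S.q < k then (((k : ℝ) - (S.q : ℝ)) / (S.q : ℝ)) * A.v (k - S.q) E φ else 0) := rfl
    rw [h3, h4, h5, h6]
    simp only [hp]
    ring
  rw [lyapDeriv, h0, Finset.sum_congr rfl h1]
  simp only [Finset.sum_add_distrib, Finset.sum_sub_distrib]
  -- The low-order parts isolated by `s1` and `s2` cancel the convolution and shift terms of `Z_k`,
  -- and the `f_k` of the homological equation cancel the expansion of the derivative of `E`.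
  have s1 := sum_sum_Icc_eq N fun j k => t ^ (-((j + k : ℕ) : ℝ) / (S.q : ℝ)) * p j k
  have s2 := sum_Icc_shift_eq N S.q_pos fun k =>
    (k : ℝ) / (S.q : ℝ) * t ^ (-(((k + S.q : ℕ) : ℝ)) / (S.q : ℝ)) * A.v k E φ
  rw [s1, s2]
  simp only [hp]
  ring

theorem exists_abs_sum_le {ι : Type*} (s : Finset ι) {B : ι → ℝ → ℝ → ℝ → ℝ} {P : ℝ → ℝ → Prop}
    {G : ℝ → ℝ → ℝ}
    (h : ∀ i ∈ s, ∃ C, 0 ≤ C ∧ ∀ t E φ, P t E → φ ∈ Icc 0 (2 * Real.pi) →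
      |B i t E φ| ≤ C * G t E) :
    ∃ C, 0 ≤ C ∧ ∀ t E φ, P t E → φ ∈ Icc 0 (2 * Real.pi) → |∑ i ∈ s, B i t E φ| ≤ C * G t E := by
  classical
  induction s using Finset.induction_on with
  | empty => exact ⟨0, le_rfl, fun _ _ _ _ _ => by simp⟩
  | insert i s hi ih =>
    obtain ⟨C, hC0, hC⟩ := h i (Finset.mem_insert_self i s)
    obtain ⟨D, hD0, hD⟩ := ih fun j hj => h j (Finset.mem_insert_of_mem hj)
    refine ⟨C + D, by positivity, fun t E φ hP hφ => ?_⟩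
    rw [Finset.sum_insert hi, add_mul]
    exact (abs_add_le _ _).trans (add_le_add (hC t E φ hP hφ) (hD t E φ hP hφ))

theorem abs_rpow_mul_le {q : ℕ} {t x C : ℝ} {N k : ℕ} (ht : 1 ≤ t) (hk : N + 1 ≤ k)
    (hx : |x| ≤ C) :
    |t ^ (-(k : ℝ) / (q : ℝ)) * x| ≤ C * t ^ (-((N + 1 : ℕ) : ℝ) / (q : ℝ)) := by
  have h0 : 0 ≤ t ^ (-(k : ℝ) / (q : ℝ)) := Real.rpow_nonneg (by linarith) _
  rw [abs_mul, abs_of_nonneg h0, mul_comm]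
  exact mul_le_mul hx (rpow_neg_div_le ht hk) h0 ((abs_nonneg x).trans hx)

/-- Each leftover term carries a time power of index at least `N + 1` and a coefficient of order two
in `√E`, or comes from the field remainder through `exists_abs_planeDeriv_le`. The factor `E` keeps
the error comparable to the linear term. -/
theorem exists_abs_lyapDeriv_sub_le (A : S.EnergyAngle) (N : ℕ) :
    ∃ C T : ℝ, 0 ≤ C ∧ 1 ≤ T ∧ ∀ t ≥ T, ∀ E ∈ Ioo 0 A.E₀, ∀ φ ∈ Icc 0 (2 * Real.pi),
      |A.lyapDeriv N t E φ - ∑ k ∈ Finset.Icc 1 N, t ^ (-(k : ℝ) / (S.q : ℝ)) *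
        (A.Lam k E + taylorPart A.Lam A.v k E φ)|
        ≤ C * (t ^ (-((N + 1 : ℕ) : ℝ) / (S.q : ℝ)) * E) := by
  obtain ⟨r, hr⟩ := A.exists_mem_closedBall
  obtain ⟨Cf, Tf, hCf, hTf, hf⟩ := S.exists_norm_field_sub_le N r
  set P : ℝ → ℝ → Prop := fun t E => (1 ≤ t ∧ Tf ≤ t) ∧ E ∈ Ioo 0 A.E₀ with hP
  set G : ℝ → ℝ → ℝ := fun t E => t ^ (-((N + 1 : ℕ) : ℝ) / (S.q : ℝ)) * E with hG
  obtain ⟨C₁, hC₁, h₁⟩ := exists_abs_sum_le (P := P) (G := G) (Finset.Icc 1 N)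
    (B := fun k t E φ => ∑ j ∈ Finset.Icc 1 N with N < j + k,
          t ^ (-((j + k : ℕ) : ℝ) / (S.q : ℝ)) *
            (A.f j E φ * deriv (fun e => A.v k e φ) E + A.g j E φ * deriv (A.v k E) φ))
    fun k hk => exists_abs_sum_le _ fun j hj => by
      rw [Finset.mem_filter, Finset.mem_Icc] at hj
      rw [Finset.mem_Icc] at hk
      have hv := A.smoothOfOrder_v hk.1
      obtain ⟨C, hC0, hC⟩ := exists_abs_le (((A.smoothOfOrder_f hj.1.1).mul hv.energyDeriv).add
        ((A.smoothOfOrder_g hj.1.1).mul hv.angleDeriv))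
      refine ⟨C, hC0, fun t E φ hP hφ => ?_⟩
      refine (abs_rpow_mul_le hP.1.1 hj.2 (hC E hP.2 φ hφ)).trans_eq ?_
      simp only [hG]; ring
  obtain ⟨C₂, hC₂, h₂⟩ := exists_abs_sum_le (P := P) (G := G)
    (Finset.filter (fun k => N < k + S.q) (Finset.Icc 1 N))
    (B := fun k t E φ =>
      (k : ℝ) / (S.q : ℝ) * t ^ (-(((k + S.q : ℕ) : ℝ)) / (S.q : ℝ)) * A.v k E φ)
    fun k hk => by
      rw [Finset.mem_filter, Finset.mem_Icc] at hk
      obtain ⟨C, hC0, hC⟩ := exists_abs_le ((A.smoothOfOrder_v hk.1.1).const_mul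
        ((k : ℝ) / (S.q : ℝ)))
      refine ⟨C, hC0, fun t E φ hP hφ => ?_⟩
      rw [mul_assoc, mul_left_comm]
      refine (abs_rpow_mul_le hP.1.1 hk.2 (hC E hP.2 φ hφ)).trans_eq ?_
      simp only [hG]; ring
  obtain ⟨Cn, hCn0, hCn⟩ := A.exists_norm_le (2 * Real.pi)
  set e : ℝ → ℝ → ℝ → ℝ × ℝ := fun t E φ =>
    S.field t (A.toPlane (E, φ)) - S.fieldCoeff 0 (A.toPlane (E, φ))
          - ∑ k ∈ Finset.Icc 1 N,
              t ^ (-(k : ℝ) / (S.q : ℝ)) • S.fieldCoeff k (A.toPlane (E, φ)) with he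
  have hpl : ∀ u : ℝ → ℝ → ℝ, SmoothOfOrder A.E₀ 2 u → ∃ C, 0 ≤ C ∧ ∀ t E φ, P t E →
      φ ∈ Icc 0 (2 * Real.pi) → |A.planeDeriv u E φ (e t E φ)| ≤ C * G t E := fun u hu => by
    obtain ⟨C, hC0, hC⟩ := exists_abs_planeDeriv_le hu
    refine ⟨C * Cf * Cn, by positivity, fun t E φ hP hφ => ?_⟩
    have ht0 : 0 < t := by linarith [hP.1.1]
    have h1 := hf t hP.1.2 _ (hr E hP.2 φ hφ)
    have h2 := hCn E hP.2 φ ⟨by linarith [hφ.1, Real.two_pi_pos], hφ.2⟩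
    have h3 : -((N : ℝ) + 1) / (S.q : ℝ) = -((N + 1 : ℕ) : ℝ) / (S.q : ℝ) := by push_cast; ring
    rw [h3] at h1
    have h4 : 0 ≤ t ^ (-((N + 1 : ℕ) : ℝ) / (S.q : ℝ)) := Real.rpow_nonneg ht0.le _
    calc _ ≤ C * √E * ‖e t E φ‖ := hC E hP.2 φ hφ _
      _ ≤ C * √E * (Cf * t ^ (-((N + 1 : ℕ) : ℝ) / (S.q : ℝ)) * (Cn * √E)) :=
          mul_le_mul_of_nonneg_left
            (h1.trans (mul_le_mul_of_nonneg_left h2 (by positivity))) (by positivity)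
      _ = C * Cf * Cn * (t ^ (-((N + 1 : ℕ) : ℝ) / (S.q : ℝ)) * (√E * √E)) := by ring
      _ = _ := by rw [Real.mul_self_sqrt hP.2.1.le]
  obtain ⟨C₃, hC₃, h₃⟩ := hpl _ (smoothOfOrder_energy A.E₀)
  obtain ⟨C₄, hC₄, h₄⟩ := exists_abs_sum_le (P := P) (G := G) (Finset.Icc 1 N)
    (B := fun k t E φ => t ^ (-(k : ℝ) / (S.q : ℝ)) * A.planeDeriv (A.v k) E φ (e t E φ))
    fun k hk => by
      obtain ⟨C, hC0, hC⟩ := hpl _ (A.smoothOfOrder_v (Finset.mem_Icc.1 hk).1)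
      refine ⟨C, hC0, fun t E φ hP hφ => ?_⟩
      have h5 : t ^ (-(k : ℝ) / (S.q : ℝ)) ≤ 1 := by
        simpa using rpow_neg_div_le (q := S.q) hP.1.1 (Nat.zero_le k)
      have h6 : 0 ≤ t ^ (-(k : ℝ) / (S.q : ℝ)) := Real.rpow_nonneg (by linarith [hP.1.1]) _
      rw [abs_mul, abs_of_nonneg h6]
      exact (mul_le_of_le_one_left (abs_nonneg _) h5).trans (hC t E φ hP hφ)
  refine ⟨C₁ + C₂ + (C₃ + C₄), max 1 Tf, by positivity, le_max_left _ _, fun t ht E hE φ hφ => ?_⟩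
  have hPt : P t E := ⟨⟨(le_max_left _ _).trans ht, (le_max_right _ _).trans ht⟩, hE⟩
  rw [lyapDeriv_eq hE φ N (by linarith [hPt.1.1])]
  have a1 := abs_le.1 (h₁ t E φ hPt hφ)
  have a2 := abs_le.1 (h₂ t E φ hPt hφ)
  have a3 := abs_le.1 (h₃ t E φ hPt hφ)
  have a4 := abs_le.1 (h₄ t E φ hPt hφ)
  simp only [he, hG] at a1 a2 a3 a4
  rw [abs_le]
  constructor <;> linarith [a1.1, a1.2, a2.1, a2.2, a3.1, a3.2, a4.1, a4.2]

end AsympHamSystem.EnergyAngle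

/-! ### Reduction of the averaged equation to its two leading terms -/

namespace AsympHamSystem.EnergyAngle

variable {S : AsympHamSystem} {A : S.EnergyAngle} {E : ℝ}

theorem sqrt_zpow_two_mul (hE : 0 ≤ E) (s : ℕ) : √E ^ (2 * (s : ℤ)) = E ^ s := by
  rw [show 2 * (s : ℤ) = ((2 * s : ℕ) : ℤ) by push_cast; ring, zpow_natCast, pow_mul,
    Real.sq_sqrt hE]

/-- Raising the order one step at a time turns a bound on values into one that derivatives inherit,
as the Taylor part requires. -/
theorem smoothOfOrder_of_isBigO {L : ℝ → ℝ} {s : ℕ} (hs : 1 ≤ s)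
    (hL : SmoothOfOrder A.E₀ 2 (fun E _ => L E)) (hO : L =O[𝓝[>] 0] fun w : ℝ => w ^ s) :
    SmoothOfOrder A.E₀ (2 * s) (fun E _ => L E) := by
  obtain ⟨C, hC0, hC⟩ := hO.exists_pos
  have key : ∀ i : ℕ, 2 + i ≤ 2 * s → SmoothOfOrder A.E₀ (2 + i) (fun E _ => L E) := fun i => by
    induction i with
    | zero => intro _; simpa using hL
    | succ i ih =>
      intro hi
      have h1 := (ih (by omega)).raise fun φ => ⟨C, ?_⟩
      · convert h1 using 1; push_cast; ring
      filter_upwards [hC.bound, Ioo_mem_nhdsGT one_pos] with E hE hE1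
      have h2 : √E ≤ 1 := Real.sqrt_le_one.2 hE1.2.le
      rw [Real.norm_eq_abs, Real.norm_eq_abs, abs_of_nonneg (pow_nonneg hE1.1.le s)] at hE
      refine hE.trans (mul_le_mul_of_nonneg_left ?_ hC0.le)
      rw [show (2 + (i : ℤ) + 1) = ((2 + i + 1 : ℕ) : ℤ) by push_cast; ring, zpow_natCast,
        ← sqrt_zpow_two_mul hE1.1.le, show (2 * (s : ℤ)) = ((2 * s : ℕ) : ℤ) by push_cast; ring,
        zpow_natCast]
      exact pow_le_pow_of_le_one (Real.sqrt_nonneg E) h2 (by omega)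
  have h := key (2 * s - 2) (by omega)
  convert h using 1
  omega

theorem taylorPart_eq_zero {L : ℕ → ℝ → ℝ} {v : ℕ → ℝ → ℝ → ℝ} {k : ℕ} {R : ℝ}
    (hL : ∀ j, 1 ≤ j → j < k → ∀ w ∈ Ioo 0 R, L j w = 0) (hE : E ∈ Ioo 0 R) (φ : ℝ) :
    taylorPart L v k E φ = 0 := by
  refine Finset.sum_eq_zero fun j hj => Finset.sum_eq_zero fun p hp => ?_
  rw [Finset.mem_Icc] at hj hp
  have h1 : L j =ᶠ[𝓝 E] fun _ => 0 := by
    filter_upwards [isOpen_Ioo.mem_nhds hE] with w hw using hL j hj.1 (by omega) w hw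
  rw [h1.iteratedDeriv_eq p]
  simp

/-- The averaged terms reduce to the two leading ones. -/
theorem exists_averaged_term_le {m n s : ℕ} (hm : 1 ≤ m) (hmn : m < n) (hs : 2 ≤ s) {γ lam : ℝ}
    (hzero : ∀ k, 1 ≤ k → k < m → ∀ w ∈ Ioo 0 A.E₀, A.Lam k w = 0)
    (hLm : (fun w : ℝ => A.Lam m w - γ * w ^ s) =O[𝓝[>] 0] (fun w : ℝ => w ^ (s + 1)))
    (hLj : ∀ j, m ≤ j → j < n → A.Lam j =O[𝓝[>] 0] (fun w : ℝ => w ^ s))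
    (hLn : (fun w : ℝ => A.Lam n w - lam * w) =O[𝓝[>] 0] (fun w : ℝ => w ^ 2))
    {k : ℕ} (hk : k ∈ Finset.Icc 1 n) :
    ∃ C, 0 ≤ C ∧ ∀ᶠ E in 𝓝[>] 0, ∀ t ≥ (1 : ℝ), ∀ φ ∈ Icc 0 (2 * Real.pi),
      |t ^ (-(k : ℝ) / (S.q : ℝ)) * (A.Lam k E + taylorPart A.Lam A.v k E φ)
        - ((if k = m then t ^ (-(m : ℝ) / (S.q : ℝ)) * (γ * E ^ s) else 0)
          + if k = n then t ^ (-(n : ℝ) / (S.q : ℝ)) * (lam * E) else 0)|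
      ≤ C * ((E + t ^ (-((1 : ℕ) : ℝ) / (S.q : ℝ))) *
        (t ^ (-(m : ℝ) / (S.q : ℝ)) * E ^ s + t ^ (-(n : ℝ) / (S.q : ℝ)) * E)) := by
  rw [Finset.mem_Icc] at hk
  have hE₀ := Ioo_mem_nhdsGT A.E₀_pos
  -- Only `Λ_j` with `j < k ≤ n` enter, and these are all `O(E^s)`; the linear `Λ_n` does not occur.
  have hT : ∃ C, 0 ≤ C ∧ ∀ E ∈ Ioo 0 A.E₀, ∀ φ ∈ Icc 0 (2 * Real.pi),
      |taylorPart A.Lam A.v k E φ| ≤ C * E ^ s := by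
    have h1 : SmoothOfOrder A.E₀ (2 * s) (taylorPart A.Lam A.v k) := by
      refine smoothOfOrder_taylorPart (fun j hj hjk => ?_) fun j hj _ => A.smoothOfOrder_v hj
      rcases lt_or_ge j m with hjm | hjm
      · exact SmoothOfOrder.zero.congr fun E hE _ => hzero j hj hjm E hE
      · exact smoothOfOrder_of_isBigO (by omega) (A.smoothOfOrder_Lam hj)
          (hLj j hjm (by omega))
    obtain ⟨C, hC0, hC⟩ := h1.bound (2 * Real.pi)
    refine ⟨C, hC0, fun E hE φ hφ => ?_⟩
    rw [← sqrt_zpow_two_mul hE.1.le]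
    exact hC E hE φ ⟨by linarith [hφ.1, Real.two_pi_pos], hφ.2⟩
  obtain ⟨CT, hCT0, hCT⟩ := hT
  have hpos : ∀ (t : ℝ) (j : ℕ), 1 ≤ t → 0 < t ^ (-(j : ℝ) / (S.q : ℝ)) := fun t j ht =>
    Real.rpow_pos_of_pos (by linarith) _
  rcases lt_trichotomy k m with hkm | rfl | hkm
  · refine ⟨0, le_rfl, ?_⟩
    filter_upwards [hE₀] with E hE t ht φ hφ
    rw [hzero k hk.1 hkm E hE, taylorPart_eq_zero (fun j hj hjk => hzero j hj (by omega)) hE,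
      if_neg (by omega), if_neg (by omega)]
    simp
  · obtain ⟨C, hC0, hC⟩ := hLm.exists_pos
    refine ⟨C, hC0.le, ?_⟩
    filter_upwards [hE₀, hC.bound] with E hE hb t ht φ hφ
    rw [taylorPart_eq_zero (fun j hj hjk => hzero j hj (by omega)) hE,
      if_pos rfl, if_neg (by omega), add_zero, add_zero, ← mul_sub, abs_mul,
      abs_of_pos (hpos t k ht)]
    rw [Real.norm_eq_abs, Real.norm_eq_abs, abs_of_nonneg (pow_nonneg hE.1.le _)] at hb
    have h1 := hpos t k ht
    have h2 := hpos t n ht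
    have h3 := hpos t 1 ht
    have h4 := hE.1
    have h5 : 0 < E ^ s := pow_pos h4 s
    calc _ ≤ t ^ (-(k : ℝ) / (S.q : ℝ)) * (C * E ^ (s + 1)) := mul_le_mul_of_nonneg_left hb h1.le
      _ = C * (E * (t ^ (-(k : ℝ) / (S.q : ℝ)) * E ^ s)) := by ring
      _ ≤ _ := by
        refine mul_le_mul_of_nonneg_left ?_ hC0.le
        exact mul_le_mul (by linarith) (by nlinarith) (by positivity) (by positivity)
  -- For `k > m` the small factor `t^{-1/q}` is gained relative to `t^{-m/q}`.
  · have hstep : ∀ t ≥ (1 : ℝ), t ^ (-(k : ℝ) / (S.q : ℝ)) ≤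
        t ^ (-((1 : ℕ) : ℝ) / (S.q : ℝ)) * t ^ (-(m : ℝ) / (S.q : ℝ)) := fun t ht => by
      rw [rpow_neg_div_mul (by linarith)]
      exact rpow_neg_div_le ht (by omega)
    rcases hk.2.lt_or_eq with hkn | rfl
    · obtain ⟨C, hC0, hC⟩ := (hLj k hkm.le hkn).exists_pos
      refine ⟨C + CT, by positivity, ?_⟩
      filter_upwards [hE₀, hC.bound] with E hE hb t ht φ hφ
      rw [if_neg (by omega), if_neg (by omega), add_zero, sub_zero, abs_mul,
        abs_of_pos (hpos t k ht)]
      rw [Real.norm_eq_abs, Real.norm_eq_abs, abs_of_nonneg (pow_nonneg hE.1.le _)] at hb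
      have h1 := hpos t m ht
      have h2 := hpos t n ht
      have h3 := hpos t 1 ht
      have h4 := hE.1
      have h5 : 0 < E ^ s := pow_pos h4 s
      have h6 : |A.Lam k E + taylorPart A.Lam A.v k E φ| ≤ (C + CT) * E ^ s := by
        rw [add_mul]; exact (abs_add_le _ _).trans (add_le_add hb (hCT E hE φ hφ))
      calc _ ≤ (t ^ (-((1 : ℕ) : ℝ) / (S.q : ℝ)) * t ^ (-(m : ℝ) / (S.q : ℝ))) *
            ((C + CT) * E ^ s) := mul_le_mul (hstep t ht) h6 (abs_nonneg _) (by positivity)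
        _ = (C + CT) * (t ^ (-((1 : ℕ) : ℝ) / (S.q : ℝ)) *
            (t ^ (-(m : ℝ) / (S.q : ℝ)) * E ^ s)) := by ring
        _ ≤ _ := by
          refine mul_le_mul_of_nonneg_left ?_ (by positivity)
          exact mul_le_mul (by linarith) (by nlinarith) (by positivity) (by positivity)
    · obtain ⟨C, hC0, hC⟩ := hLn.exists_pos
      refine ⟨C + CT, by positivity, ?_⟩
      filter_upwards [hE₀, hC.bound] with E hE hb t ht φ hφ
      rw [if_neg (by omega), if_pos rfl, zero_add]
      rw [Real.norm_eq_abs, Real.norm_eq_abs, abs_of_nonneg (pow_nonneg hE.1.le _)] at hb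
      have h1 := hpos t m ht
      have h2 := hpos t k ht
      have h3 := hpos t 1 ht
      have h4 := hE.1
      have h5 : 0 < E ^ s := pow_pos h4 s
      have e1 : t ^ (-(k : ℝ) / (S.q : ℝ)) * (A.Lam k E + taylorPart A.Lam A.v k E φ)
          - t ^ (-(k : ℝ) / (S.q : ℝ)) * (lam * E)
          = t ^ (-(k : ℝ) / (S.q : ℝ)) * (A.Lam k E - lam * E)
            + t ^ (-(k : ℝ) / (S.q : ℝ)) * taylorPart A.Lam A.v k E φ := by ring
      rw [e1]
      refine (abs_add_le _ _).trans ?_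
      rw [abs_mul, abs_mul, abs_of_pos h2, add_mul]
      refine add_le_add ?_ ?_
      · calc _ ≤ t ^ (-(k : ℝ) / (S.q : ℝ)) * (C * E ^ 2) := mul_le_mul_of_nonneg_left hb h2.le
          _ = C * (E * (t ^ (-(k : ℝ) / (S.q : ℝ)) * E)) := by ring
          _ ≤ _ := by
            refine mul_le_mul_of_nonneg_left ?_ hC0.le
            exact mul_le_mul (by linarith) (by nlinarith) (by positivity) (by positivity)
      · calc _ ≤ (t ^ (-((1 : ℕ) : ℝ) / (S.q : ℝ)) * t ^ (-(m : ℝ) / (S.q : ℝ))) * (CT * E ^ s) :=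
              mul_le_mul (hstep t ht) (hCT E hE φ hφ) (abs_nonneg _) (by positivity)
          _ = CT * (t ^ (-((1 : ℕ) : ℝ) / (S.q : ℝ)) * (t ^ (-(m : ℝ) / (S.q : ℝ)) * E ^ s)) := by
              ring
          _ ≤ _ := by
            refine mul_le_mul_of_nonneg_left ?_ hCT0
            exact mul_le_mul (by linarith) (by nlinarith) (by positivity) (by positivity)

/-- All errors are bounded by the main terms times a multiple of `E + t^{-1/q}`, which is
arbitrarily small for small energy and large time. -/
theorem exists_lyapDeriv_estimate {m n s : ℕ} (hm : 1 ≤ m) (hmn : m < n) (hs : 2 ≤ s) {γ lam : ℝ}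
    (hzero : ∀ k, 1 ≤ k → k < m → ∀ w ∈ Ioo 0 A.E₀, A.Lam k w = 0)
    (hLm : (fun w : ℝ => A.Lam m w - γ * w ^ s) =O[𝓝[>] 0] (fun w : ℝ => w ^ (s + 1)))
    (hLj : ∀ j, m ≤ j → j < n → A.Lam j =O[𝓝[>] 0] (fun w : ℝ => w ^ s))
    (hLn : (fun w : ℝ => A.Lam n w - lam * w) =O[𝓝[>] 0] (fun w : ℝ => w ^ 2))
    {η : ℝ} (hη : 0 < η) :
    ∃ T ≥ (1 : ℝ), ∀ᶠ E in 𝓝[>] 0, ∀ t ≥ T, ∀ φ ∈ Icc 0 (2 * Real.pi),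
      |A.lyapDeriv n t E φ - (γ * (t ^ (-(m : ℝ) / (S.q : ℝ)) * E ^ s)
          + lam * (t ^ (-(n : ℝ) / (S.q : ℝ)) * E))|
        ≤ η * (t ^ (-(m : ℝ) / (S.q : ℝ)) * E ^ s + t ^ (-(n : ℝ) / (S.q : ℝ)) * E) := by
  have hterm := fun k (hk : k ∈ Finset.Icc 1 n) =>
    exists_averaged_term_le hm hmn hs hzero hLm hLj hLn hk
  choose! C hC0 hC using hterm
  obtain ⟨D, T, hD0, hT1, hD⟩ := A.exists_abs_lyapDeriv_sub_le n
  set M := ∑ k ∈ Finset.Icc 1 n, C k + D with hM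
  have hM0 : 0 ≤ M := add_nonneg (Finset.sum_nonneg hC0) hD0
  have hq : (0 : ℝ) < S.q := Nat.cast_pos.2 S.q_pos
  have htend : Tendsto (fun t : ℝ => t ^ (-((1 : ℕ) : ℝ) / (S.q : ℝ))) atTop (𝓝 0) := by
    have := tendsto_rpow_neg_atTop (y := 1 / (S.q : ℝ)) (by positivity)
    simpa [neg_div] using this
  obtain ⟨T', hT'⟩ := eventually_atTop.1
    (htend.eventually (gt_mem_nhds (show (0 : ℝ) < η / (2 * (M + 1)) by positivity)))
  refine ⟨max T T', le_max_of_le_left hT1, ?_⟩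
  filter_upwards [(Finset.eventually_all (Finset.Icc 1 n)).2 hC, Ioo_mem_nhdsGT A.E₀_pos,
    Ioo_mem_nhdsGT (show (0 : ℝ) < η / (2 * (M + 1)) by positivity)] with E hCE hE hEη t ht φ hφ
  have ht1 : 1 ≤ t := hT1.trans ((le_max_left _ _).trans ht)
  have h1 := hD t ((le_max_left _ _).trans ht) E hE φ hφ
  have h2 := hT' t ((le_max_right _ _).trans ht)
  have hp := fun j : ℕ => Real.rpow_pos_of_pos (by linarith : 0 < t) (-(j : ℝ) / (S.q : ℝ))
  set B := t ^ (-(m : ℝ) / (S.q : ℝ)) * E ^ s + t ^ (-(n : ℝ) / (S.q : ℝ)) * E with hB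
  have hpm := hp m
  have hpn := hp n
  have hp1 := hp 1
  have hE0 := hE.1
  have hB0 : 0 < B := by positivity
  have h3 : |∑ k ∈ Finset.Icc 1 n, (t ^ (-(k : ℝ) / (S.q : ℝ)) *
        (A.Lam k E + taylorPart A.Lam A.v k E φ)
        - ((if k = m then t ^ (-(m : ℝ) / (S.q : ℝ)) * (γ * E ^ s) else 0)
          + if k = n then t ^ (-(n : ℝ) / (S.q : ℝ)) * (lam * E) else 0))|
      ≤ (∑ k ∈ Finset.Icc 1 n, C k) * ((E + t ^ (-((1 : ℕ) : ℝ) / (S.q : ℝ))) * B) := by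
    rw [Finset.sum_mul]
    exact (Finset.abs_sum_le_sum_abs _ _).trans
      (Finset.sum_le_sum fun k hk => hCE k hk t ht1 φ hφ)
  rw [Finset.sum_sub_distrib, Finset.sum_add_distrib, Finset.sum_ite_eq', Finset.sum_ite_eq',
    if_pos (Finset.mem_Icc.2 ⟨hm, hmn.le⟩), if_pos (Finset.mem_Icc.2 ⟨by omega, le_rfl⟩)] at h3
  have h4 : D * (t ^ (-((n + 1 : ℕ) : ℝ) / (S.q : ℝ)) * E)
      ≤ D * ((E + t ^ (-((1 : ℕ) : ℝ) / (S.q : ℝ))) * B) := by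
    refine mul_le_mul_of_nonneg_left ?_ hD0
    rw [add_comm n 1, ← rpow_neg_div_mul (by linarith : 0 < t), mul_assoc]
    refine mul_le_mul (by linarith) ?_ (by positivity) (by positivity)
    rw [hB]
    have : 0 < t ^ (-(m : ℝ) / (S.q : ℝ)) * E ^ s := by positivity
    linarith
  have h5 : M * ((E + t ^ (-((1 : ℕ) : ℝ) / (S.q : ℝ))) * B) ≤ η * B := by
    rw [← mul_assoc]
    refine mul_le_mul_of_nonneg_right ?_ hB0.le
    have h6 : E + t ^ (-((1 : ℕ) : ℝ) / (S.q : ℝ)) ≤ η / (M + 1) := by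
      have : η / (2 * (M + 1)) + η / (2 * (M + 1)) = η / (M + 1) := by field_simp; norm_num
      linarith [hEη.2]
    calc _ ≤ M * (η / (M + 1)) := mul_le_mul_of_nonneg_left h6 hM0
      _ ≤ (M + 1) * (η / (M + 1)) := mul_le_mul_of_nonneg_right (by linarith) (by positivity)
      _ = η := by field_simp
  rw [hM, add_mul] at h5
  have a1 := abs_le.1 h1
  have a3 := abs_le.1 h3
  rw [abs_le]
  constructor <;> linarith [a1.1, a1.2, a3.1, a3.2]

/-- The derivative of `V_n` along the system near the equilibrium and for large times. -/
theorem exists_lyap_estimate (A : S.EnergyAngle) {m n s : ℕ} (hm : 1 ≤ m) (hmn : m < n)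
    (hs : 2 ≤ s) {γ lam : ℝ}
    (hzero : ∀ k, 1 ≤ k → k < m → ∀ w ∈ Ioo 0 A.E₀, A.Lam k w = 0)
    (hLm : (fun w : ℝ => A.Lam m w - γ * w ^ s) =O[𝓝[>] 0] (fun w : ℝ => w ^ (s + 1)))
    (hLj : ∀ j, m ≤ j → j < n → A.Lam j =O[𝓝[>] 0] (fun w : ℝ => w ^ s))
    (hLn : (fun w : ℝ => A.Lam n w - lam * w) =O[𝓝[>] 0] (fun w : ℝ => w ^ 2))
    {η : ℝ} (hη : 0 < η) :
    ∃ r > (0 : ℝ), ∃ T ≥ (1 : ℝ), ∀ t ≥ T, ∀ z : ℝ × ℝ, planeNorm z < r →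
      planeNorm z ^ 2 / 4 ≤ S.Hc 0 z ∧ S.Hc 0 z ≤ planeNorm z ^ 2 ∧
      |A.lyap n z t - S.Hc 0 z| ≤ η * S.Hc 0 z ∧
      ∃ D, (∀ (c : ℝ → ℝ × ℝ) (u : Set ℝ), c t = z → HasDerivWithinAt c (S.field t z) u t →
          HasDerivWithinAt (fun τ => A.lyap n (c τ) τ) D u t) ∧
        |D - (γ * (t ^ (-(m : ℝ) / (S.q : ℝ)) * S.Hc 0 z ^ s)
          + lam * (t ^ (-(n : ℝ) / (S.q : ℝ)) * S.Hc 0 z))|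
        ≤ η * (t ^ (-(m : ℝ) / (S.q : ℝ)) * S.Hc 0 z ^ s
          + t ^ (-(n : ℝ) / (S.q : ℝ)) * S.Hc 0 z) := by
  obtain ⟨T, hT1, hT⟩ := exists_lyapDeriv_estimate (A := A) hm hmn hs hzero hLm hLj hLn hη
  obtain ⟨δ, hδ0, hδ⟩ := mem_nhdsGT_iff_exists_Ioo_subset.1 hT
  obtain ⟨r₁, hr₁, h₁⟩ := A.exists_toPlane_eq
  obtain ⟨r₂, hr₂, h₂⟩ := S.exists_energy_bounds
  have hq : (0 : ℝ) < S.q := Nat.cast_pos.2 S.q_pos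
  choose! C hC0 hC using fun k (hk : k ∈ Finset.Icc 1 n) => abs_pullback_le (A := A)
    (A.smoothOfOrder_v (Finset.mem_Icc.1 hk).1) (A.anglePeriodic_v (Finset.mem_Icc.1 hk).1)
  set M := ∑ k ∈ Finset.Icc 1 n, C k with hM
  have hM0 : 0 ≤ M := Finset.sum_nonneg hC0
  have htend : Tendsto (fun t : ℝ => M * t ^ (-((1 : ℕ) : ℝ) / (S.q : ℝ))) atTop (𝓝 0) := by
    have := (tendsto_rpow_neg_atTop (y := 1 / (S.q : ℝ)) (by positivity)).const_mul M
    simpa [neg_div] using this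
  obtain ⟨T', hT'⟩ := eventually_atTop.1 (htend.eventually (gt_mem_nhds hη))
  have hδ0' : 0 < δ := hδ0
  refine ⟨min (min r₁ r₂) (√δ), by positivity, max T T', le_max_of_le_left hT1,
    fun t ht z hz => ?_⟩
  have hz0 := planeNorm_nonneg z
  have hzn := norm_le_planeNorm z
  have hz1 : ‖z‖ < r₁ := hzn.trans_lt (hz.trans_le ((min_le_left _ _).trans (min_le_left _ _)))
  have hz2 : ‖z‖ < r₂ := hzn.trans_lt (hz.trans_le ((min_le_left _ _).trans (min_le_right _ _)))
  have hz3 : planeNorm z ^ 2 < δ := (Real.lt_sqrt hz0).1 (hz.trans_le (min_le_right _ _))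
  have ht0 : 0 < t := by linarith [(le_max_left T T').trans ht]
  refine ⟨(h₂ z hz2).1, (h₂ z hz2).2, ?_⟩
  -- At the origin there is no angle; there `V` and its derivative along the flow are both zero.
  rcases eq_or_ne z 0 with rfl | hzne
  · refine ⟨by simp [lyap, pullback_zero, S.Hc_zero_zero], 0,
      fun c u hct hc => hasDerivWithinAt_lyap_zero n ht0 hct hc, ?_⟩
    rw [S.Hc_zero_zero, zero_pow (by omega)]
    simp
  · obtain ⟨E, hE, φ, hφ, rfl⟩ := h₁ z hzne hz1
    have hHE : S.Hc 0 (A.toPlane (E, φ)) = E := Hc_toPlane (p := (E, φ)) hE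
    rw [hHE]
    have hEδ : E ∈ Ioo 0 δ := ⟨hE.1, by
      have := (h₂ _ hz2).2
      rw [hHE] at this
      linarith⟩
    refine ⟨?_, A.lyapDeriv n t E φ, fun c u hct hc => hasDerivWithinAt_lyap hE φ n ht0 hct hc,
      hδ hEδ t ((le_max_left _ _).trans ht) φ hφ⟩
    have h3 := hT' t ((le_max_right _ _).trans ht)
    rw [lyap, hHE, add_sub_cancel_left]
    calc _ ≤ ∑ k ∈ Finset.Icc 1 n, t ^ (-((1 : ℕ) : ℝ) / (S.q : ℝ)) * (C k * E) := by
          refine (Finset.abs_sum_le_sum_abs _ _).trans (Finset.sum_le_sum fun k hk => ?_)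
          have h4 : 0 ≤ t ^ (-(k : ℝ) / (S.q : ℝ)) := Real.rpow_nonneg ht0.le _
          rw [abs_mul, abs_of_nonneg h4]
          exact mul_le_mul (rpow_neg_div_le (by linarith [(le_max_left T T').trans ht])
            (Finset.mem_Icc.1 hk).1) (hC k hk E hE φ) (abs_nonneg _) (Real.rpow_nonneg ht0.le _)
      _ = M * t ^ (-((1 : ℕ) : ℝ) / (S.q : ℝ)) * E := by
          rw [← Finset.mul_sum, ← Finset.sum_mul]; ring
      _ ≤ η * E := mul_le_mul_of_nonneg_right h3.le hE.1.le

end AsympHamSystem.EnergyAngle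

/-! ### Solutions on a half-line -/

/-- Global existence for a vector field that is bounded and Lipschitz, locally uniformly in time. -/
theorem exists_hasDerivWithinAt_Ici {V : Type*} [NormedAddCommGroup V] [NormedSpace ℝ V]
    [CompleteSpace V] {f : ℝ → V → V} {t₀ : ℝ}
    (hf : ∀ T, ∃ K L : NNReal, ∀ t ∈ Icc t₀ T, LipschitzWith K (f t) ∧ ∀ x, ‖f t x‖ ≤ L)
    (hc : ∀ x, ContinuousOn (fun t => f t x) (Ici t₀)) (x₀ : V) :
    ∃ z : ℝ → V, z t₀ = x₀ ∧ ∀ t ∈ Ici t₀, HasDerivWithinAt z (f t (z t)) (Ici t₀) t := by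
  have hloc : ∀ N : ℕ, ∃ z : ℝ → V, z t₀ = x₀ ∧
      ∀ t ∈ Icc t₀ (t₀ + N), HasDerivWithinAt z (f t (z t)) (Icc t₀ (t₀ + N)) t := fun N => by
    obtain ⟨K, L, h⟩ := hf (t₀ + N)
    have h0 : t₀ ∈ Icc t₀ (t₀ + N) := ⟨le_rfl, by simp⟩
    refine IsPicardLindelof.exists_eq_forall_mem_Icc_hasDerivWithinAt₀ (t₀ := ⟨t₀, h0⟩)
      (a := L * N) (L := L) (K := K) ⟨fun t ht => (h t ht).1.lipschitzOnWith, fun x _ =>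
      (hc x).mono Icc_subset_Ici_self, fun t ht x _ => (h t ht).2 x, ?_⟩
    simp
  choose y hy0 hy using hloc
  have hright : ∀ (N : ℕ) (t : ℝ), t ∈ Ico t₀ (t₀ + N) →
      HasDerivWithinAt (y N) (f t (y N t)) (Ici t) t := fun N t ht =>
    (hy N t (Ico_subset_Icc_self ht)).mono_of_mem_nhdsWithin
      (mem_of_superset (Icc_mem_nhdsGE ht.2) (Icc_subset_Icc_left ht.1))
  have huniq : ∀ N M : ℕ, N ≤ M → EqOn (y N) (y M) (Icc t₀ (t₀ + N)) := fun N M hNM => by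
    obtain ⟨K, L, h⟩ := hf (t₀ + N)
    have hNM' : (N : ℝ) ≤ M := Nat.cast_le.2 hNM
    have hsub : Icc t₀ (t₀ + N) ⊆ Icc t₀ (t₀ + M) := Icc_subset_Icc_right (by linarith)
    exact ODE_solution_unique_of_mem_Icc_right (v := f) (s := fun _ => univ) (K := K)
      (fun t ht => (h t (Ico_subset_Icc_self ht)).1.lipschitzOnWith)
      (fun t ht => (hy N t ht).continuousWithinAt) (hright N) (fun _ _ => mem_univ _)
      (fun t ht => ((hy M t (hsub ht)).mono hsub).continuousWithinAt)
      (fun t ht => hright M t ⟨ht.1, by linarith [ht.2]⟩) (fun _ _ => mem_univ _)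
      (by rw [hy0, hy0])
  have hceil : ∀ t ∈ Ici t₀, t ∈ Icc t₀ (t₀ + (⌈t - t₀⌉₊ : ℕ)) := fun t ht =>
    ⟨ht, by linarith [Nat.le_ceil (t - t₀)]⟩
  have heq : ∀ (N : ℕ) (t : ℝ), t ∈ Icc t₀ (t₀ + N) → y ⌈t - t₀⌉₊ t = y N t := fun N t ht =>
    huniq _ N (Nat.ceil_le.2 (by linarith [ht.2])) (hceil t ht.1)
  refine ⟨fun t => y ⌈t - t₀⌉₊ t, hy0 _, fun t ht => ?_⟩
  -- The extra unit makes `t` lie strictly before the right endpoint, so the derivative within `Icc`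
  -- is one within `Ici`.
  set N := ⌈t - t₀⌉₊ + 1 with hN
  have htN : t < t₀ + N := by
    rw [hN]; push_cast; linarith [Nat.le_ceil (t - t₀)]
  have h1 := (hy N t ⟨ht, htN.le⟩).congr_of_mem (fun u hu => heq N u hu) ⟨ht, htN.le⟩
  rw [← heq N t ⟨ht, htN.le⟩] at h1
  refine h1.mono_of_mem_nhdsWithin ?_
  rw [← Ici_inter_Iic]
  exact inter_mem self_mem_nhdsWithin (mem_nhdsWithin_of_mem_nhds (Iic_mem_nhds htN))

/-- A continuous function that cannot reach the level `ε` stays below it. -/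
theorem lt_of_forall_le_imp_lt {g : ℝ → ℝ} {t₀ ε : ℝ} (hg : ContinuousOn g (Ici t₀))
    (h0 : g t₀ < ε) (h : ∀ t₁ ≥ t₀, (∀ t ∈ Icc t₀ t₁, g t ≤ ε) → g t₁ < ε) :
    ∀ t ≥ t₀, g t < ε := by
  intro t ht
  by_contra! hε
  -- At the first time the level is reached, `g ≤ ε` holds on the whole past, so the hypothesis
  -- forces `g < ε` there.
  set A := {u ∈ Icc t₀ t | ε ≤ g u} with hA
  have hAc : IsClosed A := (hg.mono Icc_subset_Ici_self).preimage_isClosed_of_isClosed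
    isClosed_Icc isClosed_Ici
  have hAb : BddBelow A := ⟨t₀, fun u hu => hu.1.1⟩
  have hAm := hAc.csInf_mem ⟨t, ⟨ht, le_rfl⟩, hε⟩ hAb
  set a := sInf A
  have hBc : IsClosed {u ∈ Icc t₀ a | g u ≤ ε} := (hg.mono Icc_subset_Ici_self).preimage_isClosed_of_isClosed
    isClosed_Icc isClosed_Iic
  have hB : Ico t₀ a ⊆ {u ∈ Icc t₀ a | g u ≤ ε} := fun u hu => by
    refine ⟨Ico_subset_Icc_self hu, ?_⟩
    by_contra! hu'
    exact absurd (csInf_le hAb ⟨⟨hu.1, hu.2.le.trans hAm.1.2⟩, hu'.le⟩) (not_le.2 hu.2)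
  have hne : t₀ ≠ a := fun e => absurd hAm.2 (not_le.2 (e ▸ h0))
  have h1 := hBc.closure_subset_iff.2 hB
  rw [closure_Ico hne] at h1
  exact absurd (h a hAm.1.1 fun u hu => (h1 hu).2) (not_lt.2 hAm.2)

/-! ### Existence, a priori bounds and continuation for the system -/

namespace AsympHamSystem

variable (S : AsympHamSystem)

theorem contDiffOn_field : ContDiffOn ℝ (⊤ : ℕ∞) (fun p : (ℝ × ℝ) × ℝ => S.field p.2 p.1)
    {p | 0 < p.2} := by
  have ho : IsOpen {p : (ℝ × ℝ) × ℝ | 0 < p.2} := isOpen_lt continuous_const continuous_snd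
  have hd : ∀ e : ℝ × ℝ, ContDiffOn ℝ (⊤ : ℕ∞)
      (fun p => fderiv ℝ (fun p : (ℝ × ℝ) × ℝ => S.H p.1 p.2) p (e, 0)) {p | 0 < p.2} := fun e =>
    (S.smooth_H.fderiv_of_isOpen ho (m := (⊤ : ℕ∞)) (by simp)).clm_apply contDiffOn_const
  have he : ∀ p : (ℝ × ℝ) × ℝ, 0 < p.2 → ∀ e : ℝ × ℝ, fderiv ℝ (fun z => S.H z p.2) p.1 e
      = fderiv ℝ (fun p : (ℝ × ℝ) × ℝ => S.H p.1 p.2) p (e, 0) := fun p hp e => by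
    have h1 := ((S.smooth_H.differentiableOn (by simp) p hp).differentiableAt
      (ho.mem_nhds hp)).hasFDerivAt
    have h2 : HasFDerivAt (fun z : ℝ × ℝ => (z, p.2))
        (ContinuousLinearMap.inl ℝ (ℝ × ℝ) ℝ) p.1 := hasFDerivAt_prodMk_left p.1 p.2
    have h3 := HasFDerivAt.comp p.1 (f := fun z : ℝ × ℝ => (z, p.2)) h1 h2
    have h4 : HasFDerivAt (fun z => S.H z p.2) _ p.1 := h3
    rw [h4.fderiv]
    simp
  refine (((hd (0, 1)).prodMk ((hd (1, 0)).neg.add S.smooth_F))).congr fun p hp => ?_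
  have hdiff := (S.contDiff_H hp).differentiable (by simp) p.1
  rw [field, partialX_eq hdiff, partialY_eq hdiff, he p hp, he p hp]

theorem field_zero {t : ℝ} (ht : 0 < t) : S.field t 0 = 0 := by
  have h1 := S.partialX_zero t ht
  have h2 := S.partialY_zero t ht
  have h3 := S.F_zero t ht
  rw [Prod.mk_zero_zero] at h1 h2 h3
  simp [field, h1, h2, h3]

theorem exists_lipschitz_field {t₀ : ℝ} (ht₀ : 0 < t₀) (T R : ℝ) : ∃ L : NNReal,
    ∀ t ∈ Icc t₀ T, LipschitzOnWith L (S.field t) (Metric.closedBall 0 R) := by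
  have ho : IsOpen {p : (ℝ × ℝ) × ℝ | 0 < p.2} := isOpen_lt continuous_const continuous_snd
  have hK : Metric.closedBall (0 : ℝ × ℝ) R ×ˢ Icc t₀ T ⊆ {p | 0 < p.2} :=
    fun p hp => ht₀.trans_le hp.2.1
  obtain ⟨C, hC⟩ := ((isCompact_closedBall (0 : ℝ × ℝ) R).prod
    (isCompact_Icc (a := t₀) (b := T))).exists_bound_of_continuousOn
    ((S.contDiffOn_field.continuousOn_fderiv_of_isOpen ho (by simp)).mono hK)
  refine ⟨C.toNNReal, fun t ht => LipschitzOnWith.of_dist_le_mul fun z hz w hw => ?_⟩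
  have h1 := ((convex_closedBall (0 : ℝ × ℝ) R).prod
    (convex_Icc t₀ T)).norm_image_sub_le_of_norm_fderiv_le
    (f := fun p : (ℝ × ℝ) × ℝ => S.field p.2 p.1) (C := C)
    (fun p hp => (S.contDiffOn_field.differentiableOn (by simp) p (hK hp)).differentiableAt
      (ho.mem_nhds (hK hp))) hC (x := (w, t)) (y := (z, t)) ⟨hw, ht⟩ ⟨hz, ht⟩
  have h2 : ‖((z, t) : (ℝ × ℝ) × ℝ) - (w, t)‖ = ‖z - w‖ := by
    rw [Prod.mk_sub_mk, sub_self, Prod.norm_mk, norm_zero, max_eq_left (norm_nonneg _)]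
  rw [h2] at h1
  rw [dist_eq_norm, dist_eq_norm]
  exact h1.trans (mul_le_mul_of_nonneg_right (Real.le_coe_toNNReal C) (norm_nonneg _))

/-- Projection of the plane onto a square. -/
def clamp (R : ℝ) (z : ℝ × ℝ) : ℝ × ℝ := (max (min R z.1) (-R), max (min R z.2) (-R))

theorem lipschitzWith_clamp (R : ℝ) : LipschitzWith 1 (clamp R) := by
  have h := ((LipschitzWith.prod_fst (α := ℝ) (β := ℝ)).const_min R).max_const (-R)
  have h' := ((LipschitzWith.prod_snd (α := ℝ) (β := ℝ)).const_min R).max_const (-R)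
  have h2 := h.prodMk h'
  rwa [max_self] at h2

theorem clamp_mem {R : ℝ} (hR : 0 ≤ R) (z : ℝ × ℝ) :
    clamp R z ∈ Metric.closedBall (0 : ℝ × ℝ) R := by
  rw [mem_closedBall_zero_iff, clamp, Prod.norm_mk, Real.norm_eq_abs, Real.norm_eq_abs]
  exact max_le (abs_le.2 ⟨le_max_right _ _, max_le (min_le_left _ _) (by linarith)⟩)
    (abs_le.2 ⟨le_max_right _ _, max_le (min_le_left _ _) (by linarith)⟩)

theorem clamp_eq {R : ℝ} {z : ℝ × ℝ} (hz : ‖z‖ ≤ R) : clamp R z = z := by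
  have h1 := abs_le.1 ((norm_fst_le z).trans hz)
  have h2 := abs_le.1 ((norm_snd_le z).trans hz)
  rw [clamp, min_eq_right h1.2, min_eq_right h2.2, max_eq_left h1.1, max_eq_left h2.1]

/-- Clamping the argument makes the field bounded and globally Lipschitz on compact time intervals,
so solutions never escape. They solve the original system as long as they stay in the square. -/
theorem exists_solution_clamp {t₀ : ℝ} (ht₀ : 0 < t₀) {R : ℝ} (hR : 0 ≤ R) (z₀ : ℝ × ℝ) :
    ∃ z : ℝ → ℝ × ℝ, z t₀ = z₀ ∧
      ∀ t ∈ Ici t₀, HasDerivWithinAt z (S.field t (clamp R (z t))) (Ici t₀) t := by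
  refine exists_hasDerivWithinAt_Ici (f := fun t z => S.field t (clamp R z)) (fun T => ?_)
    (fun x => ?_) z₀
  · obtain ⟨L, hL⟩ := S.exists_lipschitz_field ht₀ T R
    refine ⟨L, L * R.toNNReal, fun t ht => ⟨?_, fun x => ?_⟩⟩
    · have h := (hL t ht).comp (lipschitzWith_clamp R).lipschitzOnWith
        (s := univ) fun x _ => clamp_mem hR x
      rw [mul_one, lipschitzOnWith_univ] at h
      exact h
    · have h := (hL t ht).dist_le_mul _ (clamp_mem hR x) 0 (by simpa using hR)
      rw [S.field_zero (ht₀.trans_le ht.1), dist_zero_right, dist_zero_right] at h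
      refine h.trans ?_
      push_cast
      refine mul_le_mul_of_nonneg_left ?_ L.coe_nonneg
      rw [Real.coe_toNNReal _ hR]
      simpa using clamp_mem hR x
  · have h : ContinuousOn (fun t : ℝ => (clamp R x, t)) (Ici t₀) := by fun_prop
    exact S.contDiffOn_field.continuousOn.comp h fun t ht => ht₀.trans_le ht

/-- `z` solves the system on `[t₀, t₁]`. -/
def IsSolutionOn (t₀ t₁ : ℝ) (z : ℝ → ℝ × ℝ) : Prop :=
  ∀ t ∈ Icc t₀ t₁, HasDerivWithinAt z (S.field t (z t)) (Icc t₀ t₁) t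

variable {S}

theorem IsSolution.isSolutionOn {t₀ : ℝ} {z : ℝ → ℝ × ℝ} (h : S.IsSolution t₀ z) (t₁ : ℝ) :
    S.IsSolutionOn t₀ t₁ z :=
  fun t ht => (h t ht.1).mono Icc_subset_Ici_self

theorem IsSolutionOn.mono {t₀ t₁ a b : ℝ} {z : ℝ → ℝ × ℝ} (h : S.IsSolutionOn t₀ t₁ z)
    (ha : t₀ ≤ a) (hb : b ≤ t₁) : S.IsSolutionOn a b z :=
  fun t ht => (h t (Icc_subset_Icc ha hb ht)).mono (Icc_subset_Icc ha hb)

theorem continuous_planeNorm : Continuous planeNorm := by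
  unfold planeNorm
  fun_prop

variable (S) in
/-- Solutions in a ball grow at most by a fixed factor on a compact time interval. -/
theorem exists_planeNorm_le {t₀ : ℝ} (ht₀ : 0 < t₀) (T R : ℝ) : ∃ K ≥ (1 : ℝ), ∀ t₁ ≤ T,
    ∀ z, S.IsSolutionOn t₀ t₁ z → (∀ t ∈ Icc t₀ t₁, planeNorm (z t) ≤ R) →
    ∀ t ∈ Icc t₀ t₁, planeNorm (z t) ≤ K * planeNorm (z t₀) := by
  obtain ⟨L, hL⟩ := S.exists_lipschitz_field ht₀ T R
  -- The exponential is Gronwall's, as the field vanishes at the origin and is `L`-Lipschitz; the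
  -- `2` comes from comparing the two norms.
  refine ⟨2 * Real.exp (L * |T - t₀|), ?_, fun t₁ ht₁ z hz hR t ht => ?_⟩
  · have := Real.one_le_exp (mul_nonneg L.coe_nonneg (abs_nonneg (T - t₀)))
    linarith
  have h1 := norm_le_gronwallBound_of_norm_deriv_right_le (f := z)
    (f' := fun t => S.field t (z t)) (δ := ‖z t₀‖) (K := L) (ε := 0) (a := t₀) (b := t₁)
    (fun t ht => (hz t ht).continuousWithinAt)
    (fun t ht => (hz t (Ico_subset_Icc_self ht)).mono_of_mem_nhdsWithin
      (mem_of_superset (Icc_mem_nhdsGE ht.2) (Icc_subset_Icc_left ht.1))) le_rfl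
    (fun t ht => by
      have hzR := (norm_le_planeNorm (z t)).trans (hR t (Ico_subset_Icc_self ht))
      have h := (hL t ⟨ht.1, ht.2.le.trans ht₁⟩).dist_le_mul (z t) (by simpa using hzR) 0
        (by simpa using (norm_nonneg _).trans hzR)
      rw [S.field_zero (ht₀.trans_le ht.1), dist_zero_right, dist_zero_right] at h
      linarith) t ht
  rw [gronwallBound_ε0] at h1
  have h2 : Real.exp (L * (t - t₀)) ≤ Real.exp (L * |T - t₀|) :=
    Real.exp_le_exp.2 (mul_le_mul_of_nonneg_left
      ((by linarith [ht.2] : t - t₀ ≤ T - t₀).trans (le_abs_self _)) L.coe_nonneg)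
  calc _ ≤ 2 * ‖z t‖ := planeNorm_le_norm _
    _ ≤ 2 * (planeNorm (z t₀) * Real.exp (L * |T - t₀|)) := by
        refine mul_le_mul_of_nonneg_left (h1.trans ?_) (by norm_num)
        exact mul_le_mul (norm_le_planeNorm _) h2 (Real.exp_pos _).le (planeNorm_nonneg _)
    _ = _ := by ring

/-- A priori bounds for solutions that stay in a ball imply stability. -/
theorem stable_of_forall_isSolutionOn
    (h : ∀ t₀ > (0 : ℝ), ∀ ε > (0 : ℝ), ∃ R ≤ ε, ∃ δ > (0 : ℝ), δ ≤ R ∧ ∀ t₁ ≥ t₀, ∀ z,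
      S.IsSolutionOn t₀ t₁ z → planeNorm (z t₀) < δ → (∀ t ∈ Icc t₀ t₁, planeNorm (z t) ≤ R) →
      planeNorm (z t₁) < R) : S.Stable := by
  intro t₀ ht₀ ε hε
  obtain ⟨R, hRε, δ, hδ, hδR, H⟩ := h t₀ ht₀ ε hε
  refine ⟨δ, hδ, fun z₀ hz₀ => ⟨?_, fun z hz hz0 t ht => ?_⟩⟩
  -- The a priori bound keeps the clamped solution in the ball, where clamping does nothing; hence
  -- it is a genuine solution.
  · obtain ⟨z, hz0, hz⟩ := S.exists_solution_clamp ht₀ (hδ.le.trans hδR) z₀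
    have hcont : ContinuousOn z (Ici t₀) := fun t ht => (hz t ht).continuousWithinAt
    have hcl : ∀ t, planeNorm (z t) ≤ R → clamp R (z t) = z t := fun t ht =>
      clamp_eq ((norm_le_planeNorm _).trans ht)
    have hlt : ∀ t ≥ t₀, planeNorm (z t) < R := by
      refine lt_of_forall_le_imp_lt (continuous_planeNorm.comp_continuousOn hcont)
        (by simpa [hz0] using hz₀.trans_le hδR)
        fun t₁ ht₁ hle => H t₁ ht₁ z (fun t ht => ?_) (hz0 ▸ hz₀) hle
      have h1 := (hz t ht.1).mono (fun u hu => hu.1 : Icc t₀ t₁ ⊆ Ici t₀)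
      rwa [hcl t (hle t ht)] at h1
    refine ⟨z, fun t ht => ?_, hz0⟩
    have h1 := hz t ht
    rwa [hcl t (hlt t ht).le] at h1
  · refine (?_ : planeNorm (z t) < R).trans_le hRε
    exact lt_of_forall_le_imp_lt (g := fun t => planeNorm (z t))
      (continuous_planeNorm.comp_continuousOn fun t ht => (hz t ht).continuousWithinAt)
      (by simpa [hz0] using hz₀.trans_le hδR)
      (fun t₁ ht₁ hle => H t₁ ht₁ z (hz.isSolutionOn t₁) (hz0 ▸ hz₀) hle) t ht

end AsympHamSystem

/-! ### Stability from estimates at late times -/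

namespace AsympHamSystem

variable {S : AsympHamSystem}

/-- Between `t₀` and the late time `T` a solution grows by at most a fixed factor `K`, which is
absorbed by starting `K` times closer. -/
theorem stable_of_late {r : ℝ} (hr : 0 < r)
    (h : ∀ ε > (0 : ℝ), ∃ T₁ : ℝ, ∀ T ≥ T₁, ∃ δ > (0 : ℝ), ∀ t₁ ≥ T, ∀ z, S.IsSolutionOn T t₁ z →
      planeNorm (z T) < δ → (∀ t ∈ Icc T t₁, planeNorm (z t) < r) → planeNorm (z t₁) < ε) :
    S.Stable := by
  refine stable_of_forall_isSolutionOn fun t₀ ht₀ ε hε => ?_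
  set R := min ε (r / 2) with hR
  have hR0 : 0 < R := by positivity
  obtain ⟨T₁, hT₁⟩ := h R hR0
  set T := max t₀ T₁ with hT
  obtain ⟨δ, hδ, H⟩ := hT₁ T (le_max_right _ _)
  obtain ⟨K, hK, hb⟩ := S.exists_planeNorm_le ht₀ T R
  have hK0 : 0 < K := by linarith
  have hm : 0 < min δ R := lt_min hδ hR0
  refine ⟨R, min_le_left _ _, min δ R / K, by positivity,
    (div_le_self hm.le hK).trans (min_le_right _ _), fun t₁ ht₁ z hz hz0 hle => ?_⟩
  have hlt : K * planeNorm (z t₀) < min δ R := by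
    rw [lt_div_iff₀ hK0] at hz0; linarith
  rcases le_total t₁ T with h1 | h1
  · exact (hb t₁ h1 z hz hle t₁ ⟨ht₁, le_rfl⟩).trans_lt (hlt.trans_le (min_le_right _ _))
  · refine H t₁ h1 z (hz.mono (le_max_left _ _) le_rfl) ?_ fun t ht => ?_
    · exact (hb T le_rfl z (hz.mono le_rfl h1) (fun t ht => hle t ⟨ht.1, ht.2.trans h1⟩) T
        ⟨le_max_left _ _, le_rfl⟩).trans_lt (hlt.trans_le (min_le_left _ _))
    · have h2 := hle t ⟨(le_max_left _ _).trans ht.1, ht.2⟩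
      linarith [min_le_right ε (r / 2)]

/-- Since `C` does not depend on `T`, the decay bound is below any `ε` for late `T`, which already
gives stability. On `[t₀, T]` the constant `r T^κ` makes the power bound trivial. -/
theorem polynomiallyStable_of_late {r κ T₁ C : ℝ} (hr : 0 < r) (hκ : 0 < κ)
    (h : ∀ T ≥ T₁, ∃ δ > (0 : ℝ), ∀ t₁ ≥ T, ∀ z, S.IsSolutionOn T t₁ z →
      planeNorm (z T) < δ → (∀ t ∈ Icc T t₁, planeNorm (z t) < r) →
      planeNorm (z t₁) ≤ C * t₁ ^ (-κ)) :
    S.PolynomiallyStable := by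
  have hS : S.Stable := by
    refine stable_of_late hr fun ε hε => ?_
    have h1 : Tendsto (fun t : ℝ => C * t ^ (-κ)) atTop (𝓝 0) := by
      simpa using (tendsto_rpow_neg_atTop hκ).const_mul C
    obtain ⟨T₂, hT₂⟩ := eventually_atTop.1 (h1.eventually (gt_mem_nhds hε))
    refine ⟨max T₁ T₂, fun T hT => ?_⟩
    obtain ⟨δ, hδ, H⟩ := h T ((le_max_left _ _).trans hT)
    exact ⟨δ, hδ, fun t₁ ht₁ z hz hz0 hlt =>
      (H t₁ ht₁ z hz hz0 hlt).trans_lt (hT₂ t₁ ((le_max_right _ _).trans (hT.trans ht₁)))⟩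
  refine ⟨hS, κ, hκ, fun t₀ ht₀ => ?_⟩
  set T := max t₀ T₁ with hT
  have hT0 : 0 < T := ht₀.trans_le (le_max_left _ _)
  obtain ⟨δ, hδ, H⟩ := h T (le_max_right _ _)
  obtain ⟨δ', hδ', H'⟩ := hS t₀ ht₀ (min r δ) (by positivity)
  refine ⟨δ', hδ', max C (r * T ^ κ), fun z hz hz0 t ht => ?_⟩
  have hlt := (H' (z t₀) hz0).2 z hz rfl
  have ht0 : 0 < t := ht₀.trans_le ht
  have hp : 0 ≤ t ^ (-κ) := Real.rpow_nonneg ht0.le _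
  rcases le_total t T with h1 | h1
  · have h2 : 1 ≤ T ^ κ * t ^ (-κ) := by
      rw [Real.rpow_neg ht0.le, ← div_eq_mul_inv, one_le_div (by positivity)]
      exact Real.rpow_le_rpow ht0.le h1 hκ.le
    calc planeNorm (z t) ≤ r * 1 := by
          rw [mul_one]; exact ((hlt t ht).trans_le (min_le_left _ _)).le
      _ ≤ r * (T ^ κ * t ^ (-κ)) := mul_le_mul_of_nonneg_left h2 hr.le
      _ = r * T ^ κ * t ^ (-κ) := by ring
      _ ≤ _ := mul_le_mul_of_nonneg_right (le_max_right _ _) hp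
  · refine (H t h1 z ((hz.isSolutionOn t).mono (le_max_left _ _) le_rfl)
      ((hlt T (le_max_left _ _)).trans_le (min_le_right _ _)) fun u hu =>
      (hlt u ((le_max_left _ _).trans hu.1)).trans_le (min_le_left _ _)).trans
      (mul_le_mul_of_nonneg_right (le_max_left _ _) hp)

/-- Gronwall on `[t₀, T]` keeps the bound proportional to the initial value; resetting the clock
from `T` to `t₀` costs only a constant exponential factor. -/
theorem exponentiallyStable_of_late {r a c T₁ C : ℝ} (hS : S.Stable) (hr : 0 < r) (ha : 0 ≤ a)
    (hc : 0 < c) (hC : 0 ≤ C)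
    (h : ∀ T ≥ T₁, ∃ δ > (0 : ℝ), ∀ t₁ ≥ T, ∀ z, S.IsSolutionOn T t₁ z →
      planeNorm (z T) < δ → (∀ t ∈ Icc T t₁, planeNorm (z t) < r) →
      planeNorm (z t₁) ≤ C * planeNorm (z T) * Real.exp (-c * (t₁ ^ a - T ^ a))) :
    S.ExponentiallyStable a := by
  refine ⟨hS, c, hc, fun t₀ ht₀ => ?_⟩
  set T := max t₀ T₁ with hT
  have hT0 : 0 < T := ht₀.trans_le (le_max_left _ _)
  obtain ⟨δ, hδ, H⟩ := h T (le_max_right _ _)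
  obtain ⟨δ', hδ', H'⟩ := hS t₀ ht₀ (min r δ) (by positivity)
  obtain ⟨K, hK, hb⟩ := S.exists_planeNorm_le ht₀ T r
  refine ⟨δ', hδ', (C + 1) * K * Real.exp (c * (T ^ a - t₀ ^ a)), fun z hz hz0 t ht => ?_⟩
  have hlt := (H' (z t₀) hz0).2 z hz rfl
  have hltr : ∀ t ≥ t₀, planeNorm (z t) ≤ r := fun t ht =>
    ((hlt t ht).trans_le (min_le_left _ _)).le
  have ht0 : 0 < t := ht₀.trans_le ht
  have hz0' := planeNorm_nonneg (z t₀)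
  have hexp : Real.exp (c * (T ^ a - t₀ ^ a)) * Real.exp (-c * (t ^ a - t₀ ^ a))
      = Real.exp (-c * (t ^ a - T ^ a)) := by
    rw [← Real.exp_add]; congr 1; ring
  have hle : ∀ x, x ≤ (C + 1) * K * planeNorm (z t₀) * Real.exp (-c * (t ^ a - T ^ a)) →
      x ≤ (C + 1) * K * Real.exp (c * (T ^ a - t₀ ^ a)) * planeNorm (z t₀)
        * Real.exp (-c * (t ^ a - t₀ ^ a)) := fun x hx => by
    rw [← hexp] at hx
    linarith
  refine hle _ ?_
  rcases le_total t T with h1 | h1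
  · have h2 : 1 ≤ Real.exp (-c * (t ^ a - T ^ a)) := by
      refine Real.one_le_exp ?_
      have := Real.rpow_le_rpow ht0.le h1 ha
      nlinarith
    have h3 := hb t h1 z (hz.isSolutionOn t) (fun u hu => hltr u hu.1) t ⟨ht, le_rfl⟩
    have h4 : 0 ≤ K * planeNorm (z t₀) := by positivity
    have h5 : K * planeNorm (z t₀) ≤ (C + 1) * K * planeNorm (z t₀) := by nlinarith
    exact (h3.trans h5).trans (le_mul_of_one_le_right (h4.trans h5) h2)
  · have h3 := hb T le_rfl z (hz.isSolutionOn T) (fun u hu => hltr u hu.1) T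
      ⟨le_max_left _ _, le_rfl⟩
    refine (H t h1 z ((hz.isSolutionOn t).mono (le_max_left _ _) le_rfl)
      ((hlt T (le_max_left _ _)).trans_le (min_le_right _ _)) fun u hu =>
      (hlt u ((le_max_left _ _).trans hu.1)).trans_le (min_le_left _ _)).trans
      (mul_le_mul_of_nonneg_right ?_ (Real.exp_pos _).le)
    have h4 : 0 ≤ K * planeNorm (z t₀) := by positivity
    nlinarith [mul_le_mul_of_nonneg_left h3 hC]

end AsympHamSystem

/-! ### Scalar differential inequalities -/

/-- With the integrating factor `exp g`, the product `V exp g` is nonincreasing. -/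
theorem le_mul_exp_of_deriv_le {V D g g' : ℝ → ℝ} {T t₁ : ℝ} (hT : T ≤ t₁)
    (hV : ∀ t ∈ Icc T t₁, HasDerivWithinAt V (D t) (Icc T t₁) t)
    (hg : ∀ t ∈ Icc T t₁, HasDerivAt g (g' t) t)
    (hD : ∀ t ∈ Icc T t₁, D t ≤ -g' t * V t) : V t₁ ≤ V T * Real.exp (g T - g t₁) := by
  have hd : ∀ t ∈ Icc T t₁, HasDerivWithinAt (fun t => V t * Real.exp (g t))
      (D t * Real.exp (g t) + V t * (Real.exp (g t) * g' t)) (Icc T t₁) t := fun t ht =>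
    (hV t ht).mul (hg t ht).exp.hasDerivWithinAt
  have h := antitoneOn_of_hasDerivWithinAt_nonpos (convex_Icc T t₁)
    (fun t ht => (hd t ht).continuousWithinAt)
    (fun t ht => (hd t (interior_subset ht)).mono interior_subset) (fun t ht => by
      have h1 := hD t (interior_subset ht)
      nlinarith [mul_le_mul_of_nonneg_right h1 (Real.exp_pos (g t)).le])
    ⟨le_rfl, hT⟩ ⟨hT, le_rfl⟩ hT
  simp only at h
  rw [Real.exp_sub, ← mul_div_assoc, le_div_iff₀ (Real.exp_pos _)]
  exact h

/-- This fixes the exponent `κ`: on the curve `M t^{-κ}` the nonlinear term has the same time decay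
as the linear one. -/
theorem mul_rpow_neg_pow {t M κ μ ν : ℝ} {s : ℕ} (ht : 0 < t) (hs : 1 ≤ s)
    (hκ : κ * ((s : ℝ) - 1) = ν - μ) :
    t ^ (-μ) * (M * t ^ (-κ)) ^ (s - 1) = M ^ (s - 1) * t ^ (-ν) := by
  rw [mul_pow, ← Real.rpow_mul_natCast ht.le, mul_left_comm, ← Real.rpow_add ht]
  congr 2
  rw [Nat.cast_sub hs, Nat.cast_one]
  linarith

/-- A power barrier for a Bernoulli type differential inequality. -/
theorem le_mul_rpow_of_deriv_le {V D : ℝ → ℝ} {T t₁ a b M κ μ ν : ℝ} {s : ℕ} (hT : 0 < T)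
    (hM : 0 < M) (hs : 1 ≤ s) (hκ : κ * ((s : ℝ) - 1) = ν - μ)
    (hb : ∀ t ≥ T, κ < -(a * M ^ (s - 1) + b) * t ^ (1 - ν))
    (hV : ∀ t ∈ Icc T t₁, HasDerivWithinAt V (D t) (Icc T t₁) t)
    (hD : ∀ t ∈ Icc T t₁, D t ≤ a * (t ^ (-μ) * V t ^ s) + b * (t ^ (-ν) * V t))
    (h0 : V T ≤ M * T ^ (-κ)) {t : ℝ} (ht : t ∈ Icc T t₁) : V t ≤ M * t ^ (-κ) := by
  have hB : ∀ t ∈ Icc T t₁, HasDerivAt (fun t : ℝ => M * t ^ (-κ)) (M * (-κ * t ^ (-κ - 1))) t :=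
    fun t ht => (Real.hasDerivAt_rpow_const (Or.inl (hT.trans_le ht.1).ne')).const_mul M
  refine image_le_of_deriv_right_lt_deriv_boundary' (f := V) (f' := D)
    (fun t ht => (hV t ht).continuousWithinAt)
    (fun t ht => (hV t (Ico_subset_Icc_self ht)).mono_of_mem_nhdsWithin
      (mem_of_superset (Icc_mem_nhdsGE ht.2) (Icc_subset_Icc_left ht.1))) h0
    (fun t ht => (hB t ht).continuousAt.continuousWithinAt)
    (fun t ht => (hB t (Ico_subset_Icc_self ht)).hasDerivWithinAt) (fun t ht hVt => ?_) ht
  have ht0 : 0 < t := hT.trans_le ht.1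
  have h1 := hD t (Ico_subset_Icc_self ht)
  have h2 := hb t ht.1
  have hW : 0 < M * t ^ (-κ) := mul_pos hM (Real.rpow_pos_of_pos ht0 _)
  have e1 : V t ^ s = V t ^ (s - 1) * V t := by rw [← pow_succ, Nat.sub_add_cancel hs]
  rw [e1, ← mul_assoc (t ^ (-μ)), hVt, mul_rpow_neg_pow ht0 hs hκ] at h1
  have e2 : t ^ (-κ - 1) = t ^ (-κ) * t⁻¹ := by
    rw [sub_eq_add_neg, Real.rpow_add ht0, Real.rpow_neg_one]
  have e3 : t ^ (-ν) = t ^ (1 - ν) * t⁻¹ := by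
    rw [sub_eq_add_neg, Real.rpow_add ht0, Real.rpow_one]; field_simp
  have h3 : 0 < M * t ^ (-κ) * t⁻¹ := by positivity
  rw [e3] at h1
  rw [e2]
  -- At a contact point the required strict inequality of slopes is `hb` multiplied by `M t^{-κ} /
  -- t`.
  nlinarith [mul_lt_mul_of_pos_right h2 h3]

/-! ### The Bernoulli inequality along solutions and the stability cases -/

namespace AsympHamSystem.EnergyAngle

variable {S : AsympHamSystem} {A : S.EnergyAngle} {m n s : ℕ} {γ lam : ℝ}

/-- Two conditions on `c` are needed because the sign of `a` decides whether the lower or the upper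
bound for `V` is the relevant one. -/
theorem add_mul_pow_le {a c η E V : ℝ} (s : ℕ) (hη1 : η ≤ 1) (hE : 0 ≤ E)
    (h1 : c ≤ a * (1 - η) ^ s) (h2 : c ≤ a * (1 + η) ^ s) (hV1 : (1 - η) * E ≤ V)
    (hV2 : V ≤ (1 + η) * E) : c * E ^ s ≤ a * V ^ s := by
  have hV0 : 0 ≤ (1 - η) * E := mul_nonneg (by linarith) hE
  rcases le_total 0 a with ha | ha
  · calc c * E ^ s ≤ a * (1 - η) ^ s * E ^ s := mul_le_mul_of_nonneg_right h1 (pow_nonneg hE s)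
      _ = a * ((1 - η) * E) ^ s := by rw [mul_pow]; ring
      _ ≤ a * V ^ s := mul_le_mul_of_nonneg_left (pow_le_pow_left₀ hV0 hV1 s) ha
  · calc c * E ^ s ≤ a * (1 + η) ^ s * E ^ s := mul_le_mul_of_nonneg_right h2 (pow_nonneg hE s)
      _ = a * ((1 + η) * E) ^ s := by rw [mul_pow]; ring
      _ ≤ a * V ^ s :=
        mul_le_mul_of_nonpos_left (pow_le_pow_left₀ (hV0.trans hV1) hV2 s) ha

theorem eventually_add_le_mul_pow {a c : ℝ} (h : c < a) (s : ℕ) :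
    ∀ᶠ η : ℝ in 𝓝[>] 0, c + η ≤ a * (1 - η) ^ s ∧ c + η ≤ a * (1 + η) ^ s := by
  have h1 : Continuous fun η : ℝ => a * (1 - η) ^ s - (c + η) := by fun_prop
  have h2 : Continuous fun η : ℝ => a * (1 + η) ^ s - (c + η) := by fun_prop
  have h3 := (h1.tendsto 0).eventually (lt_mem_nhds (a := 0) (by simpa using h))
  have h4 := (h2.tendsto 0).eventually (lt_mem_nhds (a := 0) (by simpa using h))
  filter_upwards [nhdsWithin_le_nhds h3, nhdsWithin_le_nhds h4] with η h5 h6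
  constructor <;> linarith

/-- Along solutions near the equilibrium there is a function comparable to the energy that
satisfies a differential inequality of Bernoulli type. -/
theorem exists_lyap_ineq (A : S.EnergyAngle) (hm : 1 ≤ m) (hmn : m < n) (hs : 2 ≤ s)
    (hzero : ∀ k, 1 ≤ k → k < m → ∀ w ∈ Ioo 0 A.E₀, A.Lam k w = 0)
    (hLm : (fun w : ℝ => A.Lam m w - γ * w ^ s) =O[𝓝[>] 0] (fun w : ℝ => w ^ (s + 1)))
    (hLj : ∀ j, m ≤ j → j < n → A.Lam j =O[𝓝[>] 0] (fun w : ℝ => w ^ s))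
    (hLn : (fun w : ℝ => A.Lam n w - lam * w) =O[𝓝[>] 0] (fun w : ℝ => w ^ 2))
    {a b : ℝ} (ha : γ < a) (hb : lam < b) {l : ℕ} (hl : l ≤ n) (hlb : l = n ∨ 0 ≤ b) :
    ∃ r > (0 : ℝ), ∃ T₁ ≥ (1 : ℝ), ∀ T ≥ T₁, ∀ t₁, ∀ z, S.IsSolutionOn T t₁ z →
      (∀ t ∈ Icc T t₁, planeNorm (z t) < r) → ∃ V D : ℝ → ℝ, ∀ t ∈ Icc T t₁,
        planeNorm (z t) ^ 2 ≤ 8 * V t ∧ V t ≤ 2 * planeNorm (z t) ^ 2 ∧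
        HasDerivWithinAt V (D t) (Icc T t₁) t ∧
        D t ≤ a * (t ^ (-((m : ℝ) / S.q)) * V t ^ s) + b * (t ^ (-((l : ℝ) / S.q)) * V t) := by
  -- The gaps `γ < a` and `lam < b` absorb both the error `η` and the replacement of `E` by `V`.
  -- With `η < 1/2`, `V` lies between `E/2` and `3E/2`, whence the constants `8` and `2`.
  obtain ⟨η, ⟨⟨ha1, ha2⟩, hb1, hb2⟩, hη⟩ := (((eventually_add_le_mul_pow ha s).and
    (eventually_add_le_mul_pow hb 1)).and (Ioo_mem_nhdsGT (by norm_num : (0 : ℝ) < 1 / 2))).exists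
  obtain ⟨r, hr, T₁, hT₁, h⟩ := A.exists_lyap_estimate hm hmn hs hzero hLm hLj hLn hη.1
  refine ⟨r, hr, T₁, hT₁, fun T hT t₁ z hz hzr => ?_⟩
  have key : ∀ t ∈ Icc T t₁, ∃ D,
      planeNorm (z t) ^ 2 ≤ 8 * A.lyap n (z t) t ∧ A.lyap n (z t) t ≤ 2 * planeNorm (z t) ^ 2 ∧
      HasDerivWithinAt (fun t => A.lyap n (z t) t) D (Icc T t₁) t ∧
      D ≤ a * (t ^ (-((m : ℝ) / S.q)) * A.lyap n (z t) t ^ s)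
        + b * (t ^ (-((l : ℝ) / S.q)) * A.lyap n (z t) t) := fun t ht => by
    obtain ⟨h1, h2, h3, D, h4, h5⟩ := h t (hT.trans ht.1) (z t) (hzr t ht)
    have ht1 : 1 ≤ t := (hT₁.trans hT).trans ht.1
    set E := S.Hc 0 (z t)
    set V := A.lyap n (z t) t
    have hE : 0 ≤ E := le_trans (by positivity) h1
    have h6 := abs_le.1 h3
    have hV1 : (1 - η) * E ≤ V := by linarith [h6.1]
    have hV2 : V ≤ (1 + η) * E := by linarith [h6.2]
    have h7 : η * E ≤ 1 / 2 * E := mul_le_mul_of_nonneg_right hη.2.le hE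
    refine ⟨D, by linarith, by linarith, h4 z _ rfl (hz t ht), ?_⟩
    have h8 := add_mul_pow_le s (by linarith [hη.2]) hE ha1 ha2 hV1 hV2
    have h9 := add_mul_pow_le 1 (by linarith [hη.2]) hE hb1 hb2 hV1 hV2
    rw [pow_one, pow_one] at h9
    have hm0 : 0 ≤ t ^ (-((m : ℝ) / S.q)) := Real.rpow_nonneg (by linarith) _
    have hn0 : 0 ≤ t ^ (-((n : ℝ) / S.q)) := Real.rpow_nonneg (by linarith) _
    have h10 : b * (t ^ (-((n : ℝ) / S.q)) * V) ≤ b * (t ^ (-((l : ℝ) / S.q)) * V) := by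
      rcases hlb with rfl | hb0
      · exact le_rfl
      · refine mul_le_mul_of_nonneg_left (mul_le_mul_of_nonneg_right ?_ (by linarith)) hb0
        have := rpow_neg_div_le (q := S.q) ht1 hl
        rwa [neg_div, neg_div] at this
    rw [neg_div, neg_div] at h5
    nlinarith [(abs_le.1 h5).2, mul_le_mul_of_nonneg_left h8 hm0, mul_le_mul_of_nonneg_left h9 hn0]
  choose! D hD using key
  exact ⟨fun t => A.lyap n (z t) t, D, hD⟩

/-- Power decay of the function in `exists_lyap_ineq`. -/
theorem exists_lyap_decay (A : S.EnergyAngle) (hm : 1 ≤ m) (hmn : m < n) (hs : 2 ≤ s)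
    (hzero : ∀ k, 1 ≤ k → k < m → ∀ w ∈ Ioo 0 A.E₀, A.Lam k w = 0)
    (hLm : (fun w : ℝ => A.Lam m w - γ * w ^ s) =O[𝓝[>] 0] (fun w : ℝ => w ^ (s + 1)))
    (hLj : ∀ j, m ≤ j → j < n → A.Lam j =O[𝓝[>] 0] (fun w : ℝ => w ^ s))
    (hLn : (fun w : ℝ => A.Lam n w - lam * w) =O[𝓝[>] 0] (fun w : ℝ => w ^ 2))
    {a b : ℝ} (ha : γ < a) (hb : lam < b) {l : ℕ} (hl : l ≤ n) (hlb : l = n ∨ 0 ≤ b)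
    {M κ : ℝ} (hM : 0 < M) (hκ : κ * ((s : ℝ) - 1) = (l : ℝ) / S.q - (m : ℝ) / S.q)
    (hβ : ∀ᶠ t : ℝ in atTop, κ < -(a * M ^ (s - 1) + b) * t ^ (1 - (l : ℝ) / S.q)) :
    ∃ r > (0 : ℝ), ∃ T₁ ≥ (1 : ℝ), ∀ T ≥ T₁, ∃ δ > (0 : ℝ), ∀ t₁, ∀ z, S.IsSolutionOn T t₁ z →
      planeNorm (z T) < δ → (∀ t ∈ Icc T t₁, planeNorm (z t) < r) → ∃ V D : ℝ → ℝ,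
      ∀ t ∈ Icc T t₁,
        planeNorm (z t) ^ 2 ≤ 8 * V t ∧ V t ≤ 2 * planeNorm (z t) ^ 2 ∧
        HasDerivWithinAt V (D t) (Icc T t₁) t ∧
        D t ≤ a * (t ^ (-((m : ℝ) / S.q)) * V t ^ s) + b * (t ^ (-((l : ℝ) / S.q)) * V t) ∧
        V t ≤ M * t ^ (-κ) := by
  obtain ⟨r, hr, T₁, hT₁, h⟩ :=
    A.exists_lyap_ineq hm hmn hs hzero hLm hLj hLn ha hb hl hlb
  obtain ⟨T₂, hT₂⟩ := eventually_atTop.1 hβ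
  refine ⟨r, hr, max T₁ T₂, le_max_of_le_left hT₁, fun T hT => ?_⟩
  have hT0 : 0 < T := by linarith [(le_max_left T₁ T₂).trans hT]
  have hMT : 0 < M * T ^ (-κ) := mul_pos hM (Real.rpow_pos_of_pos hT0 _)
  -- As `V ≤ 2 planeNorm²`, this `δ` starts the solution below the barrier.
  refine ⟨√(M * T ^ (-κ) / 2), Real.sqrt_pos.2 (by linarith), fun t₁ z hz hz0 hzr => ?_⟩
  obtain ⟨V, D, hVD⟩ := h T ((le_max_left _ _).trans hT) t₁ z hz hzr
  refine ⟨V, D, fun t ht => ⟨(hVD t ht).1, (hVD t ht).2.1, (hVD t ht).2.2.1, (hVD t ht).2.2.2, ?_⟩⟩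
  have hTm : T ∈ Icc T t₁ := ⟨le_rfl, ht.1.trans ht.2⟩
  refine le_mul_rpow_of_deriv_le hT0 hM (by omega) hκ
    (fun t ht => hT₂ t ((le_max_right _ _).trans (hT.trans ht))) (fun t ht => (hVD t ht).2.2.1)
    (fun t ht => (hVD t ht).2.2.2) ?_ ht
  have h1 := (Real.lt_sqrt (planeNorm_nonneg _)).1 hz0
  linarith [(hVD T hTm).2.1]

theorem polynomiallyStable_of_decay (A : S.EnergyAngle) (hm : 1 ≤ m) (hmn : m < n) (hs : 2 ≤ s)
    (hzero : ∀ k, 1 ≤ k → k < m → ∀ w ∈ Ioo 0 A.E₀, A.Lam k w = 0)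
    (hLm : (fun w : ℝ => A.Lam m w - γ * w ^ s) =O[𝓝[>] 0] (fun w : ℝ => w ^ (s + 1)))
    (hLj : ∀ j, m ≤ j → j < n → A.Lam j =O[𝓝[>] 0] (fun w : ℝ => w ^ s))
    (hLn : (fun w : ℝ => A.Lam n w - lam * w) =O[𝓝[>] 0] (fun w : ℝ => w ^ 2))
    {a b : ℝ} (ha : γ < a) (hb : lam < b) {l : ℕ} (hl : l ≤ n) (hlb : l = n ∨ 0 ≤ b)
    {M κ : ℝ} (hM : 0 < M) (hκ0 : 0 < κ)
    (hκ : κ * ((s : ℝ) - 1) = (l : ℝ) / S.q - (m : ℝ) / S.q)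
    (hβ : ∀ᶠ t : ℝ in atTop, κ < -(a * M ^ (s - 1) + b) * t ^ (1 - (l : ℝ) / S.q)) :
    S.PolynomiallyStable := by
  obtain ⟨r, hr, T₁, hT₁, h⟩ :=
    A.exists_lyap_decay hm hmn hs hzero hLm hLj hLn ha hb hl hlb hM hκ hβ
  -- `V` is quadratic in the radius, so its rate `κ` becomes `κ / 2`.
  refine polynomiallyStable_of_late hr (half_pos hκ0) (C := √(8 * M)) (T₁ := T₁) fun T hT => ?_
  obtain ⟨δ, hδ, H⟩ := h T hT
  refine ⟨δ, hδ, fun t₁ ht₁ z hz hz0 hzr => ?_⟩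
  obtain ⟨V, D, hVD⟩ := H t₁ z hz hz0 hzr
  have h1 := hVD t₁ ⟨ht₁, le_rfl⟩
  have ht0 : 0 < t₁ := by linarith
  have h2 : (t₁ ^ (-(κ / 2))) ^ 2 = t₁ ^ (-κ) := by
    rw [← Real.rpow_mul_natCast ht0.le]
    congr 1
    push_cast
    ring
  refine (sq_le_sq₀ (planeNorm_nonneg _)
    (mul_nonneg (Real.sqrt_nonneg _) (Real.rpow_nonneg ht0.le _))).1 ?_
  rw [mul_pow, h2, Real.sq_sqrt (by positivity)]
  linarith [h1.1, h1.2.2.2.2]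

theorem exists_pos_le_one_mul_lt {a c : ℝ} (ha : 0 < a) (hc : 0 < c) :
    ∃ M : ℝ, 0 < M ∧ M ≤ 1 ∧ a * M < c := by
  refine ⟨min 1 (c / (2 * a)), by positivity, min_le_left _ _, ?_⟩
  calc a * min 1 (c / (2 * a)) ≤ a * (c / (2 * a)) :=
        mul_le_mul_of_nonneg_left (min_le_right _ _) ha.le
    _ = c / 2 := by field_simp
    _ < c := by linarith

theorem rate_mul (hs : 2 ≤ s) (l : ℕ) :
    ((l : ℝ) - m) / (S.q * ((s : ℝ) - 1)) * ((s : ℝ) - 1) = (l : ℝ) / S.q - (m : ℝ) / S.q := by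
  have hq : (0 : ℝ) < S.q := Nat.cast_pos.2 S.q_pos
  have hs' : (2 : ℝ) ≤ s := by exact_mod_cast hs
  have : (s : ℝ) - 1 ≠ 0 := by linarith
  field_simp

theorem rate_pos (hs : 2 ≤ s) {l : ℕ} (hml : m < l) :
    0 < ((l : ℝ) - m) / (S.q * ((s : ℝ) - 1)) := by
  have hq : (0 : ℝ) < S.q := Nat.cast_pos.2 S.q_pos
  have hs' : (2 : ℝ) ≤ s := by exact_mod_cast hs
  have hml' : (m : ℝ) < l := Nat.cast_lt.2 hml
  exact div_pos (by linarith) (mul_pos hq (by linarith))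

/-- The leading nonlinear damping makes the equilibrium polynomially stable. -/
theorem polynomiallyStable_of_neg (A : S.EnergyAngle) (hm : 1 ≤ m) (hmn : m < n) (hs : 2 ≤ s)
    (hzero : ∀ k, 1 ≤ k → k < m → ∀ w ∈ Ioo 0 A.E₀, A.Lam k w = 0)
    (hLm : (fun w : ℝ => A.Lam m w - γ * w ^ s) =O[𝓝[>] 0] (fun w : ℝ => w ^ (s + 1)))
    (hLj : ∀ j, m ≤ j → j < n → A.Lam j =O[𝓝[>] 0] (fun w : ℝ => w ^ s))
    (hLn : (fun w : ℝ => A.Lam n w - lam * w) =O[𝓝[>] 0] (fun w : ℝ => w ^ 2))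
    (hmq : m < S.q) (hγ : γ < 0) : S.PolynomiallyStable := by
  have hq : (0 : ℝ) < S.q := Nat.cast_pos.2 S.q_pos
  -- Capping the index at `q` gives `t^{1-l/q} ≥ 1`. This weakens the linear bound, which is
  -- harmless because `b` is positive.
  set l := min n S.q with hl
  have hml : m < l := lt_min hmn hmq
  set κ := ((l : ℝ) - m) / (S.q * ((s : ℝ) - 1)) with hκ
  have hκ0 : 0 < κ := rate_pos hs hml
  set b := |lam| + 1 with hb
  have hb0 : 0 < b := by positivity
  -- A high barrier: the damping `γ/2 * M^{s-1}` outweighs both `b` and the slope `κ`.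
  set M := (b + κ + 1) / (-(γ / 2)) + 1 with hM
  have hM1 : 1 ≤ M := by
    have : 0 ≤ (b + κ + 1) / (-(γ / 2)) := div_nonneg (by linarith) (by linarith)
    linarith
  refine A.polynomiallyStable_of_decay hm hmn hs hzero hLm hLj hLn (a := γ / 2) (b := b)
    (M := M) (by linarith) (by linarith [le_abs_self lam]) (min_le_left n S.q) (Or.inr hb0.le)
    (by linarith) hκ0 (rate_mul hs l) ?_
  filter_upwards [eventually_ge_atTop 1] with t ht
  have h1 : 1 ≤ t ^ (1 - (l : ℝ) / S.q) := by
    refine Real.one_le_rpow ht (sub_nonneg.2 ((div_le_one hq).2 ?_))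
    exact Nat.cast_le.2 (min_le_right n S.q)
  have h2 : M ≤ M ^ (s - 1) := le_self_pow₀ hM1 (by omega)
  have h3 : γ / 2 * M ≤ -(b + κ + 1) := by
    have : (b + κ + 1) / (-(γ / 2)) * (-(γ / 2)) = b + κ + 1 :=
      div_mul_cancel₀ _ (by linarith : 0 < -(γ / 2)).ne'
    rw [hM]
    linarith
  have h4 : γ / 2 * M ^ (s - 1) ≤ γ / 2 * M := mul_le_mul_of_nonpos_left h2 (by linarith)
  nlinarith

/-- In the critical case a sufficiently negative linear part gives polynomial stability. -/
theorem polynomiallyStable_of_eq (A : S.EnergyAngle) (hm : 1 ≤ m) (hmn : m < n) (hs : 2 ≤ s)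
    (hzero : ∀ k, 1 ≤ k → k < m → ∀ w ∈ Ioo 0 A.E₀, A.Lam k w = 0)
    (hLm : (fun w : ℝ => A.Lam m w - γ * w ^ s) =O[𝓝[>] 0] (fun w : ℝ => w ^ (s + 1)))
    (hLj : ∀ j, m ≤ j → j < n → A.Lam j =O[𝓝[>] 0] (fun w : ℝ => w ^ s))
    (hLn : (fun w : ℝ => A.Lam n w - lam * w) =O[𝓝[>] 0] (fun w : ℝ => w ^ 2))
    (hnq : n = S.q) (h : lam + ((n : ℝ) - m) / (S.q * ((s : ℝ) - 1)) < 0) :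
    S.PolynomiallyStable := by
  have hq : (0 : ℝ) < S.q := Nat.cast_pos.2 S.q_pos
  set κ := ((n : ℝ) - m) / (S.q * ((s : ℝ) - 1)) with hκ
  have hκ0 : 0 < κ := rate_pos hs hmn
  -- The midpoint of `lam` and `-κ`. Since `b < -κ`, a low barrier works whatever the sign of `γ`.
  set b := (lam - κ) / 2 with hb
  set a := |γ| + 1 with ha
  have ha0 : 0 < a := by positivity
  obtain ⟨M, hM0, hM1, hM⟩ : ∃ M : ℝ, 0 < M ∧ M ≤ 1 ∧ a * M < -κ - b :=
    exists_pos_le_one_mul_lt ha0 (by linarith)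
  refine A.polynomiallyStable_of_decay hm hmn hs hzero hLm hLj hLn (a := a) (b := b)
    (by linarith [le_abs_self γ]) (by linarith) le_rfl (Or.inl rfl) hM0 hκ0 (rate_mul hs n) ?_
  have h1 : M ^ (s - 1) ≤ M := pow_le_of_le_one hM0.le hM1 (by omega)
  have h2 := mul_le_mul_of_nonneg_left h1 ha0.le
  have h3 : 1 - (n : ℝ) / S.q = 0 := by rw [hnq, div_self hq.ne', sub_self]
  refine Eventually.of_forall fun t => ?_
  rw [h3, Real.rpow_zero]
  linarith

/-- A negative linear part decaying slower than `1 / t` gives exponential stability. -/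
theorem exponentiallyStable_of_neg (A : S.EnergyAngle) (hm : 1 ≤ m) (hmn : m < n) (hs : 2 ≤ s)
    (hzero : ∀ k, 1 ≤ k → k < m → ∀ w ∈ Ioo 0 A.E₀, A.Lam k w = 0)
    (hLm : (fun w : ℝ => A.Lam m w - γ * w ^ s) =O[𝓝[>] 0] (fun w : ℝ => w ^ (s + 1)))
    (hLj : ∀ j, m ≤ j → j < n → A.Lam j =O[𝓝[>] 0] (fun w : ℝ => w ^ s))
    (hLn : (fun w : ℝ => A.Lam n w - lam * w) =O[𝓝[>] 0] (fun w : ℝ => w ^ 2))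
    (hnq : n < S.q) (hlam : lam < 0) : S.ExponentiallyStable (1 - (n : ℝ) / S.q) := by
  have hq : (0 : ℝ) < S.q := Nat.cast_pos.2 S.q_pos
  set ν := (n : ℝ) / S.q with hν
  have hν1 : 0 < 1 - ν := sub_pos.2 ((div_lt_one hq).2 (Nat.cast_lt.2 hnq))
  set κ := ((n : ℝ) - m) / (S.q * ((s : ℝ) - 1)) with hκ
  have hκ0 : 0 < κ := rate_pos hs hmn
  set b := lam / 2 with hb
  set a := |γ| + 1 with ha
  have ha0 : 0 < a := by positivity
  obtain ⟨M, hM0, hM1, hM⟩ : ∃ M : ℝ, 0 < M ∧ M ≤ 1 ∧ a * M < -b :=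
    exists_pos_le_one_mul_lt ha0 (by linarith)
  have h1 : M ^ (s - 1) ≤ M := pow_le_of_le_one hM0.le hM1 (by omega)
  have h2 := mul_le_mul_of_nonneg_left h1 ha0.le
  -- Below the barrier the nonlinear term is at most `a M^{s-1} t^{-ν} V`, so `β` is the net linear
  -- damping. The barrier condition holds for late times because `t^{1-ν}` is unbounded.
  set β := -(a * M ^ (s - 1) + b) with hβ
  have hβ0 : 0 < β := by linarith
  have hev : ∀ᶠ t : ℝ in atTop, κ < β * t ^ (1 - ν) :=
    ((tendsto_rpow_atTop hν1).const_mul_atTop hβ0).eventually_gt_atTop κ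
  have hγa : γ < a := by linarith [le_abs_self γ]
  have hlb : lam < b := by linarith
  have hst := (A.polynomiallyStable_of_decay hm hmn hs hzero hLm hLj hLn hγa hlb le_rfl
    (Or.inl rfl) hM0 hκ0 (rate_mul hs n) hev).1
  obtain ⟨r, hr, T₁, hT₁, h⟩ := A.exists_lyap_decay hm hmn hs hzero hLm hLj hLn hγa hlb le_rfl
    (Or.inl rfl) hM0 (rate_mul hs n) hev
  -- Taking square roots halves the rate and turns the product `8 * 2` of the comparison constants
  -- into `4`.
  refine exponentiallyStable_of_late (r := r) (c := β / (1 - ν) / 2) (T₁ := T₁) (C := 4) hst hr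
    hν1.le (by positivity) (by norm_num) fun T hT => ?_
  obtain ⟨δ, hδ, H⟩ := h T hT
  refine ⟨δ, hδ, fun t₁ ht₁ z hz hz0 hzr => ?_⟩
  obtain ⟨V, D, hVD⟩ := H t₁ z hz hz0 hzr
  have ht0 : ∀ t ∈ Icc T t₁, 0 < t := fun t ht => by linarith [ht.1]
  have key := le_mul_exp_of_deriv_le (g := fun t => β / (1 - ν) * t ^ (1 - ν))
    (g' := fun t => β * t ^ (-ν)) ht₁ (fun t ht => (hVD t ht).2.2.1) (fun t ht => ?_)
    (fun t ht => ?_)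
  · have h3 := hVD t₁ ⟨ht₁, le_rfl⟩
    have h4 := hVD T ⟨le_rfl, ht₁⟩
    refine (sq_le_sq₀ (planeNorm_nonneg _) (mul_nonneg (mul_nonneg (by norm_num)
      (planeNorm_nonneg _)) (Real.exp_pos _).le)).1 ?_
    have h5 : Real.exp (-(β / (1 - ν) / 2) * (t₁ ^ (1 - ν) - T ^ (1 - ν))) ^ 2
        = Real.exp (β / (1 - ν) * T ^ (1 - ν) - β / (1 - ν) * t₁ ^ (1 - ν)) := by
      rw [← Real.exp_nat_mul]; congr 1; push_cast; ring
    rw [mul_pow, h5, mul_pow]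
    have h6 := mul_le_mul_of_nonneg_right h4.2.1
      (Real.exp_pos (β / (1 - ν) * T ^ (1 - ν) - β / (1 - ν) * t₁ ^ (1 - ν))).le
    linarith [h3.1]
  · refine ((Real.hasDerivAt_rpow_const (p := 1 - ν)
      (Or.inl (ht0 t ht).ne')).const_mul (β / (1 - ν))).congr_deriv ?_
    rw [show 1 - ν - 1 = -ν by ring]
    field_simp
  · obtain ⟨h3, -, -, h4, h5⟩ := hVD t ht
    have hV0 : 0 ≤ V t := by linarith [sq_nonneg (planeNorm (z t))]
    have h6 := mul_rpow_neg_pow (M := M) (ht0 t ht) (by omega : 1 ≤ s)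
      (rate_mul (S := S) (m := m) hs n)
    have h7 : t ^ (-((m : ℝ) / S.q)) * V t ^ (s - 1) ≤ M ^ (s - 1) * t ^ (-ν) := by
      rw [← h6]
      exact mul_le_mul_of_nonneg_left (pow_le_pow_left₀ hV0 h5 _) (Real.rpow_nonneg (ht0 t ht).le _)
    have h8 : t ^ (-((m : ℝ) / S.q)) * V t ^ s ≤ M ^ (s - 1) * t ^ (-ν) * V t := by
      rw [show V t ^ s = V t ^ (s - 1) * V t by
        rw [← pow_succ, Nat.sub_add_cancel (by omega : 1 ≤ s)], ← mul_assoc]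
      exact mul_le_mul_of_nonneg_right h7 hV0
    have h9 := mul_le_mul_of_nonneg_left h8 ha0.le
    refine h4.trans ?_
    simp only [hβ]
    linarith

/-- When all time-dependent terms are integrable in time the equilibrium is stable. -/
theorem stable_of_le (A : S.EnergyAngle) (hm : 1 ≤ m) (hmn : m < n) (hs : 2 ≤ s)
    (hzero : ∀ k, 1 ≤ k → k < m → ∀ w ∈ Ioo 0 A.E₀, A.Lam k w = 0)
    (hLm : (fun w : ℝ => A.Lam m w - γ * w ^ s) =O[𝓝[>] 0] (fun w : ℝ => w ^ (s + 1)))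
    (hLj : ∀ j, m ≤ j → j < n → A.Lam j =O[𝓝[>] 0] (fun w : ℝ => w ^ s))
    (hLn : (fun w : ℝ => A.Lam n w - lam * w) =O[𝓝[>] 0] (fun w : ℝ => w ^ 2))
    (hqm : S.q ≤ m) (hγ : γ < 0) : S.Stable := by
  have hq : (0 : ℝ) < S.q := Nat.cast_pos.2 S.q_pos
  set b := |lam| + 1 with hb
  have hb0 : 0 < b := by positivity
  -- Here `a = 0`, which `γ < 0` permits, and `l = q + 1 ≤ n`. The remaining coefficient `b
  -- t^{-(q+1)/q}` has integral at most `b q` over `[1, ∞)`, hence the growth factor `K`.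
  obtain ⟨r, hr, T₁, hT₁, h⟩ := A.exists_lyap_ineq hm hmn hs hzero hLm hLj hLn hγ
    (b := b) (by linarith [le_abs_self lam]) (l := S.q + 1) (by omega) (Or.inr hb0.le)
  set K := Real.exp (b * S.q) with hK
  have hK1 : 1 ≤ K := Real.one_le_exp (by positivity)
  have hK0 : 0 < K := by linarith
  refine stable_of_late hr fun ε hε => ⟨T₁, fun T hT => ⟨ε / (4 * K), by positivity,
    fun t₁ ht₁ z hz hz0 hzr => ?_⟩⟩
  obtain ⟨V, D, hVD⟩ := h T hT t₁ z hz hzr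
  have ht0 : ∀ t ∈ Icc T t₁, 0 < t := fun t ht => by linarith [ht.1]
  have hT0 : 0 < T := ht0 T ⟨le_rfl, ht₁⟩
  have key := le_mul_exp_of_deriv_le (g := fun t => b * S.q * t ^ (-(1 / (S.q : ℝ))))
    (g' := fun t => -b * t ^ (-(((S.q + 1 : ℕ) : ℝ) / S.q))) ht₁ (fun t ht => (hVD t ht).2.2.1)
    (fun t ht => ?_) (fun t ht => ?_)
  · have h3 := hVD t₁ ⟨ht₁, le_rfl⟩
    have h4 := hVD T ⟨le_rfl, ht₁⟩
    have hVT : 0 ≤ V T := by linarith [sq_nonneg (planeNorm (z T))]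
    have h5 : T ^ (-(1 / (S.q : ℝ))) ≤ 1 :=
      Real.rpow_le_one_of_one_le_of_nonpos (hT₁.trans hT) (by simp)
    have h6 : 0 ≤ t₁ ^ (-(1 / (S.q : ℝ))) := Real.rpow_nonneg (hT0.le.trans ht₁) _
    have h7 : Real.exp (b * S.q * T ^ (-(1 / (S.q : ℝ))) - b * S.q * t₁ ^ (-(1 / (S.q : ℝ))))
        ≤ K := by
      refine Real.exp_le_exp.2 ?_
      have : 0 < b * S.q := by positivity
      nlinarith
    have h8 : V t₁ ≤ V T * K := key.trans (mul_le_mul_of_nonneg_left h7 hVT)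
    have h9 : 4 * K * planeNorm (z T) < ε := by
      rw [lt_div_iff₀ (by positivity)] at hz0
      linarith
    refine (sq_lt_sq₀ (planeNorm_nonneg _) hε.le).1 ?_
    calc planeNorm (z t₁) ^ 2 ≤ 16 * planeNorm (z T) ^ 2 * K := by
          linarith [h3.1, mul_le_mul_of_nonneg_right h4.2.1 hK0.le]
      _ ≤ 16 * planeNorm (z T) ^ 2 * (K * K) := by
          refine mul_le_mul_of_nonneg_left ?_ (by positivity)
          exact le_mul_of_one_le_left hK0.le hK1
      _ = (4 * K * planeNorm (z T)) ^ 2 := by ring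
      _ < ε ^ 2 := pow_lt_pow_left₀ h9
          (mul_nonneg (by positivity) (planeNorm_nonneg _)) two_ne_zero
  · refine ((Real.hasDerivAt_rpow_const (p := -(1 / (S.q : ℝ)))
      (Or.inl (ht0 t ht).ne')).const_mul (b * S.q)).congr_deriv ?_
    rw [show -(1 / (S.q : ℝ)) - 1 = -(((S.q + 1 : ℕ) : ℝ) / S.q) by push_cast; field_simp; ring]
    field_simp
  · have h4 := (hVD t ht).2.2.2
    rw [zero_mul, zero_add] at h4
    linarith

end AsympHamSystem.EnergyAngle

theorem mainTheorem6 (S : AsympHamSystem) (A : S.EnergyAngle)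
    (m n s : ℕ) (hm : 1 ≤ m) (hmn : m < n) (hs : 2 ≤ s)
    (γ lam : ℝ) (hγ : γ ≠ 0) (hlam : lam ≠ 0)
    (hzero : ∀ k, 1 ≤ k → k < m → ∀ w ∈ Ioo 0 A.E₀, A.Lam k w = 0)
    (hLm : (fun w : ℝ => A.Lam m w - γ * w ^ s) =O[𝓝[>] 0] (fun w : ℝ => w ^ (s + 1)))
    (hLj : ∀ j, m ≤ j → j < n → A.Lam j =O[𝓝[>] 0] (fun w : ℝ => w ^ s))
    (hLn : (fun w : ℝ => A.Lam n w - lam * w) =O[𝓝[>] 0] (fun w : ℝ => w ^ 2)) :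
    (n < S.q →
      (lam < 0 → S.ExponentiallyStable (1 - (n : ℝ) / (S.q : ℝ))) ∧
      (0 < lam → γ < 0 → S.PolynomiallyStable)) ∧
    (n = S.q →
      (lam + ((n : ℝ) - (m : ℝ)) / ((S.q : ℝ) * ((s : ℝ) - 1)) < 0 → S.PolynomiallyStable) ∧
      (0 < lam + ((n : ℝ) - (m : ℝ)) / ((S.q : ℝ) * ((s : ℝ) - 1)) → γ < 0 →
        S.PolynomiallyStable)) ∧
    (m < S.q → S.q < n → γ < 0 → S.PolynomiallyStable) ∧
    (S.q ≤ m → γ < 0 → S.Stable) := by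
  refine ⟨fun hnq => ⟨fun h => ?_, fun _ hγ => ?_⟩, fun hnq => ⟨fun h => ?_, fun _ hγ => ?_⟩,
    fun hmq _ hγ => ?_, fun hqm hγ => ?_⟩
  · exact A.exponentiallyStable_of_neg hm hmn hs hzero hLm hLj hLn hnq h
  · exact A.polynomiallyStable_of_neg hm hmn hs hzero hLm hLj hLn (hmn.trans hnq) hγ
  · exact A.polynomiallyStable_of_eq hm hmn hs hzero hLm hLj hLn hnq h
  · exact A.polynomiallyStable_of_neg hm hmn hs hzero hLm hLj hLn (hmn.trans_eq hnq) hγ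
  · exact A.polynomiallyStable_of_neg hm hmn hs hzero hLm hLj hLn hmq hγ
  · exact A.stable_of_le hm hmn hs hzero hLm hLj hLn hqm hγ
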